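/- **Timescales of complexity recurrences.** Let $q\ge 2$, $n\ge 1$, $d=q^n$, $\mathcal H=(\mathbb C^q)^{\otimes n}$. Unitary channels $\rho\mapsto U\rho U^\dagger$ are represented by unitary operators up to a global phase, with distance $\mathrm d(U,V)=\min_\varphi\|U-e^{i\varphi}V\|_\infty$; pure states are rank-one projectors, with distance $\mathrm d(\psi,\phi)=\frac12\|\psi-\phi\|_1$. $\mathrm{Vol}(R)$ and $\mathrm{Vol}_{\mathsf S}(R)$ are the volumes of closed balls $B(\cdot,R)$ of radius $R$ for the Haar measure on unitaries and for the measure it induces on pure states. For $0<\alpha\le 1\le\beta$, a probability measure $\nu$ on unitaries is $(\alpha,\beta)$-equidistributed at scale $\varepsilon$ if $\mathrm{Vol}(\alpha R)\le\nu(B(V,R))\le\mathrm{Vol}(\beta R)$ for all $V$ and all $R\ge\varepsilon$; for measures on pure states use $\mathrm{Vol}_{\mathsf S}$. Let $\mathcal G$ be a finite set of unitaries (gates), for instance a universal gate set, let $\mathcal G^l$ be the set of products of $l$ gates ($\mathcal G^0=\{I\}$), and let $\psi_0$ be a pure state, for instance $|0\rangle\langle 0|^{\otimes n}$. $C_\varepsilon(U)$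 (resp. $C_\varepsilon(\psi)$) is the least $l$ such that $\mathrm d(U,W)\le\varepsilon$ (resp. $\mathrm d(\psi,W(\psi_0))\le\varepsilon$) for some $W\in\mathcal G^l$ ($+\infty$ if there is none). Let $\nu$ be a probability measure on unitaries, $V^{(1)},V^{(2)},\dots$ i.i.d. with law $\nu$, $U_t=V^{(t)}\cdots V^{(1)}$ ($U_0=I$) and $\psi_t=U_t(\psi_0)$. Put $c_o=\frac1{9\pi}$, $c^o=87$. **Unitary channels.** 1. Let $|\mathcal G|\ge 2$, $\varepsilon\in(0,\frac14)$, $\Delta\in(0,1)$, and let $T$ be such that $\nu^{*T}$ is $(\alpha,\beta)$-equidistributed at scale $\varepsilon$ with $\Gamma=\max\{1-\alpha,\beta-1\}\le\frac{\Delta}{6}(c_o/3)^{d^2-1}$. Then for every integer $t>2T$ and $$r=\frac{(d^2-1)\log\frac1{c^o\beta\varepsilon}-\log\frac2\Delta}{\log|\mathcal G|}$$ we have $\Pr(C_\varepsilon(U_t)=0)>0$ and $$\Pr\big(C_\varepsilon(U_{t-T})>r,\ C_\varepsilon(U_{t+T})>r\ \big|\ C_\varepsilon(U_t)=0\big)\ge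 1-\tfrac32\Delta .$$ 2. Let $\varepsilon\in(0,\frac14)$. If for $\nu$-almost every $V$ both $V$ and $V^{-1}$ equal, up to a global phase, a product of at most $k$ gates of $\mathcal G$, then almost surely, for all $t$ with $C_\varepsilon(U_t)=0$ and all $m\ge0$, $C_\varepsilon(U_{t+m})\le k\,m$, and $C_\varepsilon(U_{t-m})\le k\,m$ if $m\le t$. 3. For every $q\ge2$, $\kappa\in\mathbb N$, $\Delta_0>0$ and $0<\varepsilon_0<1/c^o$ there are $c_1,c_2>0$ and $n_0$ such that, for all $n\ge n_0$, all $\varepsilon\in(0,\varepsilon_0]$, all $\Delta\in[\Delta_0,1)$ and all $k\ge1$ with $k\le n^\kappa$, $2\le|\mathcal G|\le n^\kappa$, if the hypotheses of 1 and 2 hold, then for $t>2T$ and $r$ as in 1 $$e^{c_1n}\log\tfrac1\varepsilon\le \tfrac rk\le e^{c_2n}\log\tfrac1\varepsilon ,$$ and, conditioned on $C_\varepsilon(U_t)=0$, with probability at least $1-\frac32\Delta$ both the least $m$ with $C_\varepsilon(U_{t+m})>r$ and the least $m\le t$ with $C_\varepsilon(U_{t-m})>r$ exist and lie in $[\frac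 rk,T]$. So typical recurrence dips last between $e^{\Theta(n)}\log(1/\varepsilon)$ and $T$ steps. **Pure states.** The same three assertions hold for $\psi_t$ in place of $U_t$, with these changes: in 1 and 3, $|\mathcal G|\ge3$ is assumed; the hypothesis on $T$ is that for every pure state $\phi$ the law of $V(\phi)$, $V\sim\nu^{*T}$, is $(\alpha,\beta)$-equidistributed on pure states at scale $\varepsilon$, with $\max\{1-\alpha,\beta-1\}\le\frac{\Delta}{24d}$; $r$ is replaced by $$r_{\mathsf S}=\frac{(2d-2)\log\frac1{\beta\varepsilon}-\log\frac2\Delta}{\log|\mathcal G|}\,;$$ and in 3 all $\varepsilon\in(0,\frac14)$ are allowed (no $\varepsilon_0$). -/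

import Mathlib

open MeasureTheory Matrix
open scoped ENNReal Pointwise

noncomputable section

namespace Recurrence

/-! ## Unitaries and pure states of `n` qudits of local dimension `q` -/

/-- Labels of the computational basis of `(ℂ^q)^{⊗ n}`; there are `q ^ n` of them. -/
abbrev Basis (q n : ℕ) : Type := Fin n → Fin q

/-- Unitary operators on `(ℂ^q)^{⊗ n}`. A unitary channel `ρ ↦ U ρ U†` is represented by any of the
operators `exp (i φ) U`; all notions below only see operators up to a global phase. -/
abbrev UnitaryOp (q n : ℕ) : Type := Matrix.unitaryGroup (Basis q n) ℂ

/-- The operator norm (largest singular value) of a matrix. -/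
def opNorm {N : Type*} [Fintype N] [DecidableEq N] (A : Matrix N N ℂ) : ℝ :=
  ‖Matrix.toEuclideanCLM (𝕜 := ℂ) A‖

/-- The trace norm (sum of the singular values) of a matrix. -/
def traceNorm {N : Type*} [Fintype N] [DecidableEq N] (A : Matrix N N ℂ) : ℝ :=
  ∑ i, Real.sqrt ((Matrix.isHermitian_conjTranspose_mul_self A).eigenvalues i)

/-- Pure states: the rank-one projectors `|v⟩⟨v|` with `v` a unit vector. -/
def PureState (q n : ℕ) : Type :=
  {ρ : Matrix (Basis q n) (Basis q n) ℂ //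
    ∃ v : Basis q n → ℂ, star v ⬝ᵥ v = 1 ∧ ρ = Matrix.vecMulVec v (star v)}

instance (q n : ℕ) : TopologicalSpace (PureState q n) := instTopologicalSpaceSubtype

instance (q n : ℕ) : MeasurableSpace (UnitaryOp q n) := borel _
instance (q n : ℕ) : BorelSpace (UnitaryOp q n) := ⟨rfl⟩
instance (q n : ℕ) : MeasurableSpace (PureState q n) := borel _
instance (q n : ℕ) : BorelSpace (PureState q n) := ⟨rfl⟩

/-- The action `ψ ↦ U ψ U†` of a unitary channel on a pure state. -/
def applyState {q n : ℕ} (U : UnitaryOp q n) (ψ : PureState q n) : PureState q n :=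
  ⟨(U : Matrix _ _ ℂ) * ψ.1 * (U : Matrix _ _ ℂ)ᴴ, by
    obtain ⟨ρ, v, hv, rfl⟩ := ψ
    refine ⟨(U : Matrix _ _ ℂ) *ᵥ v, ?_, ?_⟩
    · have hU : (U : Matrix (Basis q n) (Basis q n) ℂ)ᴴ * (U : Matrix _ _ ℂ) = 1 :=
        Matrix.UnitaryGroup.star_mul_self U
      rw [Matrix.star_mulVec, Matrix.dotProduct_mulVec, Matrix.vecMul_vecMul, hU,
        Matrix.vecMul_one, hv]
    · rw [Matrix.star_mulVec, Matrix.mul_vecMulVec, Matrix.vecMulVec_mul]⟩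

/-- `d(U, V) = min_φ ‖U - exp (i φ) V‖`, the distance of unitary channels. -/
def unitDist {q n : ℕ} (U V : UnitaryOp q n) : ℝ :=
  ⨅ z : Circle, opNorm ((U : Matrix (Basis q n) (Basis q n) ℂ) - (z : ℂ) • (V : Matrix _ _ ℂ))

/-- The trace distance `‖ψ - φ‖₁ / 2` of pure states. -/
def stateDist {q n : ℕ} (ψ φ : PureState q n) : ℝ :=
  1 / 2 * traceNorm (ψ.1 - φ.1)

/-- The closed ball `B(V, R)` of unitary channels. -/
def unitBall {q n : ℕ} (V : UnitaryOp q n) (R : ℝ) : Set (UnitaryOp q n) := {U | unitDist U V ≤ R}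

/-- The closed ball `B(ψ, R)` of pure states. -/
def stateBall {q n : ℕ} (ψ : PureState q n) (R : ℝ) : Set (PureState q n) :=
  {φ | stateDist φ ψ ≤ R}

/-! ## Haar measure and approximate equidistribution -/

instance (q n : ℕ) : CompactSpace (UnitaryOp q n) := by
  have hc : IsCompact {A : Matrix (Basis q n) (Basis q n) ℂ |
      A ∈ Matrix.unitaryGroup (Basis q n) ℂ} := by
    have hsub : {A : Matrix (Basis q n) (Basis q n) ℂ |
        A ∈ Matrix.unitaryGroup (Basis q n) ℂ} ⊆
        Set.univ.pi (fun _ => Set.univ.pi (fun _ => Metric.closedBall (0 : ℂ) 1)) := by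
      intro A hA i _ j _
      rw [mem_closedBall_zero_iff]
      exact entry_norm_bound_of_unitary hA i j
    have hclosed : IsClosed {A : Matrix (Basis q n) (Basis q n) ℂ |
        A ∈ Matrix.unitaryGroup (Basis q n) ℂ} := by
      have : {A : Matrix (Basis q n) (Basis q n) ℂ | A ∈ Matrix.unitaryGroup (Basis q n) ℂ} =
          {A | A * star A = 1} := by
        ext A; exact Matrix.mem_unitaryGroup_iff
      rw [this]
      exact isClosed_eq (by fun_prop) continuous_const
    exact IsCompact.of_isClosed_subset
      (isCompact_univ_pi fun _ => isCompact_univ_pi fun _ => isCompact_closedBall _ _)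
      hclosed hsub
  exact isCompact_iff_compactSpace.mp hc

/-- The normalized Haar measure on the unitary group. -/
def haarUnit (q n : ℕ) : Measure (UnitaryOp q n) := Measure.haarMeasure ⊤

/-- The measure induced on pure states by a measure `ν` on unitaries and a reference state `φ`. -/
def stateMeasure {q n : ℕ} (ν : Measure (UnitaryOp q n)) (φ : PureState q n) :
    Measure (PureState q n) :=
  ν.map (fun U => applyState U φ)

/-- `Vol(R)`: the Haar measure of a ball of radius `R` of unitary channels. -/
def unitVol (q n : ℕ) (R : ℝ) : ℝ≥0∞ := haarUnit q n (unitBall 1 R)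

/-- The volume of the ball of radius `R` around the pure state `ψ`, for the invariant probability
measure on pure states (the one induced by the Haar measure). -/
def stateVol {q n : ℕ} (ψ : PureState q n) (R : ℝ) : ℝ≥0∞ :=
  stateMeasure (haarUnit q n) ψ (stateBall ψ R)

/-- `ν` is `(α, β)`-equidistributed on unitary channels at the scale `ε`. -/
def UnitEquidistributed {q n : ℕ} (α β ε : ℝ) (ν : Measure (UnitaryOp q n)) : Prop :=
  0 < α ∧ α ≤ 1 ∧ 1 ≤ β ∧ ∀ (V : UnitaryOp q n) (R : ℝ), ε ≤ R →
    unitVol q n (α * R) ≤ ν (unitBall V R) ∧ ν (unitBall V R) ≤ unitVol q n (β * R)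

/-- `νS` is `(α, β)`-equidistributed on pure states at the scale `ε`. -/
def StateEquidistributed {q n : ℕ} (α β ε : ℝ) (νS : Measure (PureState q n)) : Prop :=
  0 < α ∧ α ≤ 1 ∧ 1 ≤ β ∧ ∀ (ψ : PureState q n) (R : ℝ), ε ≤ R →
    stateVol ψ (α * R) ≤ νS (stateBall ψ R) ∧ νS (stateBall ψ R) ≤ stateVol ψ (β * R)

/-! ## Circuits and complexity -/

/-- The circuits of size `l` over the gate set `G`: the products of `l` elements of `G`. -/
def circuits {q n : ℕ} (G : Finset (UnitaryOp q n)) (l : ℕ) : Set (UnitaryOp q n) :=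
  (G : Set (UnitaryOp q n)) ^ l

/-- `C_ε(U)`: the least `l` such that some circuit of size `l` is `ε`-close to `U`
(`⊤` if there is none, which does not happen for a universal gate set and `ε > 0`). -/
def unitComplexity {q n : ℕ} (G : Finset (UnitaryOp q n)) (ε : ℝ) (U : UnitaryOp q n) : ℕ∞ :=
  ⨅ l ∈ {l : ℕ | ∃ W ∈ circuits G l, unitDist U W ≤ ε}, (l : ℕ∞)

/-- `C_ε(ψ)`: the least `l` such that some circuit of size `l` maps the initial state `ψ₀` to a
state that is `ε`-close to `ψ`. -/
def stateComplexity {q n : ℕ} (G : Finset (UnitaryOp q n)) (ψ₀ : PureState q n) (ε : ℝ)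
    (ψ : PureState q n) : ℕ∞ :=
  ⨅ l ∈ {l : ℕ | ∃ W ∈ circuits G l, stateDist ψ (applyState W ψ₀) ≤ ε}, (l : ℕ∞)

/-- The channel of `V` is exactly (so, up to a global phase) a circuit of at most `k` gates. -/
def ExactlyImplementable {q n : ℕ} (G : Finset (UnitaryOp q n)) (k : ℕ) (V : UnitaryOp q n) : Prop :=
  ∃ l ≤ k, ∃ W ∈ circuits G l, unitDist V W = 0

/-! ## Random walks -/

/-- The convolution power `ν^{*t}`. -/
def convPow {q n : ℕ} (ν : Measure (UnitaryOp q n)) : ℕ → Measure (UnitaryOp q n)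
  | 0 => Measure.dirac 1
  | t + 1 => ν.mconv (convPow ν t)

/-- The law of an i.i.d. sequence of steps distributed according to `ν`. -/
def stepsLaw {q n : ℕ} (ν : Measure (UnitaryOp q n)) : Measure (ℕ → UnitaryOp q n) :=
  Measure.infinitePi (fun _ => ν)

/-- The walk `U_t = V^{(t)} ⋯ V^{(1)}` with steps `ω`, started at the identity. -/
def walk {q n : ℕ} (ω : ℕ → UnitaryOp q n) : ℕ → UnitaryOp q n
  | 0 => 1
  | t + 1 => ω t * walk ω t

/-- The walk `ψ_t = U_t(ψ₀)` on pure states. -/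
def stateWalk {q n : ℕ} (ψ₀ : PureState q n) (ω : ℕ → UnitaryOp q n) (t : ℕ) : PureState q n :=
  applyState (walk ω t) ψ₀

/-- The complexities `C_ε(U_t)` along the walk. -/
def unitTrajectory {q n : ℕ} (G : Finset (UnitaryOp q n)) (ε : ℝ) (ω : ℕ → UnitaryOp q n) (t : ℕ) : ℕ∞ :=
  unitComplexity G ε (walk ω t)

/-- The complexities `C_ε(ψ_t)` along the walk. -/
def stateTrajectory {q n : ℕ} (G : Finset (UnitaryOp q n)) (ψ₀ : PureState q n) (ε : ℝ)
    (ω : ℕ → UnitaryOp q n) (t : ℕ) : ℕ∞ :=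
  stateComplexity G ψ₀ ε (stateWalk ψ₀ ω t)

/-! ## Thresholds and durations of dips -/

/-- Extended natural numbers as extended reals, for comparison with real thresholds. -/
def natEReal (x : ℕ∞) : EReal := ((x : ℝ≥0∞) : EReal)

/-- The number of steps after time `t` until the complexity `C` first exceeds `r`
(`⊤` if it never does). -/
def dipAfter (C : ℕ → ℕ∞) (r : ℝ) (t : ℕ) : ℕ∞ :=
  ⨅ m ∈ {m : ℕ | (r : EReal) < natEReal (C (t + m))}, (m : ℕ∞)

/-- The number of steps before time `t` since the complexity `C` last exceeded `r`
(`⊤` if it never did). -/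
def dipBefore (C : ℕ → ℕ∞) (r : ℝ) (t : ℕ) : ℕ∞ :=
  ⨅ m ∈ {m : ℕ | m ≤ t ∧ (r : EReal) < natEReal (C (t - m))}, (m : ℕ∞)

/-- A dip of the complexity `C` below `r` around time `t` lasts between `L` and `T` steps, on both
sides of `t`. -/
def DipLasts (C : ℕ → ℕ∞) (r : ℝ) (t : ℕ) (L : ℝ) (T : ℕ) : Prop :=
  ((L : EReal) ≤ natEReal (dipBefore C r t) ∧ dipBefore C r t ≤ (T : ℕ∞)) ∧
    ((L : EReal) ≤ natEReal (dipAfter C r t) ∧ dipAfter C r t ≤ (T : ℕ∞))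

/-- The constant `c_o` of the lower volume bound `(c_o ε)^(d² - 1) ≤ Vol(ε)`. -/
def cLow : ℝ := 1 / (9 * Real.pi)

/-- The constant `c^o` of the upper volume bound `Vol(ε) ≤ (c^o ε)^(d² - 1)`. -/
def cUp : ℝ := 87

/-- The threshold `r` for unitary channels in dimension `d`, for a set of `g` gates. -/
def unitThreshold (d g : ℕ) (β ε Δ : ℝ) : ℝ :=
  (((d : ℝ) ^ 2 - 1) * Real.log (1 / (cUp * β * ε)) - Real.log (2 / Δ)) / Real.log g

/-- The threshold `r_S` for pure states in dimension `d`, for a set of `g` gates. -/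
def stateThreshold (d g : ℕ) (β ε Δ : ℝ) : ℝ :=
  ((2 * (d : ℝ) - 2) * Real.log (1 / (β * ε)) - Real.log (2 / Δ)) / Real.log g

end Recurrence

end

open MeasureTheory Matrix
open scoped ENNReal Pointwise

noncomputable section

namespace Recurrence

variable {q n : ℕ}

/-! ## The Haar measure -/

/-! Both walks are orbits of a point `x₀` in a space `X`: the unitary group under left
multiplication with `x₀ = 1`, or the pure states. Let `B` be the `ε`-ball around `x₀`, that is,
complexity zero, and `S` the set of points within `ε` of the image of `x₀` under at most `r` gates.
Suppose that from every point `T` steps lead into `S` with probability at most `p`, and into `B`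
with probability between `va` and `ρ * va`. Disjoint blocks of steps are independent. At time `t - T
> T` the walk is in `S` with probability at most `p`, and from there it is in `B` at time `t` with
probability at most `ρ * va`, while being in `B` has total probability at least `va`. So given the
return, the past lies in `S` with probability at most `p * ρ`, and the next `T` steps miss `S` with
probability at least `1 - p` whatever came before. This gives `(1 - p) * (1 - p * ρ)`; see
`le_cond_notMem_of_forall_le`.

The bound `p` comes from a union bound over circuits: a geometric sum times the volume of a ball of
radius `β * ε`. The threshold `r` makes this product at most a small multiple of `Δ`. The ratio `ρ`
compares the volumes at `β * ε` and `α * ε`.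

For unitaries, the Cayley transform `A ↦ (1 + iA)(1 - iA)⁻¹` is bi-Lipschitz near `0` from the
self-adjoint matrices, a real space of dimension `d ^ 2`. Packings there yield the volume bound
`unitVol_le`, in which the global phase costs one dimension, and the doubling bound
`unitVol_le_mul_unitVol`. The resulting `ρ = 4 ^ d ^ 2` is crude, but `p` decays like `(4 / 87) ^ (d
^ 2 - 1)` and absorbs it.

For pure states the volume is exactly `R ^ (2 * (d - 1))` (`stateVol_eq`): the ball corresponds to a
cone whose Gaussian measure is computable and unitarily invariant. Here `ρ` is close to `1`.

For the duration, each step and its inverse cost at most `k` gates, so leaving complexity `0` for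
more than `r` takes at least `r / k` steps, and this has happened by distance `T` in time. Finally
`r / k` is exponential in `n`, since its numerator grows at least like `2 ^ n * log (1 / ε)` while
`log |G|` and `k` are at most polynomial. -/

open scoped Matrix.Norms.L2Operator in
instance : SecondCountableTopology (UnitaryOp q n) := inferInstance

instance : (haarUnit q n).IsHaarMeasure := by unfold haarUnit; infer_instance

instance : IsProbabilityMeasure (haarUnit q n) :=
  ⟨by simpa [haarUnit] using Measure.haarMeasure_self (K₀ := (⊤ : TopologicalSpace.PositiveCompacts
    (UnitaryOp q n)))⟩

/-- A right translate of Haar measure is again a Haar probability measure, so uniqueness applies.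
Right invariance serves to move the vector on which a random unitary acts. -/
instance : (haarUnit q n).IsMulRightInvariant where
  map_mul_right_eq_self g := by
    have : IsProbabilityMeasure ((haarUnit q n).map (· * g)) :=
      Measure.isProbabilityMeasure_map (by fun_prop)
    have : ((haarUnit q n).map (· * g)).IsHaarMeasure :=
      Measure.isHaarMeasure_map_mul_right _ _
    exact Measure.isHaarMeasure_eq_of_isProbabilityMeasure _ _

/-! ## The random walk -/

section Walk

variable (ν : Measure (UnitaryOp q n)) [IsProbabilityMeasure ν]

instance (t : ℕ) : IsProbabilityMeasure (convPow ν t) := by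
  induction t with
  | zero => unfold convPow; infer_instance
  | succ t ih =>
    unfold convPow Measure.mconv
    exact Measure.isProbabilityMeasure_map measurable_mul.aemeasurable

instance : IsProbabilityMeasure (stepsLaw ν) := by unfold stepsLaw; infer_instance

/-- Prepending an independent step to an i.i.d. sequence reproduces its law, as cylinder sets show;
splitting into head and tail undoes this. -/
theorem map_stepsLaw_head_tail :
    (stepsLaw ν).map (fun ω => (ω 0, fun i => ω (i + 1))) = ν.prod (stepsLaw ν) := by
  let cons : UnitaryOp q n × (ℕ → UnitaryOp q n) → ℕ → UnitaryOp q n :=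
    fun x i => Nat.casesOn i x.1 x.2
  have hcons : Measurable cons := by
    refine measurable_pi_lambda _ fun i => ?_
    cases i with
    | zero => exact measurable_fst
    | succ i => exact (measurable_pi_apply i).comp measurable_snd
  have key : (ν.prod (stepsLaw ν)).map cons = stepsLaw ν := by
    refine Measure.eq_infinitePi _ fun s t ht => ?_
    classical
    -- Trivial constraints outside `s` turn the cylinder into one over an initial segment of
    -- indices, from which the factor at `0` splits off.
    let t' : ℕ → Set (UnitaryOp q n) := fun i => if i ∈ s then t i else Set.univ
    have ht' : ∀ i, MeasurableSet (t' i) := fun i => by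
      by_cases h : i ∈ s <;> simp [t', h, ht]
    obtain ⟨M, hM⟩ : ∃ M, s ⊆ Finset.range (M + 1) :=
      ⟨s.sup id, fun i hi => Finset.mem_range.2 (Nat.lt_succ_of_le (Finset.le_sup (f := id) hi))⟩
    rw [Measure.map_apply hcons (MeasurableSet.pi s.countable_toSet fun i _ => ht i)]
    have hpre : cons ⁻¹' Set.pi s t =
        t' 0 ×ˢ Set.pi (Finset.range M) (fun i => t' (i + 1)) := by
      ext ⟨v, η⟩
      simp only [Set.mem_preimage, Set.mem_pi, Set.mem_prod, Finset.mem_coe, Finset.mem_range]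
      constructor
      · intro h
        constructor
        · by_cases h0 : 0 ∈ s
          · simpa [t', h0] using! h 0 h0
          · simp [t', h0]
        · intro i _
          by_cases h0 : i + 1 ∈ s
          · simpa [t', h0] using! h (i + 1) h0
          · simp [t', h0]
      · rintro ⟨h1, h2⟩ i hi
        have hiM := Finset.mem_range.1 (hM hi)
        cases i with
        | zero => simpa [t', hi] using! h1
        | succ i => simpa [t', hi] using! h2 i (by omega)
    rw [hpre, Measure.prod_prod, stepsLaw, Measure.infinitePi_pi _ fun i _ => ht' _, mul_comm,
      ← Finset.prod_range_succ' (fun i => ν (t' i)), ← Finset.prod_subset hM]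
    · refine Finset.prod_congr rfl fun i hi => ?_
      simp [t', hi]
    · intro i _ hi
      simp [t', hi]
  have hht : Measurable fun ω : ℕ → UnitaryOp q n => (ω 0, fun i => ω (i + 1)) := by fun_prop
  conv_lhs => rw [← key]
  rw [Measure.map_map hht hcons]
  exact Measure.map_id

theorem measurable_walk (t : ℕ) : Measurable fun ω : ℕ → UnitaryOp q n => walk ω t := by
  induction t with
  | zero => exact measurable_const
  | succ t ih => exact (measurable_pi_apply t).mul ih

/-- The step `ω a` leads from time `a` to time `a + 1`, so the block after time `a` starts at the
index `a` itself. -/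
theorem walk_add (ω : ℕ → UnitaryOp q n) (a b : ℕ) :
    walk ω (a + b) = walk (fun i => ω (a + i)) b * walk ω a := by
  induction b with
  | zero => simp [walk]
  | succ b ih => rw [← add_assoc, walk, walk, ih, mul_assoc]

/-- The Markov property: the present position is independent of the future steps. In the induction,
the head of the future is split off and multiplied into the position. -/
theorem map_walk_shift (t : ℕ) :
    (stepsLaw ν).map (fun ω => (walk ω t, fun i => ω (t + i))) =
      (convPow ν t).prod (stepsLaw ν) := by
  induction t with
  | zero =>
    simp only [walk, zero_add, convPow]
    rw [Measure.dirac_prod]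
  | succ t ih =>
    have hw := measurable_walk (q := q) (n := n) t
    have hm : Measurable fun p : UnitaryOp q n × UnitaryOp q n => p.1 * p.2 := measurable_mul
    let ht : (ℕ → UnitaryOp q n) → UnitaryOp q n × (ℕ → UnitaryOp q n) :=
      fun ω => (ω 0, fun i => ω (i + 1))
    have hht : Measurable ht := by fun_prop
    let g : UnitaryOp q n × UnitaryOp q n × (ℕ → UnitaryOp q n) →
      UnitaryOp q n × (ℕ → UnitaryOp q n) := fun x => (x.2.1 * x.1, x.2.2)
    have hg : Measurable g := by fun_prop
    have hcomp : (fun ω : ℕ → UnitaryOp q n => (walk ω (t + 1), fun i => ω (t + 1 + i))) =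
        g ∘ (Prod.map id ht) ∘ (fun ω => (walk ω t, fun i => ω (t + i))) := by
      funext ω
      simp only [g, ht, walk, Function.comp, Prod.map, id, add_zero, Prod.mk.injEq, true_and]
      exact funext fun i => by rw [add_assoc, add_comm 1 i]
    rw [hcomp, ← Measure.map_map hg ((measurable_id.prodMap hht).comp (by fun_prop)),
      ← Measure.map_map (measurable_id.prodMap hht) (by fun_prop), ih,
      ← Measure.map_prod_map _ _ measurable_id hht, map_stepsLaw_head_tail, Measure.map_id,
      convPow, Measure.mconv]
    -- `convPow` lists the newest step first, since it multiplies on the left, while the walk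
    -- carries the old position first; a swap reconciles them.
    conv_rhs => rw [← Measure.map_id (μ := stepsLaw ν)]
    rw [Measure.map_prod_map _ _ hm measurable_id, ← Measure.prodAssoc_prod,
      ← Measure.prod_swap (μ := convPow ν t) (ν := ν)]
    conv_rhs => rw [← Measure.map_id (μ := stepsLaw ν)]
    rw [Measure.map_prod_map _ _ measurable_swap measurable_id,
      Measure.map_map (hm.prodMap measurable_id) (measurable_swap.prodMap measurable_id),
      Measure.map_map hg (MeasurableEquiv.measurable _)]
    rfl

theorem map_walk (t : ℕ) : (stepsLaw ν).map (fun ω => walk ω t) = convPow ν t := by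
  have h := congrArg Measure.fst (map_walk_shift ν t)
  have hw := measurable_walk (q := q) (n := n) t
  rw [Measure.fst_prod, Measure.fst, Measure.map_map measurable_fst (by fun_prop)] at h
  exact h

theorem map_walk_walk (a b : ℕ) :
    (stepsLaw ν).map (fun ω => (walk ω a, walk (fun i => ω (a + i)) b)) =
      (convPow ν a).prod (convPow ν b) := by
  have ha := measurable_walk (q := q) (n := n) a
  have hb := measurable_walk (q := q) (n := n) b
  rw [← map_walk ν b, ← Measure.map_id (μ := convPow ν a),
    Measure.map_prod_map _ _ measurable_id hb, ← map_walk_shift,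
    Measure.map_map (measurable_id.prodMap hb) (by fun_prop)]
  rfl

theorem map_walk_walk_walk (a b c : ℕ) :
    (stepsLaw ν).map (fun ω => ((walk ω a, walk (fun i => ω (a + i)) b),
      walk (fun i => ω (a + b + i)) c)) =
      ((convPow ν a).prod (convPow ν b)).prod (convPow ν c) := by
  have ha := measurable_walk (q := q) (n := n) a
  have hb := measurable_walk (q := q) (n := n) b
  have hc := measurable_walk (q := q) (n := n) c
  let f : (ℕ → UnitaryOp q n) → UnitaryOp q n × UnitaryOp q n :=
    fun ω => (walk ω b, walk (fun i => ω (b + i)) c)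
  have hf : Measurable f := by
    refine hb.prodMk (hc.comp ?_)
    fun_prop
  have hfl : (stepsLaw ν).map f = (convPow ν b).prod (convPow ν c) := map_walk_walk ν b c
  have hcomp : (fun ω : ℕ → UnitaryOp q n => ((walk ω a, walk (fun i => ω (a + i)) b),
      walk (fun i => ω (a + b + i)) c)) = MeasurableEquiv.prodAssoc.symm ∘ (Prod.map id f) ∘
      (fun ω => (walk ω a, fun i => ω (a + i))) := by
    funext ω
    simp only [f, Function.comp, Prod.map, id, add_assoc]
    rfl
  rw [hcomp, ← Measure.map_map (MeasurableEquiv.measurable _)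
      ((measurable_id.prodMap hf).comp (by fun_prop)),
    ← Measure.map_map (measurable_id.prodMap hf) (by fun_prop), map_walk_shift,
    ← Measure.map_prod_map _ _ measurable_id hf, hfl, Measure.map_id, ← Measure.prodAssoc_prod,
    Measure.map_map (MeasurableEquiv.measurable _) (MeasurableEquiv.measurable _)]
  simp

end Walk

/-! ## Conditioning the walk on a return -/

section Core

variable (ν : Measure (UnitaryOp q n)) [IsProbabilityMeasure ν]
  {X : Type*} [MeasurableSpace X] {act : UnitaryOp q n → X → X}

theorem measurable_walk_shift (a t : ℕ) :
    Measurable fun ω : ℕ → UnitaryOp q n => walk (fun i => ω (a + i)) t :=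
  (measurable_walk t).comp (measurable_pi_lambda _ fun i => measurable_pi_apply (a + i))

theorem stepsLaw_walk_mem_eq_lintegral (hact : Measurable fun x : UnitaryOp q n × X => act x.1 x.2)
    (hmul : ∀ V W x, act (V * W) x = act V (act W x)) {S : Set X} (hS : MeasurableSet S) (x₀ : X)
    {T t : ℕ} (ht : T ≤ t) :
    stepsLaw ν {ω | act (walk ω t) x₀ ∈ S} =
      ∫⁻ W, convPow ν T {V | act V (act W x₀) ∈ S} ∂(convPow ν (t - T)) := by
  obtain ⟨c, rfl⟩ := Nat.exists_eq_add_of_le' ht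
  have hc := measurable_walk (q := q) (n := n) c
  have hm : Measurable fun x : UnitaryOp q n × UnitaryOp q n => act x.2 (act x.1 x₀) :=
    hact.comp (measurable_snd.prodMk (hact.comp (measurable_fst.prodMk measurable_const)))
  have hm' : MeasurableSet {x : UnitaryOp q n × UnitaryOp q n | act x.2 (act x.1 x₀) ∈ S} := hm hS
  rw [Nat.add_sub_cancel]
  calc stepsLaw ν {ω | act (walk ω (c + T)) x₀ ∈ S}
      = (stepsLaw ν).map (fun ω => (walk ω c, walk (fun i => ω (c + i)) T))
          {x | act x.2 (act x.1 x₀) ∈ S} := by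
        rw [Measure.map_apply (hc.prodMk (measurable_walk_shift c T)) hm']
        congr 1
        ext ω
        simp [walk_add, hmul]
    _ = _ := by
        rw [map_walk_walk, Measure.prod_apply hm']
        rfl

/-- With the first `a` steps frozen, the next `T` are fresh, so the bound `vb`, uniform in the
starting point, factors out. -/
theorem stepsLaw_le_mul_stepsLaw (hact : Measurable fun x : UnitaryOp q n × X => act x.1 x.2)
    (hmul : ∀ V W x, act (V * W) x = act V (act W x)) {S B : Set X} (hS : MeasurableSet S)
    (hB : MeasurableSet B) (x₀ : X) {T : ℕ} (a : ℕ) {vb : ℝ≥0∞}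
    (hvb : ∀ x, convPow ν T {V | act V x ∈ B} ≤ vb) :
    stepsLaw ν {ω | act (walk ω a) x₀ ∈ S ∧ act (walk ω (a + T)) x₀ ∈ B} ≤
      vb * stepsLaw ν {ω | act (walk ω a) x₀ ∈ S} := by
  have ha := measurable_walk (q := q) (n := n) a
  have h1 : Measurable fun x : UnitaryOp q n => act x x₀ :=
    hact.comp (measurable_id.prodMk measurable_const)
  have hm : Measurable fun x : UnitaryOp q n × UnitaryOp q n => act x.2 (act x.1 x₀) :=
    hact.comp (measurable_snd.prodMk (h1.comp measurable_fst))
  have h1S : MeasurableSet {W : UnitaryOp q n | act W x₀ ∈ S} := h1 hS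
  have hE : MeasurableSet {x : UnitaryOp q n × UnitaryOp q n |
      act x.1 x₀ ∈ S ∧ act x.2 (act x.1 x₀) ∈ B} :=
    ((h1.comp measurable_fst) hS).inter (hm hB)
  calc stepsLaw ν {ω | act (walk ω a) x₀ ∈ S ∧ act (walk ω (a + T)) x₀ ∈ B}
      = (stepsLaw ν).map (fun ω => (walk ω a, walk (fun i => ω (a + i)) T))
          {x | act x.1 x₀ ∈ S ∧ act x.2 (act x.1 x₀) ∈ B} := by
        rw [Measure.map_apply (ha.prodMk (measurable_walk_shift a T)) hE]
        congr 1
        ext ω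
        simp [walk_add, hmul]
    _ = ∫⁻ W, convPow ν T {V | act W x₀ ∈ S ∧ act V (act W x₀) ∈ B} ∂(convPow ν a) := by
        rw [map_walk_walk, Measure.prod_apply hE]
        rfl
    _ ≤ ∫⁻ W, ({W | act W x₀ ∈ S}.indicator fun _ => vb) W ∂(convPow ν a) := by
        refine lintegral_mono fun W => ?_
        by_cases h : act W x₀ ∈ S
        · simpa [h] using hvb (act W x₀)
        · simp [h]
    _ = vb * stepsLaw ν {ω | act (walk ω a) x₀ ∈ S} := by
        rw [lintegral_indicator_const h1S, ← map_walk, Measure.map_apply ha h1S]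
        rfl

/-- The same for the future: the third block is independent of the first two, and its lower bound
`c` holds from every point they can reach. -/
theorem mul_stepsLaw_le_stepsLaw (hact : Measurable fun x : UnitaryOp q n × X => act x.1 x.2)
    (hmul : ∀ V W x, act (V * W) x = act V (act W x)) {S B C : Set X} (hS : MeasurableSet S)
    (hB : MeasurableSet B) (hC : MeasurableSet C) (x₀ : X) {T : ℕ} (a : ℕ) {c : ℝ≥0∞}
    (hc : ∀ x, c ≤ convPow ν T {V | act V x ∈ C}) :
    c * stepsLaw ν {ω | act (walk ω a) x₀ ∈ S ∧ act (walk ω (a + T)) x₀ ∈ B} ≤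
      stepsLaw ν {ω | (act (walk ω a) x₀ ∈ S ∧ act (walk ω (a + T)) x₀ ∈ B) ∧
        act (walk ω (a + T + T)) x₀ ∈ C} := by
  have ha := measurable_walk (q := q) (n := n) a
  have h1 : Measurable fun x : UnitaryOp q n => act x x₀ :=
    hact.comp (measurable_id.prodMk measurable_const)
  have hm : Measurable fun x : UnitaryOp q n × UnitaryOp q n => act x.2 (act x.1 x₀) :=
    hact.comp (measurable_snd.prodMk (h1.comp measurable_fst))
  have hm3 : Measurable fun x : (UnitaryOp q n × UnitaryOp q n) × UnitaryOp q n =>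
      act x.2 (act x.1.2 (act x.1.1 x₀)) :=
    hact.comp (measurable_snd.prodMk (hm.comp measurable_fst))
  let E : Set (UnitaryOp q n × UnitaryOp q n) := {x | act x.1 x₀ ∈ S ∧ act x.2 (act x.1 x₀) ∈ B}
  have hE : MeasurableSet E := ((h1.comp measurable_fst) hS).inter (hm hB)
  let F : Set ((UnitaryOp q n × UnitaryOp q n) × UnitaryOp q n) :=
    {x | x.1 ∈ E ∧ act x.2 (act x.1.2 (act x.1.1 x₀)) ∈ C}
  have hF : MeasurableSet F := (measurable_fst hE).inter (hm3 hC)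
  calc c * stepsLaw ν {ω | act (walk ω a) x₀ ∈ S ∧ act (walk ω (a + T)) x₀ ∈ B}
      = c * (stepsLaw ν).map (fun ω => (walk ω a, walk (fun i => ω (a + i)) T)) E := by
        rw [Measure.map_apply (ha.prodMk (measurable_walk_shift a T)) hE]
        congr 2
        ext ω
        simp [walk_add, hmul, E]
    _ = ∫⁻ x, (E.indicator fun _ => c) x ∂((convPow ν a).prod (convPow ν T)) := by
        rw [lintegral_indicator_const hE, map_walk_walk]
    _ ≤ ∫⁻ x, convPow ν T {V | x ∈ E ∧ act V (act x.2 (act x.1 x₀)) ∈ C}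
          ∂((convPow ν a).prod (convPow ν T)) := by
        refine lintegral_mono fun x => ?_
        by_cases h : x ∈ E
        · simpa [h] using hc _
        · simp [h]
    _ = (stepsLaw ν).map (fun ω => ((walk ω a, walk (fun i => ω (a + i)) T),
          walk (fun i => ω (a + T + i)) T)) F := by
        rw [map_walk_walk_walk, Measure.prod_apply hF]
        rfl
    _ = _ := by
        rw [Measure.map_apply ((ha.prodMk (measurable_walk_shift a T)).prodMk
          (measurable_walk_shift (a + T) T)) hF]
        congr 1
        ext ω
        simp [walk_add, hmul, E, F]

/-- If from every point the set `S` is hit after `T` steps with probability at most `p`, and the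
probabilities of hitting `B` agree up to a factor `ρ`, then conditioned on being in `B` at the time
`t` the walk is outside `S` at the times `t - T` and `t + T` with high probability, because the
past and the future are independent given the present. -/
theorem le_cond_notMem_of_forall_le
    (hact : Measurable fun x : UnitaryOp q n × X => act x.1 x.2)
    (hmul : ∀ V W x, act (V * W) x = act V (act W x)) {S B : Set X} (hS : MeasurableSet S)
    (hB : MeasurableSet B) (x₀ : X) {T t : ℕ} (ht : 2 * T < t) {p ρ c : ℝ} (hp : 0 ≤ p)
    (hp1 : p ≤ 1) (hρ : 0 ≤ ρ) (hpρ : p * ρ ≤ 1) (hc : c ≤ (1 - p) * (1 - p * ρ)) {va : ℝ≥0∞}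
    (hva : va ≠ 0)
    (hpS : ∀ x, convPow ν T {V | act V x ∈ S} ≤ ENNReal.ofReal p)
    (haB : ∀ x, va ≤ convPow ν T {V | act V x ∈ B})
    (hbB : ∀ x, convPow ν T {V | act V x ∈ B} ≤ ENNReal.ofReal ρ * va) :
    stepsLaw ν {ω | act (walk ω t) x₀ ∈ B} ≠ 0 ∧
      ENNReal.ofReal c ≤ ProbabilityTheory.cond (stepsLaw ν) {ω | act (walk ω t) x₀ ∈ B}
        {ω | act (walk ω (t - T)) x₀ ∉ S ∧ act (walk ω (t + T)) x₀ ∉ S} := by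
  obtain ⟨a, rfl⟩ : ∃ a, t = a + T := Nat.exists_eq_add_of_le' (by omega)
  have h1 : ∀ s, Measurable fun ω : ℕ → UnitaryOp q n => act (walk ω s) x₀ := fun s =>
    hact.comp ((measurable_walk s).prodMk measurable_const)
  have hact1 : ∀ x, Measurable fun V : UnitaryOp q n => act V x := fun x =>
    hact.comp (measurable_id.prodMk measurable_const)
  set A := {ω : ℕ → UnitaryOp q n | act (walk ω (a + T)) x₀ ∈ B} with hA
  have hAm : MeasurableSet A := h1 _ hB
  have hAva : va ≤ stepsLaw ν A := by
    rw [hA, stepsLaw_walk_mem_eq_lintegral ν hact hmul hB x₀ (Nat.le_add_left T a)]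
    calc va = ∫⁻ _, va ∂(convPow ν (a + T - T)) := by simp
      _ ≤ _ := lintegral_mono fun W => haB _
  have hA0 : stepsLaw ν A ≠ 0 := (pos_iff_ne_zero.2 hva |>.trans_le hAva).ne'
  refine ⟨hA0, ?_⟩
  -- Here `2 * T < t` enters: the past before `t - T` itself contains a complete block of `T` steps.
  have hpast : stepsLaw ν {ω | act (walk ω a) x₀ ∈ S} ≤ ENNReal.ofReal p := by
    rw [stepsLaw_walk_mem_eq_lintegral ν hact hmul hS x₀ (by omega : T ≤ a)]
    calc _ ≤ ∫⁻ _, ENNReal.ofReal p ∂(convPow ν (a - T)) := lintegral_mono fun W => hpS _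
      _ = _ := by simp
  -- The least return probability `va` is traded for the actual probability of `A`, so that
  -- conditioning on `A` costs only the factor `ρ`.
  have hback : stepsLaw ν {ω | act (walk ω a) x₀ ∈ S ∧ act (walk ω (a + T)) x₀ ∈ B} ≤
      ENNReal.ofReal (p * ρ) * stepsLaw ν A := by
    calc _ ≤ ENNReal.ofReal ρ * va * ENNReal.ofReal p :=
          (stepsLaw_le_mul_stepsLaw ν hact hmul hS hB x₀ a hbB).trans (by gcongr)
      _ ≤ ENNReal.ofReal ρ * stepsLaw ν A * ENNReal.ofReal p := by gcongr
      _ = _ := by rw [ENNReal.ofReal_mul hp]; ring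
  have hgood : ENNReal.ofReal (1 - p * ρ) * stepsLaw ν A ≤
      stepsLaw ν {ω | act (walk ω a) x₀ ∈ Sᶜ ∧ act (walk ω (a + T)) x₀ ∈ B} := by
    have hsplit : stepsLaw ν A ≤
        stepsLaw ν {ω | act (walk ω a) x₀ ∈ S ∧ act (walk ω (a + T)) x₀ ∈ B} +
        stepsLaw ν {ω | act (walk ω a) x₀ ∈ Sᶜ ∧ act (walk ω (a + T)) x₀ ∈ B} := by
      refine (measure_mono ?_).trans (measure_union_le _ _)
      intro ω hω
      by_cases h : act (walk ω a) x₀ ∈ S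
      · exact Or.inl ⟨h, hω⟩
      · exact Or.inr ⟨h, hω⟩
    have hsum : ENNReal.ofReal (1 - p * ρ) * stepsLaw ν A +
        ENNReal.ofReal (p * ρ) * stepsLaw ν A = stepsLaw ν A := by
      rw [← add_mul, ← ENNReal.ofReal_add (by linarith) (by positivity)]
      simp
    have hfin : ENNReal.ofReal (p * ρ) * stepsLaw ν A ≠ ⊤ :=
      ENNReal.mul_ne_top ENNReal.ofReal_ne_top (measure_ne_top _ _)
    refine (ENNReal.add_le_add_iff_right hfin).1 ?_
    rw [hsum, add_comm]
    exact hsplit.trans (by gcongr)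
  have hfut : ∀ x, ENNReal.ofReal (1 - p) ≤ convPow ν T {V | act V x ∈ Sᶜ} := by
    intro x
    have hcompl : {V | act V x ∈ Sᶜ} = {V | act V x ∈ S}ᶜ := rfl
    have hmS : MeasurableSet {V | act V x ∈ S} := hact1 x hS
    rw [hcompl, prob_compl_eq_one_sub hmS, ENNReal.ofReal_sub _ hp, ENNReal.ofReal_one]
    exact tsub_le_tsub_left (hpS x) 1
  have hfinal := mul_stepsLaw_le_stepsLaw ν hact hmul hS.compl hB hS.compl x₀ a hfut
  rw [ProbabilityTheory.cond_apply hAm, Nat.add_sub_cancel]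
  have hset : A ∩ {ω | act (walk ω a) x₀ ∉ S ∧ act (walk ω (a + T + T)) x₀ ∉ S} =
      {ω | (act (walk ω a) x₀ ∈ Sᶜ ∧ act (walk ω (a + T)) x₀ ∈ B) ∧
        act (walk ω (a + T + T)) x₀ ∈ Sᶜ} := by
    ext ω
    simp only [hA, Set.mem_inter_iff, Set.mem_ofPred_eq, Set.mem_compl_iff]
    tauto
  rw [hset]
  calc ENNReal.ofReal c ≤ ENNReal.ofReal ((1 - p) * (1 - p * ρ)) := ENNReal.ofReal_le_ofReal hc
    _ = (stepsLaw ν A)⁻¹ *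
        (ENNReal.ofReal (1 - p) * (ENNReal.ofReal (1 - p * ρ) * stepsLaw ν A)) := by
      rw [ENNReal.ofReal_mul (by linarith), mul_comm (stepsLaw ν A)⁻¹, ← mul_assoc, mul_assoc,
        ENNReal.mul_inv_cancel hA0 (measure_ne_top _ _), mul_one]
    _ ≤ _ := by
      gcongr
      exact le_trans (by gcongr) hfinal

end Core

/-! ## Infima of sets of sizes -/

theorem natEReal_natCast (l : ℕ) : natEReal (l : ℕ∞) = ((l : ℝ) : EReal) := by
  rw [natEReal, ENat.toENNReal_coe, ← ENNReal.ofReal_natCast, EReal.coe_ennreal_ofReal,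
    max_eq_left (Nat.cast_nonneg l)]

theorem natEReal_mono {x y : ℕ∞} (h : x ≤ y) : natEReal x ≤ natEReal y := by
  unfold natEReal
  exact_mod_cast h

/-- The infimum is attained unless the set is empty, where it takes the default value `⊤`. Hence
even strict lower bounds pass to it. -/
theorem biInf_natCast_eq_top_or (S : Set ℕ) :
    ((⨅ l ∈ S, (l : ℕ∞)) = ⊤ ∧ S = ∅) ∨ ∃ l ∈ S, (⨅ l ∈ S, (l : ℕ∞)) = l := by
  rcases S.eq_empty_or_nonempty with rfl | h
  · left; simp
  · right
    refine ⟨sInf S, Nat.sInf_mem h, le_antisymm (iInf₂_le _ (Nat.sInf_mem h)) ?_⟩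
    exact le_iInf₂ fun l hl => by exact_mod_cast Nat.sInf_le hl

theorem biInf_natCast_eq_zero_iff (S : Set ℕ) : (⨅ l ∈ S, (l : ℕ∞)) = 0 ↔ 0 ∈ S := by
  constructor
  · intro h
    rcases biInf_natCast_eq_top_or S with ⟨h', -⟩ | ⟨l, hl, h'⟩
    · simp [h'] at h
    · rw [h'] at h
      have : l = 0 := by exact_mod_cast h
      exact this ▸ hl
  · intro h
    exact le_antisymm (by simpa using iInf₂_le (f := fun (l : ℕ) (_ : l ∈ S) => (l : ℕ∞)) 0 h)
      bot_le

theorem lt_natEReal_biInf_of_forall (S : Set ℕ) {r : ℝ} (h : ∀ l ∈ S, r < l) :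
    (r : EReal) < natEReal (⨅ l ∈ S, (l : ℕ∞)) := by
  rcases biInf_natCast_eq_top_or S with ⟨h', -⟩ | ⟨l, hl, h'⟩
  · rw [h']; simp [natEReal]
  · rw [h', natEReal_natCast]
    exact_mod_cast h l hl

theorem le_natEReal_biInf_of_forall (S : Set ℕ) {r : ℝ} (h : ∀ l ∈ S, r ≤ l) :
    (r : EReal) ≤ natEReal (⨅ l ∈ S, (l : ℕ∞)) := by
  rcases biInf_natCast_eq_top_or S with ⟨h', -⟩ | ⟨l, hl, h'⟩
  · rw [h']; simp [natEReal]
  · rw [h', natEReal_natCast]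
    exact_mod_cast h l hl

/-- If `C` exceeds `r` at distance `m` from `t`, then `r < k * m`, hence `r / k ≤ m`. The times `t -
T` and `t + T` witness the upper bounds. -/
theorem dipLasts_of_le_mul {C : ℕ → ℕ∞} {r : ℝ} {t k T : ℕ} (hk : 1 ≤ k) (hT : T ≤ t)
    (hafter : ∀ m, C (t + m) ≤ ((k * m : ℕ) : ℕ∞))
    (hbefore : ∀ m, m ≤ t → C (t - m) ≤ ((k * m : ℕ) : ℕ∞))
    (h1 : (r : EReal) < natEReal (C (t - T))) (h2 : (r : EReal) < natEReal (C (t + T))) :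
    DipLasts C r t (r / k) T := by
  have key : ∀ {x : ℕ∞} {m : ℕ}, (r : EReal) < natEReal x → x ≤ ((k * m : ℕ) : ℕ∞) →
      r / k ≤ m := by
    intro x m hx hxm
    have h : (r : EReal) < (((k * m : ℕ) : ℝ) : EReal) := by
      rw [← natEReal_natCast]
      exact hx.trans_le (natEReal_mono hxm)
    rw [div_le_iff₀ (by exact_mod_cast hk), mul_comm]
    have h' : r < ((k * m : ℕ) : ℝ) := by exact_mod_cast h
    push_cast at h'
    exact h'.le
  refine ⟨⟨?_, iInf₂_le T ⟨hT, h1⟩⟩, ⟨?_, iInf₂_le T h2⟩⟩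
  · exact le_natEReal_biInf_of_forall _ fun m hm => key hm.2 (hbefore m hm.1)
  · exact le_natEReal_biInf_of_forall _ fun m hm => key hm (hafter m)

/-! ## Counting circuits -/

theorem one_mem_circuits_zero (G : Finset (UnitaryOp q n)) : 1 ∈ circuits G 0 := by
  simp [circuits]

theorem mem_circuits_zero_iff {G : Finset (UnitaryOp q n)} {W : UnitaryOp q n} :
    W ∈ circuits G 0 ↔ W = 1 := by
  simp [circuits]

theorem mul_mem_circuits {G : Finset (UnitaryOp q n)} {a b : ℕ} {V W : UnitaryOp q n}
    (hV : V ∈ circuits G a) (hW : W ∈ circuits G b) : V * W ∈ circuits G (a + b) := by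
  unfold circuits at *
  rw [pow_add]
  exact Set.mul_mem_mul hV hW

theorem exists_finset_coe_eq_circuits (G : Finset (UnitaryOp q n)) (l : ℕ) :
    ∃ F : Finset (UnitaryOp q n), (F : Set (UnitaryOp q n)) = circuits G l ∧
      F.card ≤ G.card ^ l := by
  classical
  exact ⟨G ^ l, by simp [circuits], Finset.card_pow_le⟩

/-- The points within `ε` of the image of `x₀` under a circuit of at most `r` gates. -/
def nearCircuits {X : Type*} (act : UnitaryOp q n → X → X) (dist : X → X → ℝ)
    (G : Finset (UnitaryOp q n)) (x₀ : X) (ε r : ℝ) : Set X :=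
  {x | ∃ l : ℕ, (l : ℝ) ≤ r ∧ ∃ W ∈ circuits G l, dist x (act W x₀) ≤ ε}

section NearCircuits

variable {X : Type*} {act : UnitaryOp q n → X → X} {dist : X → X → ℝ}
  {G : Finset (UnitaryOp q n)} {x₀ : X} {ε r : ℝ}

theorem nearCircuits_of_neg (hr : r < 0) : nearCircuits act dist G x₀ ε r = ∅ := by
  ext x
  simp only [nearCircuits, Set.mem_ofPred_eq, Set.mem_empty_iff_false, iff_false]
  rintro ⟨l, hl, -⟩
  exact absurd (hl.trans_lt hr) (not_lt.2 (Nat.cast_nonneg l))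

theorem nearCircuits_eq_biUnion (hr : 0 ≤ r) : nearCircuits act dist G x₀ ε r =
    ⋃ l ∈ Finset.range (⌊r⌋₊ + 1), ⋃ W ∈ circuits G l, {x | dist x (act W x₀) ≤ ε} := by
  ext x
  simp only [nearCircuits, Set.mem_ofPred_eq, Set.mem_iUnion, Finset.mem_range, exists_prop,
    Nat.lt_succ_iff, Nat.le_floor_iff hr]

theorem measurableSet_nearCircuits [MeasurableSpace X]
    (hd : ∀ y, MeasurableSet {x | dist x y ≤ ε}) :
    MeasurableSet (nearCircuits act dist G x₀ ε r) := by
  rcases lt_or_ge r 0 with hr | hr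
  · rw [nearCircuits_of_neg hr]; exact MeasurableSet.empty
  rw [nearCircuits_eq_biUnion hr]
  refine Finset.measurableSet_biUnion _ fun l _ => ?_
  obtain ⟨F, hF, -⟩ := exists_finset_coe_eq_circuits G l
  rw [← hF]
  exact Finset.measurableSet_biUnion F fun W _ => hd _

theorem sum_range_floor_pow_le {g : ℝ} (hg : 1 < g) (hr : 0 ≤ r) :
    ∑ l ∈ Finset.range (⌊r⌋₊ + 1), g ^ l ≤ g / (g - 1) * Real.exp (r * Real.log g) := by
  rw [geom_sum_eq hg.ne', div_mul_eq_mul_div]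
  have h : g ^ ⌊r⌋₊ ≤ Real.exp (r * Real.log g) := by
    rw [← Real.rpow_natCast, Real.rpow_def_of_pos (by linarith), mul_comm]
    exact Real.exp_le_exp.2 (mul_le_mul_of_nonneg_right (Nat.floor_le hr) (Real.log_nonneg hg.le))
  have : 0 < g - 1 := by linarith
  gcongr
  rw [pow_succ']
  nlinarith

/-- Union bound over at most `|G| ^ l` circuits of each size `l ≤ r`. For `r < 0` there are no such
sizes, so `hp` is needed only for `0 ≤ r`. -/
theorem measure_preimage_nearCircuits_le {Ω : Type*} [MeasurableSpace Ω] (μ : Measure Ω)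
    (hg : 2 ≤ G.card) (f : Ω → X) {v p : ℝ} (hv : ∀ y, μ {V | dist (f V) y ≤ ε} ≤ ENNReal.ofReal v)
    (hv0 : 0 ≤ v)
    (hp : 0 ≤ r → (G.card : ℝ) / (G.card - 1) * Real.exp (r * Real.log G.card) * v ≤ p) :
    μ {V | f V ∈ nearCircuits act dist G x₀ ε r} ≤ ENNReal.ofReal p := by
  rcases lt_or_ge r 0 with hr | hr
  · simp [nearCircuits_of_neg hr]
  have hg1 : (1 : ℝ) < G.card := by exact_mod_cast hg
  have hset : {V | f V ∈ nearCircuits act dist G x₀ ε r} =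
      ⋃ l ∈ Finset.range (⌊r⌋₊ + 1), ⋃ W ∈ circuits G l, {V | dist (f V) (act W x₀) ≤ ε} := by
    ext V
    simp [nearCircuits_eq_biUnion hr]
  rw [hset]
  calc _ ≤ ∑ l ∈ Finset.range (⌊r⌋₊ + 1),
        μ (⋃ W ∈ circuits G l, {V | dist (f V) (act W x₀) ≤ ε}) :=
        measure_biUnion_finset_le _ _
    _ ≤ ∑ l ∈ Finset.range (⌊r⌋₊ + 1), ENNReal.ofReal ((G.card : ℝ) ^ l * v) := by
        refine Finset.sum_le_sum fun l _ => ?_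
        obtain ⟨F, hF, hcard⟩ := exists_finset_coe_eq_circuits G l
        rw [← hF]
        calc _ ≤ ∑ W ∈ F, μ {V | dist (f V) (act W x₀) ≤ ε} := measure_biUnion_finset_le _ _
          _ ≤ ∑ W ∈ F, ENNReal.ofReal v := Finset.sum_le_sum fun W _ => hv _
          _ = ENNReal.ofReal (F.card * v) := by
            rw [Finset.sum_const, nsmul_eq_mul, ENNReal.ofReal_mul (by positivity),
              ENNReal.ofReal_natCast]
          _ ≤ _ := by
            refine ENNReal.ofReal_le_ofReal ?_
            gcongr
            exact_mod_cast hcard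
    _ = ENNReal.ofReal ((∑ l ∈ Finset.range (⌊r⌋₊ + 1), (G.card : ℝ) ^ l) * v) := by
        rw [Finset.sum_mul, ENNReal.ofReal_sum_of_nonneg fun i _ => by positivity]
    _ ≤ _ := by
        refine ENNReal.ofReal_le_ofReal (le_trans ?_ (hp hr))
        gcongr
        exact sum_range_floor_pow_le hg1 hr

end NearCircuits

/-! ## The distance of unitary channels -/

section UnitDist

open scoped Matrix.Norms.L2Operator

theorem norm_unitary_mul (U : UnitaryOp q n) (A : Matrix (Basis q n) (Basis q n) ℂ) :
    ‖(U : Matrix _ _ ℂ) * A‖ = ‖A‖ :=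
  CStarRing.norm_coe_unitary_mul U A

theorem norm_mul_unitary (U : UnitaryOp q n) (A : Matrix (Basis q n) (Basis q n) ℂ) :
    ‖A * (U : Matrix _ _ ℂ)‖ = ‖A‖ :=
  CStarRing.norm_mul_coe_unitary A U

theorem unitDist_eq_iInf_norm (U V : UnitaryOp q n) : unitDist U V =
    ⨅ z : Circle, ‖(U : Matrix (Basis q n) (Basis q n) ℂ) - (z : ℂ) • (V : Matrix _ _ ℂ)‖ := rfl

theorem unitDist_le (U V : UnitaryOp q n) (z : Circle) :
    unitDist U V ≤ ‖(U : Matrix (Basis q n) (Basis q n) ℂ) - (z : ℂ) • (V : Matrix _ _ ℂ)‖ :=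
  ciInf_le ⟨0, by rintro _ ⟨z, rfl⟩; exact norm_nonneg _⟩ z

theorem exists_norm_eq_unitDist (U V : UnitaryOp q n) : ∃ z : Circle,
    ‖(U : Matrix (Basis q n) (Basis q n) ℂ) - (z : ℂ) • (V : Matrix _ _ ℂ)‖ = unitDist U V := by
  have hc : Continuous fun z : Circle =>
      ‖(U : Matrix (Basis q n) (Basis q n) ℂ) - (z : ℂ) • (V : Matrix _ _ ℂ)‖ := by fun_prop
  obtain ⟨z, -, hz⟩ := isCompact_univ.exists_isMinOn Set.univ_nonempty hc.continuousOn
  exact ⟨z, le_antisymm (le_ciInf fun w => hz (Set.mem_univ w)) (unitDist_le U V z)⟩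

theorem unitDist_le_iff {U V : UnitaryOp q n} {R : ℝ} : unitDist U V ≤ R ↔ ∃ z : Circle,
    ‖(U : Matrix (Basis q n) (Basis q n) ℂ) - (z : ℂ) • (V : Matrix _ _ ℂ)‖ ≤ R := by
  constructor
  · intro h
    obtain ⟨z, hz⟩ := exists_norm_eq_unitDist U V
    exact ⟨z, hz.le.trans h⟩
  · rintro ⟨z, hz⟩
    exact (unitDist_le U V z).trans hz

theorem unitDist_mul_left (W U V : UnitaryOp q n) : unitDist (W * U) (W * V) = unitDist U V := by
  rw [unitDist_eq_iInf_norm, unitDist_eq_iInf_norm]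
  refine iInf_congr fun z => ?_
  rw [← norm_unitary_mul W ((U : Matrix (Basis q n) (Basis q n) ℂ) - _), mul_sub,
    Matrix.mul_smul]
  rfl

theorem unitDist_mul_right (W U V : UnitaryOp q n) : unitDist (U * W) (V * W) = unitDist U V := by
  rw [unitDist_eq_iInf_norm, unitDist_eq_iInf_norm]
  refine iInf_congr fun z => ?_
  rw [← norm_mul_unitary W ((U : Matrix (Basis q n) (Basis q n) ℂ) - _), sub_mul,
    Matrix.smul_mul]
  rfl

/-- The minimum over phases is attained, so the ball is the projection of a closed subset of a
compact product. -/
theorem isClosed_unitBall (V : UnitaryOp q n) (R : ℝ) : IsClosed (unitBall V R) := by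
  have h : unitBall V R = Prod.fst '' {x : UnitaryOp q n × Circle |
      ‖(x.1 : Matrix (Basis q n) (Basis q n) ℂ) - (x.2 : ℂ) • (V : Matrix _ _ ℂ)‖ ≤ R} := by
    ext U
    simp [unitBall, unitDist_le_iff]
  rw [h]
  have hc : Continuous fun x : UnitaryOp q n × Circle =>
      ‖(x.1 : Matrix (Basis q n) (Basis q n) ℂ) - (x.2 : ℂ) • (V : Matrix _ _ ℂ)‖ := by fun_prop
  exact ((isClosed_le hc continuous_const).isCompact.image continuous_fst).isClosed

theorem exists_eq_smul_of_unitDist_eq_zero {U V : UnitaryOp q n} (h : unitDist U V = 0) :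
    ∃ z : Circle, (U : Matrix (Basis q n) (Basis q n) ℂ) = (z : ℂ) • (V : Matrix _ _ ℂ) := by
  obtain ⟨z, hz⟩ := exists_norm_eq_unitDist U V
  exact ⟨z, sub_eq_zero.1 (norm_eq_zero.1 (hz.trans h))⟩

theorem unitDist_congr_of_eq_smul {U U' V : UnitaryOp q n} {z : Circle}
    (h : (U : Matrix (Basis q n) (Basis q n) ℂ) = (z : ℂ) • (U' : Matrix _ _ ℂ)) :
    unitDist U V = unitDist U' V := by
  have key : ∀ {A B : UnitaryOp q n} {w : Circle},
      (A : Matrix (Basis q n) (Basis q n) ℂ) = (w : ℂ) • (B : Matrix _ _ ℂ) →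
      unitDist A V ≤ unitDist B V := by
    intro A B w hw
    obtain ⟨y, hy⟩ := exists_norm_eq_unitDist B V
    refine (unitDist_le A V (w * y)).trans ?_
    rw [hw, ← hy, Circle.coe_mul, mul_smul, ← smul_sub, norm_smul, Circle.norm_coe, one_mul]
  refine le_antisymm (key h) (key (w := z⁻¹) ?_)
  rw [h, smul_smul, ← Circle.coe_mul, inv_mul_cancel, Circle.coe_one, one_smul]

end UnitDist

/-! ## Packings -/

/-- The bound `K` on cardinalities lets one choose a separated set of largest cardinality. A point
farther than `s` from all of it could be added, so it is also an `s`-net. -/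
theorem exists_maximal_separated {X : Type*} (dist : X → X → ℝ) (hself : ∀ x, dist x x = 0)
    (hsymm : ∀ x y, dist x y = dist y x) {s : ℝ} (hs : 0 ≤ s)
    (A : Set X) {K : ℝ} (hK : ∀ F : Finset X, (F : Set X) ⊆ A →
      (F : Set X).Pairwise (fun x y => s < dist x y) → (F.card : ℝ) ≤ K) :
    ∃ F : Finset X, (F : Set X) ⊆ A ∧ (F : Set X).Pairwise (fun x y => s < dist x y) ∧
      ∀ x ∈ A, ∃ y ∈ F, dist x y ≤ s := by
  classical
  let C : Set ℕ := {m | ∃ F : Finset X, (F : Set X) ⊆ A ∧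
    (F : Set X).Pairwise (fun x y => s < dist x y) ∧ F.card = m}
  have hne : C.Nonempty := ⟨0, ∅, by simp⟩
  have hbdd : BddAbove C := by
    refine ⟨⌊K⌋₊, ?_⟩
    rintro _ ⟨F, h1, h2, rfl⟩
    exact Nat.le_floor (hK F h1 h2)
  obtain ⟨F, hFA, hFs, hFc⟩ := Nat.sSup_mem hne hbdd
  refine ⟨F, hFA, hFs, fun x hx => ?_⟩
  by_contra! hcon
  have hxF : x ∉ F := fun h => absurd (hcon x h) (by simp [hself, hs])
  have hmem : (insert x F).card ∈ C := by
    refine ⟨insert x F, ?_, ?_, rfl⟩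
    · rw [Finset.coe_insert]
      exact Set.insert_subset hx hFA
    · rw [Finset.coe_insert, Set.pairwise_insert]
      exact ⟨hFs, fun y hy _ => ⟨hcon y hy, hsymm x y ▸ hcon y hy⟩⟩
  have := le_csSup hbdd hmem
  rw [Finset.card_insert_of_notMem hxF, hFc] at this
  omega

section Packing

variable {E : Type*} [NormedAddCommGroup E] [NormedSpace ℝ E] [FiniteDimensional ℝ E]

/-- The balls of radius `s / 2` around the points are disjoint and lie in the ball of radius `ρ + s
/ 2`; compare volumes. -/
theorem card_le_of_separated {ρ s : ℝ} (hρ : 0 ≤ ρ) (hs : 0 < s) (F : Finset E)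
    (hF : ∀ x ∈ F, ‖x‖ ≤ ρ) (hsep : (F : Set E).Pairwise (fun x y => s < dist x y)) :
    (F.card : ℝ) ≤ (1 + 2 * ρ / s) ^ Module.finrank ℝ E := by
  borelize E
  let μ : Measure E := Measure.addHaar
  have hdisj : (F : Set E).PairwiseDisjoint fun x => Metric.closedBall x (s / 2) := by
    intro x hx y hy hxy
    exact Metric.closedBall_disjoint_closedBall (by linarith [hsep hx hy hxy])
  have hsub : (⋃ x ∈ F, Metric.closedBall x (s / 2)) ⊆ Metric.closedBall (0 : E) (ρ + s / 2) := by
    refine Set.iUnion₂_subset fun x hx => Metric.closedBall_subset_closedBall' ?_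
    rw [dist_zero_right]
    linarith [hF x hx]
  have h := measure_mono (μ := μ) hsub
  rw [measure_biUnion_finset hdisj fun x _ => Metric.isClosed_closedBall.measurableSet] at h
  simp only [Measure.addHaar_closedBall μ _ (by positivity : 0 ≤ s / 2),
    Measure.addHaar_closedBall μ _ (by positivity : 0 ≤ ρ + s / 2), Finset.sum_const,
    nsmul_eq_mul] at h
  rw [← mul_assoc, ENNReal.mul_le_mul_iff_left (Metric.measure_ball_pos μ _ one_pos).ne'
    (measure_ball_lt_top).ne, ← ENNReal.ofReal_natCast, ← ENNReal.ofReal_mul (by positivity),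
    ENNReal.ofReal_le_ofReal_iff (by positivity)] at h
  have hpos : 0 < (s / 2) ^ Module.finrank ℝ E := by positivity
  calc (F.card : ℝ) ≤ (ρ + s / 2) ^ Module.finrank ℝ E / (s / 2) ^ Module.finrank ℝ E := by
        rwa [le_div_iff₀ hpos]
    _ = _ := by
        rw [← div_pow]
        congr 1
        field_simp
        ring

/-- A maximal separated set is a net, so its balls of radius `s` cover the unit ball; compare
volumes. -/
theorem exists_separated_one_le_card_mul {s : ℝ} (hs : 0 < s) :
    ∃ F : Finset E, (∀ x ∈ F, ‖x‖ ≤ 1) ∧ (F : Set E).Pairwise (fun x y => s < dist x y) ∧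
      1 ≤ (F.card : ℝ) * s ^ Module.finrank ℝ E := by
  borelize E
  let μ : Measure E := Measure.addHaar
  obtain ⟨F, hF1, hF2, hF3⟩ := exists_maximal_separated (X := E) dist dist_self dist_comm hs.le
    (Metric.closedBall 0 1) (K := (1 + 2 * 1 / s) ^ Module.finrank ℝ E) fun F h1 h2 =>
      card_le_of_separated zero_le_one hs F (fun x hx => by simpa using h1 hx) h2
  refine ⟨F, fun x hx => by simpa using hF1 hx, hF2, ?_⟩
  have hsub : Metric.closedBall (0 : E) 1 ⊆ ⋃ x ∈ F, Metric.closedBall x s := by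
    intro x hx
    obtain ⟨y, hy, hxy⟩ := hF3 x hx
    exact Set.mem_biUnion hy hxy
  have h := (measure_mono (μ := μ) hsub).trans (measure_biUnion_finset_le _ _)
  simp only [Measure.addHaar_closedBall μ _ hs.le, Measure.addHaar_closedBall μ _ zero_le_one,
    Finset.sum_const, nsmul_eq_mul] at h
  rw [← mul_assoc, ENNReal.mul_le_mul_iff_left (Metric.measure_ball_pos μ _ one_pos).ne'
    (measure_ball_lt_top).ne, ← ENNReal.ofReal_natCast, ← ENNReal.ofReal_mul (by positivity),
    ENNReal.ofReal_le_ofReal_iff (by positivity)] at h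
  simpa using h

end Packing

/-! ## The Cayley transform -/

section Cayley

open scoped Matrix.Norms.L2Operator ComplexStarModule
open Complex

variable {N : Type*} [Fintype N] [DecidableEq N]

instance : FiniteDimensional ℝ (selfAdjoint (Matrix N N ℂ)) :=
  inferInstanceAs (FiniteDimensional ℝ (selfAdjoint.submodule ℝ (Matrix N N ℂ)))

/-- Real and imaginary parts split the complex matrices, of real dimension `2 * |N| ^ 2`, into two
copies of the self-adjoint ones. -/
theorem finrank_selfAdjoint_matrix :
    Module.finrank ℝ (selfAdjoint (Matrix N N ℂ)) = Fintype.card N ^ 2 := by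
  let e : Matrix N N ℂ ≃ₗ[ℝ] selfAdjoint (Matrix N N ℂ) × selfAdjoint (Matrix N N ℂ) :=
    { toFun := fun x => (ℜ x, ℑ x)
      map_add' := fun x y => by simp
      map_smul' := fun c x => by simp
      invFun := fun x => (x.1 : Matrix N N ℂ) + I • (x.2 : Matrix N N ℂ)
      left_inv := fun x => realPart_add_I_smul_imaginaryPart x
      right_inv := fun x => by ext1 <;> simp }
  have h := e.finrank_eq
  rw [Module.finrank_prod, finrank_real_of_complex, Module.finrank_matrix,
    Module.finrank_self] at h
  nlinarith

/-- A matrix bounded below is injective, hence invertible in finite dimension; applying the bound to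
preimages controls the inverse. -/
theorem isUnit_and_norm_inv_le_of_forall {X : Matrix N N ℂ} {c : ℝ} (hc : 0 < c)
    (h : ∀ v : EuclideanSpace ℂ N, c * ‖v‖ ≤ ‖Matrix.toEuclideanCLM (𝕜 := ℂ) X v‖) :
    IsUnit X ∧ ‖X⁻¹‖ ≤ c⁻¹ := by
  have hX : IsUnit X := by
    rw [← Matrix.mulVec_injective_iff_isUnit]
    intro v w hvw
    have h1 := h (WithLp.toLp 2 (v - w))
    rw [Matrix.toEuclideanCLM_toLp, Matrix.mulVec_sub, sub_eq_zero.2 hvw] at h1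
    simp only [WithLp.toLp_zero, norm_zero] at h1
    have h2 : ‖WithLp.toLp 2 (v - w)‖ = 0 := by
      nlinarith [norm_nonneg (WithLp.toLp 2 (v - w))]
    have h3 : WithLp.toLp 2 (v - w) = WithLp.toLp 2 0 := by simpa using h2
    exact sub_eq_zero.1 (WithLp.toLp_injective 2 h3)
  refine ⟨hX, ContinuousLinearMap.opNorm_le_bound _ (by positivity) fun v => ?_⟩
  have h1 := h (Matrix.toEuclideanCLM (𝕜 := ℂ) X⁻¹ v)
  have h2 : Matrix.toEuclideanCLM (𝕜 := ℂ) X (Matrix.toEuclideanCLM (𝕜 := ℂ) X⁻¹ v) = v := by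
    have h3 : (Matrix.toEuclideanCLM (𝕜 := ℂ) X) * (Matrix.toEuclideanCLM (𝕜 := ℂ) X⁻¹) = 1 := by
      rw [← map_mul, Matrix.mul_nonsing_inv _ ((Matrix.isUnit_iff_isUnit_det _).1 hX), map_one]
    exact DFunLike.congr_fun h3 v
  rw [h2] at h1
  rw [inv_mul_eq_div, le_div_iff₀' hc]
  exact h1

/-- Since `⟨v, A v⟩` is real, the real part of `⟨v, (1 - iA) v⟩` is `‖v‖ ^ 2`, and Cauchy–Schwarz
makes `1 - iA` bounded below by `1`. -/
theorem isUnit_one_sub_I_smul {A : Matrix N N ℂ} (hA : star A = A) :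
    IsUnit (1 - I • A) ∧ ‖(1 - I • A)⁻¹‖ ≤ 1 := by
  have := isUnit_and_norm_inv_le_of_forall (X := 1 - I • A) one_pos fun v => ?_
  · simpa using this
  have hre : RCLike.re (inner ℂ v (Matrix.toEuclideanCLM (𝕜 := ℂ) (1 - I • A) v)) = ‖v‖ ^ 2 := by
    have hsymm : inner ℂ v (Matrix.toEuclideanCLM (𝕜 := ℂ) A v) =
        inner ℂ (Matrix.toEuclideanCLM (𝕜 := ℂ) A v) v := by
      have hadj : ContinuousLinearMap.adjoint (Matrix.toEuclideanCLM (𝕜 := ℂ) A) =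
          Matrix.toEuclideanCLM (𝕜 := ℂ) A := by
        rw [← ContinuousLinearMap.star_eq_adjoint, ← map_star, hA]
      conv_lhs => rw [← hadj]
      exact ContinuousLinearMap.adjoint_inner_right _ _ _
    have him : (inner ℂ v (Matrix.toEuclideanCLM (𝕜 := ℂ) A v)).im = 0 := by
      rw [← Complex.conj_eq_iff_im, inner_conj_symm, hsymm]
    rw [map_sub, map_one, map_smul, _root_.sub_apply, inner_sub_right, map_sub]
    rw [one_apply_eq_self, inner_self_eq_norm_sq, _root_.smul_apply,
      inner_smul_right]
    simp [him]
  have hle := (RCLike.re_le_norm _).trans (norm_inner_le_norm (𝕜 := ℂ) v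
    (Matrix.toEuclideanCLM (𝕜 := ℂ) (1 - I • A) v))
  rw [hre, sq] at hle
  rw [one_mul]
  rcases (norm_nonneg v).eq_or_lt with h0 | h0
  · rw [← h0]; exact norm_nonneg _
  · exact le_of_mul_le_mul_left hle h0

theorem star_one_sub_I_smul {A : Matrix N N ℂ} (hA : star A = A) :
    star (1 - I • A) = 1 + I • A := by
  rw [star_sub, star_one, star_smul, hA]
  simp

/-- With `X = 1 - iA` this matrix is `(1 + iA) X⁻¹`. Unitarity follows from `star X + X = 2`; the
chosen form keeps a single inverse and makes differences easy to compute. -/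
theorem cayley_mem_unitaryGroup {A : Matrix N N ℂ} (hA : star A = A) :
    2 • (1 - I • A)⁻¹ - 1 ∈ Matrix.unitaryGroup N ℂ := by
  obtain ⟨hu, -⟩ := isUnit_one_sub_I_smul hA
  have hs := star_one_sub_I_smul hA
  set X := 1 - I • A with hX
  have hdet := (Matrix.isUnit_iff_isUnit_det X).1 hu
  have h1 : X⁻¹ * X = 1 := Matrix.nonsing_inv_mul X hdet
  have h1' : X * X⁻¹ = 1 := Matrix.mul_nonsing_inv X hdet
  have hsum : star X + X = 2 • (1 : Matrix N N ℂ) := by rw [hs, hX]; abel_nf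
  have h2 : star X * star X⁻¹ = 1 := by rw [← star_mul, h1, star_one]
  have h3 : star X⁻¹ * star X = 1 := by rw [← star_mul, h1', star_one]
  have key : 2 • (star X⁻¹ * X⁻¹) = star X⁻¹ + X⁻¹ := by
    calc 2 • (star X⁻¹ * X⁻¹) = star X⁻¹ * (2 • (1 : Matrix N N ℂ)) * X⁻¹ := by
          noncomm_ring
      _ = (star X⁻¹ * star X) * X⁻¹ + star X⁻¹ * (X * X⁻¹) := by
          rw [← hsum]; noncomm_ring
      _ = _ := by rw [h3, h1']; simp [add_comm]
  rw [Matrix.mem_unitaryGroup_iff']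
  calc star (2 • X⁻¹ - 1) * (2 • X⁻¹ - 1)
      = 2 • (2 • (star X⁻¹ * X⁻¹)) - 2 • (star X⁻¹ + X⁻¹) + 1 := by
        rw [star_sub, star_one, star_nsmul]; noncomm_ring
    _ = 1 := by rw [key]; abel

/-- With `X = 1 - iA` and `Y = 1 - iB`, multiplying the difference of transforms by `X` on the left
and `Y` on the right gives `2i(A - B)`. On the unit ball `‖X‖ ^ 2 = ‖1 + A ^ 2‖ ≤ 2`, and likewise
for `Y`, so the transform does not shrink distances. -/
theorem norm_sub_le_norm_cayley_sub {A B : Matrix N N ℂ} (hA : star A = A) (hB : star B = B)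
    (hA1 : ‖A‖ ≤ 1) (hB1 : ‖B‖ ≤ 1) :
    ‖A - B‖ ≤ ‖(2 • (1 - I • A)⁻¹ - 1) - (2 • (1 - I • B)⁻¹ - 1)‖ := by
  have hnorm : ∀ {C : Matrix N N ℂ}, star C = C → ‖C‖ ≤ 1 →
      ‖1 - I • C‖ * ‖1 - I • C‖ ≤ 2 := by
    intro C hC hC1
    rw [← CStarRing.norm_star_mul_self, star_one_sub_I_smul hC]
    have : (1 + I • C) * (1 - I • C) = 1 + C * C := by
      simp only [mul_sub, add_mul, mul_one, one_mul, Matrix.smul_mul, Matrix.mul_smul, smul_smul,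
        I_mul_I, neg_smul, one_smul]
      abel
    rw [this]
    have h1 : ‖(1 : Matrix N N ℂ)‖ ≤ 1 := by
      rcases isEmpty_or_nonempty N with h | h
      · rw [Subsingleton.elim (1 : Matrix N N ℂ) 0]; simp
      · exact CStarRing.norm_one.le
    calc ‖1 + C * C‖ ≤ ‖(1 : Matrix N N ℂ)‖ + ‖C‖ * ‖C‖ :=
          (norm_add_le _ _).trans (by gcongr; exact norm_mul_le _ _)
      _ ≤ 1 + 1 * 1 := by gcongr
      _ = 2 := by norm_num
  have hXA := hnorm hA hA1
  have hXB := hnorm hB hB1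
  obtain ⟨hu, -⟩ := isUnit_one_sub_I_smul hA
  obtain ⟨hv, -⟩ := isUnit_one_sub_I_smul hB
  have hd1 := Matrix.mul_nonsing_inv _ ((Matrix.isUnit_iff_isUnit_det _).1 hu)
  have hd2 := Matrix.nonsing_inv_mul _ ((Matrix.isUnit_iff_isUnit_det _).1 hv)
  set X := 1 - I • A with hX
  set Y := 1 - I • B with hY
  have hYX : Y - X = I • (A - B) := by rw [hX, hY, smul_sub]; abel
  have key : (2 : ℂ) • (A - B) = (-I) • (X * ((2 • X⁻¹ - 1) - (2 • Y⁻¹ - 1)) * Y) := by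
    have : X * ((2 • X⁻¹ - 1) - (2 • Y⁻¹ - 1)) * Y = 2 • (Y - X) := by
      calc _ = 2 • ((X * X⁻¹) * Y - X * (Y⁻¹ * Y)) := by noncomm_ring
        _ = _ := by rw [hd1, hd2, one_mul, mul_one]
    rw [this, hYX, smul_comm, smul_smul]
    simp [two_smul]
  have hn := congrArg norm key
  rw [norm_smul, norm_smul, norm_neg, norm_I, one_mul] at hn
  have hb : ‖X * ((2 • X⁻¹ - 1) - (2 • Y⁻¹ - 1)) * Y‖ ≤
      ‖X‖ * ‖Y‖ * ‖(2 • X⁻¹ - 1) - (2 • Y⁻¹ - 1)‖ :=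
    calc _ ≤ ‖X‖ * ‖(2 • X⁻¹ - 1) - (2 • Y⁻¹ - 1)‖ * ‖Y‖ :=
          (norm_mul_le _ _).trans (by gcongr; exact norm_mul_le _ _)
      _ = _ := by ring
  have hXY : ‖X‖ * ‖Y‖ ≤ 2 := by nlinarith [sq_nonneg (‖X‖ - ‖Y‖)]
  have h2 : ‖(2 : ℂ)‖ = 2 := by simp
  rw [h2] at hn
  nlinarith [norm_nonneg ((2 • X⁻¹ - 1) - (2 • Y⁻¹ - 1))]

/-- Near the identity the Cayley transform can be inverted. -/
theorem exists_selfAdjoint_cayley_eq {U : Matrix N N ℂ} (hU : U ∈ Matrix.unitaryGroup N ℂ) {b : ℝ}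
    (hb : b < 2) (hUb : ‖U - 1‖ ≤ b) :
    ∃ A : Matrix N N ℂ, star A = A ∧ U = 2 • (1 - I • A)⁻¹ - 1 ∧ ‖A‖ ≤ b / (2 - b) := by
  have hb0 : 0 ≤ b := (norm_nonneg _).trans hUb
  obtain ⟨hu, hinv⟩ := isUnit_and_norm_inv_le_of_forall (X := 1 + U) (c := 2 - b) (by linarith)
    fun v => by
      have h1 : Matrix.toEuclideanCLM (𝕜 := ℂ) (1 + U) v =
          (2 : ℂ) • v + Matrix.toEuclideanCLM (𝕜 := ℂ) (U - 1) v := by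
        rw [map_add, map_sub, map_one, _root_.add_apply,
          _root_.sub_apply, one_apply_eq_self, two_smul]
        abel
      have h2 : ‖Matrix.toEuclideanCLM (𝕜 := ℂ) (U - 1) v‖ ≤ b * ‖v‖ :=
        (ContinuousLinearMap.le_opNorm _ v).trans (by gcongr; exact hUb)
      have h3 := norm_sub_le ((2 : ℂ) • v + Matrix.toEuclideanCLM (𝕜 := ℂ) (U - 1) v)
        (Matrix.toEuclideanCLM (𝕜 := ℂ) (U - 1) v)
      rw [add_sub_cancel_right, norm_smul, Complex.norm_ofNat] at h3
      rw [h1]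
      linarith
  have hdet := (Matrix.isUnit_iff_isUnit_det _).1 hu
  have e1 := Matrix.mul_nonsing_inv _ hdet
  have e2 := Matrix.nonsing_inv_mul _ hdet
  have e3 : star (1 + U)⁻¹ * star (1 + U) = 1 := by rw [← star_mul, e1, star_one]
  have hUU := Matrix.mem_unitaryGroup_iff'.1 hU
  set Z := (1 + U)⁻¹ with hZ
  -- Unitarity of `U` enters as `(1 + U) + star (1 + U) = star (1 + U) * (1 + U)`, conjugated by
  -- `Z`.
  have hself : star Z + Z = 1 := by
    calc star Z + Z = star Z * ((1 + U) * Z) + (star Z * star (1 + U)) * Z := by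
          rw [e1, e3, mul_one, one_mul]
      _ = star Z * (1 + U + star (1 + U)) * Z := by noncomm_ring
      _ = star Z * (star (1 + U) * (1 + U)) * Z := by
          congr 2
          rw [star_add, star_one, add_mul, mul_add, mul_add, hUU]
          simp only [mul_one, one_mul]
          abel
      _ = (star Z * star (1 + U)) * ((1 + U) * Z) := by noncomm_ring
      _ = 1 := by rw [e1, e3, one_mul]
  have hX : (1 : Matrix N N ℂ) - I • (I • (2 • Z - 1)) = 2 • Z := by
    rw [smul_smul, I_mul_I, neg_smul, one_smul]
    abel
  -- This is `U = 2 (1 - iA)⁻¹ - 1` solved for `A`: one has `1 - iA = 2 (1 + U)⁻¹`.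
  refine ⟨I • (2 • Z - 1), ?_, ?_, ?_⟩
  · rw [star_smul, star_sub, star_nsmul, star_one, ← hself]
    simp only [RCLike.star_def, conj_I, neg_smul, ← smul_neg]
    congr 1
    abel
  · rw [hX]
    have h2Z : (2 • Z)⁻¹ = (1 / 2 : ℂ) • (1 + U) := by
      refine Matrix.inv_eq_left_inv ?_
      rw [Matrix.smul_mul, Matrix.mul_smul, e1, ← Nat.cast_smul_eq_nsmul ℂ, smul_smul]
      simp
    rw [h2Z, ← Nat.cast_smul_eq_nsmul ℂ, smul_smul]
    simp
  · have h4 : 2 • Z - 1 = Z * (-(U - 1)) := by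
      have : 2 • Z - 1 = 2 • Z - Z * (1 + U) := by rw [e2]
      rw [this]; noncomm_ring
    rw [norm_smul, norm_I, one_mul, h4]
    calc ‖Z * (-(U - 1))‖ ≤ ‖Z‖ * ‖-(U - 1)‖ := norm_mul_le _ _
      _ ≤ (2 - b)⁻¹ * b := by
          rw [norm_neg]
          gcongr
      _ = _ := by rw [inv_mul_eq_div]

/-- The difference equals `2 X⁻¹ (Y - X) Y⁻¹`, where both inverses have norm at most `1`. -/
theorem norm_cayley_sub_le {A B : Matrix N N ℂ} (hA : star A = A) (hB : star B = B) :
    ‖(2 • (1 - I • A)⁻¹ - 1) - (2 • (1 - I • B)⁻¹ - 1)‖ ≤ 2 * ‖A - B‖ := by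
  obtain ⟨hu, hun⟩ := isUnit_one_sub_I_smul hA
  obtain ⟨hv, hvn⟩ := isUnit_one_sub_I_smul hB
  have hd1 := Matrix.nonsing_inv_mul _ ((Matrix.isUnit_iff_isUnit_det _).1 hu)
  have hd2 := Matrix.mul_nonsing_inv _ ((Matrix.isUnit_iff_isUnit_det _).1 hv)
  set X := 1 - I • A with hX
  set Y := 1 - I • B with hY
  have hYX : Y - X = I • (A - B) := by rw [hX, hY, smul_sub]; abel
  have key : (2 • X⁻¹ - 1) - (2 • Y⁻¹ - 1) = 2 • (X⁻¹ * (Y - X) * Y⁻¹) := by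
    calc _ = 2 • (X⁻¹ * (Y * Y⁻¹) - (X⁻¹ * X) * Y⁻¹) := by rw [hd1, hd2]; noncomm_ring
      _ = _ := by noncomm_ring
  have hAB : ‖Y - X‖ = ‖A - B‖ := by rw [hYX, norm_smul, norm_I, one_mul]
  rw [key, two_nsmul, two_mul]
  have : ‖X⁻¹ * (Y - X) * Y⁻¹‖ ≤ ‖A - B‖ := by
    calc _ ≤ ‖X⁻¹‖ * ‖Y - X‖ * ‖Y⁻¹‖ :=
          (norm_mul_le _ _).trans (by gcongr; exact norm_mul_le _ _)
      _ ≤ 1 * ‖Y - X‖ * 1 := by gcongr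
      _ = _ := by rw [hAB]; ring
  exact (norm_add_le _ _).trans (add_le_add this this)

end Cayley

/-! ## Volumes of balls of unitary channels -/

section UnitVol

open scoped Matrix.Norms.L2Operator
open Complex

/-- Operators on `(ℂ^q)^{⊗ n}`. -/
abbrev Op (q n : ℕ) : Type := Matrix (Basis q n) (Basis q n) ℂ

/-- The unitaries within `ρ` of `U` in the operator norm, phases included. -/
def normBall (U : UnitaryOp q n) (ρ : ℝ) : Set (UnitaryOp q n) :=
  {V | ‖(V : Op q n) - U‖ ≤ ρ}

theorem mem_normBall {U V : UnitaryOp q n} {ρ : ℝ} :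
    V ∈ normBall U ρ ↔ ‖(V : Op q n) - U‖ ≤ ρ := Iff.rfl

theorem mem_normBall_one {V : UnitaryOp q n} {ρ : ℝ} :
    V ∈ normBall 1 ρ ↔ ‖(V : Op q n) - 1‖ ≤ ρ := by
  rw [mem_normBall, OneMemClass.coe_one]

theorem measurableSet_normBall (U : UnitaryOp q n) (ρ : ℝ) : MeasurableSet (normBall U ρ) := by
  refine IsClosed.measurableSet (isClosed_le ?_ continuous_const)
  fun_prop

theorem haarUnit_normBall (U : UnitaryOp q n) (ρ : ℝ) :
    haarUnit q n (normBall U ρ) = haarUnit q n (normBall 1 ρ) := by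
  have hpre : (fun V => U * V) ⁻¹' normBall U ρ = normBall 1 ρ := by
    ext V
    have h : ((U * V : UnitaryOp q n) : Op q n) - U =
        (U : Op q n) * ((V : Op q n) - ((1 : UnitaryOp q n) : Op q n)) := by
      rw [mul_sub, Submonoid.coe_mul, OneMemClass.coe_one, mul_one]
    rw [Set.mem_preimage, mem_normBall, mem_normBall, h, norm_unitary_mul]
  rw [← hpre, measure_preimage_mul]

theorem card_basis (q n : ℕ) : Fintype.card (Basis q n) = q ^ n := by simp

/-- At least `s ^ (-d ^ 2)` points of the self-adjoint unit ball are `s`-separated, and so are their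
Cayley transforms. The balls of radius `s / 2` around these are disjoint, have equal Haar measure,
and fit into total measure `1`. -/
theorem haarUnit_normBall_le {s : ℝ} (hs : 0 < s) :
    haarUnit q n (normBall 1 (s / 2)) ≤ ENNReal.ofReal (s ^ (q ^ n) ^ 2) := by
  classical
  obtain ⟨F, hF1, hF2, hF3⟩ := exists_separated_one_le_card_mul
    (E := selfAdjoint (Op q n)) hs
  rw [finrank_selfAdjoint_matrix, card_basis] at hF3
  let f : selfAdjoint (Op q n) → UnitaryOp q n := fun A =>
    ⟨2 • (1 - I • (A : Op q n))⁻¹ - 1, cayley_mem_unitaryGroup (selfAdjoint.mem_iff.1 A.2)⟩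
  have hsep : ∀ A ∈ F, ∀ B ∈ F, A ≠ B →
      s < ‖(f A : Op q n) - f B‖ := fun A hA B hB hAB =>
    (hF2 hA hB hAB).trans_le
      ((dist_eq_norm A B).le.trans
        (norm_sub_le_norm_cayley_sub A.2 B.2 (hF1 A hA) (hF1 B hB)))
  have hdisj : (F : Set _).PairwiseDisjoint fun A => normBall (f A) (s / 2) := by
    intro A hA B hB hAB
    rw [Function.onFun, Set.disjoint_left]
    intro V hVA hVB
    have h1 := hsep A hA B hB hAB
    have h2 : ‖(f A : Op q n) - f B‖ ≤ s / 2 + s / 2 := by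
      calc _ = ‖((V : Op q n) - f B) - (V - f A)‖ := by congr 1; abel
        _ ≤ _ := (norm_sub_le _ _).trans (add_le_add hVB hVA)
    linarith
  have hsum := prob_le_one (μ := haarUnit q n) (s := ⋃ A ∈ F, normBall (f A) (s / 2))
  rw [measure_biUnion_finset hdisj fun A _ => measurableSet_normBall _ _] at hsum
  simp only [haarUnit_normBall, Finset.sum_const, nsmul_eq_mul] at hsum
  calc haarUnit q n (normBall 1 (s / 2))
      ≤ ENNReal.ofReal ((F.card : ℝ) * s ^ (q ^ n) ^ 2) * haarUnit q n (normBall 1 (s / 2)) := by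
        refine le_mul_of_one_le_left (by positivity) ?_
        rw [← ENNReal.ofReal_one]
        exact ENNReal.ofReal_le_ofReal hF3
    _ = ENNReal.ofReal (s ^ (q ^ n) ^ 2) *
        ((F.card : ℝ≥0∞) * haarUnit q n (normBall 1 (s / 2))) := by
        rw [ENNReal.ofReal_mul (by positivity), ENNReal.ofReal_natCast]
        ring
    _ ≤ ENNReal.ofReal (s ^ (q ^ n) ^ 2) * 1 := by gcongr
    _ = _ := mul_one _

/-- The global phase `z` as a unitary operator. -/
def phase (q n : ℕ) (z : Circle) : UnitaryOp q n :=
  ⟨(z : ℂ) • 1, by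
    rw [Matrix.mem_unitaryGroup_iff, star_smul, star_one, Matrix.smul_mul, Matrix.mul_smul,
      smul_smul, mul_one]
    have h : (z : ℂ) * star (z : ℂ) = 1 := by
      rw [RCLike.star_def, Complex.mul_conj, Complex.normSq_eq_norm_sq, Circle.norm_coe]
      simp
    rw [h, one_smul]⟩

theorem coe_phase (z : Circle) :
    (phase q n z : Op q n) = (z : ℂ) • 1 := rfl

theorem norm_one_matrix_le {N : Type*} [Fintype N] [DecidableEq N] :
    ‖(1 : Matrix N N ℂ)‖ ≤ 1 := by
  rcases isEmpty_or_nonempty N with h | h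
  · rw [Subsingleton.elim (1 : Matrix N N ℂ) 0]; simp
  · exact CStarRing.norm_one.le

theorem exists_net_circle {δ : ℝ} (hδ : 0 < δ) (z : Circle) :
    ∃ k ∈ Finset.range (⌊2 * Real.pi / δ⌋₊ + 1),
      ‖(z : ℂ) - (Circle.exp (k * δ - Real.pi) : ℂ)‖ ≤ δ := by
  have h1 := Complex.neg_pi_lt_arg (z : ℂ)
  have h2 := Complex.arg_le_pi (z : ℂ)
  set θ := Complex.arg (z : ℂ) with hθ
  have hz : (z : ℂ) = Complex.exp (θ * I) := by
    have := Complex.norm_mul_exp_arg_mul_I (z : ℂ)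
    rw [Circle.norm_coe] at this
    simpa using this.symm
  have hnn : 0 ≤ (θ + Real.pi) / δ := div_nonneg (by linarith) hδ.le
  refine ⟨⌊(θ + Real.pi) / δ⌋₊, ?_, ?_⟩
  · rw [Finset.mem_range, Nat.lt_succ_iff]
    refine Nat.floor_le_floor ?_
    gcongr
    linarith
  · have h3 := Nat.floor_le hnn
    have h4 := Nat.lt_floor_add_one ((θ + Real.pi) / δ)
    rw [le_div_iff₀ hδ] at h3
    rw [div_lt_iff₀ hδ] at h4
    set k : ℝ := (⌊(θ + Real.pi) / δ⌋₊ : ℝ)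
    rw [hz, Circle.coe_exp]
    have h5 : Complex.exp (θ * I) - Complex.exp ((k * δ - Real.pi : ℝ) * I) =
        Complex.exp ((k * δ - Real.pi : ℝ) * I) *
          (Complex.exp (I * ((θ - (k * δ - Real.pi) : ℝ) : ℂ)) - 1) := by
      rw [mul_sub, mul_one, ← Complex.exp_add]
      congr 2
      push_cast
      ring
    rw [h5, norm_mul, Complex.norm_exp_ofReal_mul_I, one_mul]
    refine Real.norm_exp_I_mul_ofReal_sub_one_le.trans ?_
    rw [Real.norm_eq_abs, abs_le]
    constructor <;> linarith

/-- A ball of channels is a union over phases of norm balls. A net of about `2π / R` phases, at the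
price of doubling the radius, covers it; the factor `1 / R` lowers the exponent from `d ^ 2` to `d ^
2 - 1`. -/
theorem unitVol_le {R : ℝ} (hR : 0 < R) (hR1 : R ≤ 1) :
    unitVol q n R ≤ ENNReal.ofReal (7.3 / R * (4 * R) ^ (q ^ n) ^ 2) := by
  have hsub : unitBall (1 : UnitaryOp q n) R ⊆
      ⋃ k ∈ Finset.range (⌊2 * Real.pi / R⌋₊ + 1),
        normBall (phase q n (Circle.exp (k * R - Real.pi))) (4 * R / 2) := by
    intro U hU
    obtain ⟨z, hz⟩ := unitDist_le_iff.1 hU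
    obtain ⟨k, hk, hkz⟩ := exists_net_circle hR z
    refine Set.mem_biUnion hk ?_
    have h1 : ‖((z : ℂ) - (Circle.exp (k * R - Real.pi) : ℂ)) •
        (1 : Op q n)‖ ≤ R := by
      rw [norm_smul]
      calc _ ≤ R * 1 := by gcongr; exact norm_one_matrix_le
        _ = R := mul_one R
    have h2 : (U : Op q n) - phase q n (Circle.exp (k * R - Real.pi)) =
        ((U : Op q n) - (z : ℂ) • ((1 : UnitaryOp q n) :
          Op q n)) + ((z : ℂ) - (Circle.exp (k * R - Real.pi) : ℂ)) •
          (1 : Op q n) := by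
      rw [coe_phase, sub_smul, OneMemClass.coe_one]
      abel
    rw [mem_normBall, h2]
    calc _ ≤ R + R := (norm_add_le _ _).trans (add_le_add hz h1)
      _ = 4 * R / 2 := by ring
  -- The constant is `2 * 3.15 + 1`, with the extra net point bounded by `1 / R` since `R ≤ 1`.
  have hN : ((⌊2 * Real.pi / R⌋₊ + 1 : ℕ) : ℝ) ≤ 7.3 / R := by
    have h1 := Nat.floor_le (a := 2 * Real.pi / R) (by positivity)
    have h2 : (1 : ℝ) ≤ 1 / R := by rwa [le_div_iff₀ hR, one_mul]
    have h3 : 2 * Real.pi / R + 1 / R ≤ 7.3 / R := by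
      rw [← add_div]
      gcongr
      linarith [Real.pi_lt_d2]
    push_cast
    linarith
  calc unitVol q n R ≤ ∑ k ∈ Finset.range (⌊2 * Real.pi / R⌋₊ + 1),
        haarUnit q n (normBall (phase q n (Circle.exp (k * R - Real.pi))) (4 * R / 2)) :=
        (measure_mono hsub).trans (measure_biUnion_finset_le _ _)
    _ = ((⌊2 * Real.pi / R⌋₊ + 1 : ℕ) : ℝ≥0∞) * haarUnit q n (normBall 1 (4 * R / 2)) := by
        simp only [haarUnit_normBall, Finset.sum_const, nsmul_eq_mul, Finset.card_range]
    _ ≤ ENNReal.ofReal (7.3 / R) * ENNReal.ofReal ((4 * R) ^ (q ^ n) ^ 2) := by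
        gcongr
        · rw [← ENNReal.ofReal_natCast]
          exact ENNReal.ofReal_le_ofReal hN
        · exact haarUnit_normBall_le (by positivity)
    _ = _ := by rw [ENNReal.ofReal_mul (by positivity)]

theorem haarUnit_unitBall (V : UnitaryOp q n) (R : ℝ) :
    haarUnit q n (unitBall V R) = unitVol q n R := by
  have hpre : (fun U => V * U) ⁻¹' unitBall V R = unitBall 1 R := by
    ext U
    change unitDist (V * U) V ≤ R ↔ unitDist U 1 ≤ R
    rw [← unitDist_mul_left V U 1, mul_one]
  rw [unitVol, ← hpre, measure_preimage_mul]

theorem unitVol_pos {R : ℝ} (hR : 0 < R) : unitVol q n R ≠ 0 := by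
  have hopen : IsOpen {U : UnitaryOp q n |
      ‖(U : Op q n) - (1 : UnitaryOp q n)‖ < R} :=
    isOpen_lt (by fun_prop) continuous_const
  have hpos := hopen.measure_pos (haarUnit q n) ⟨1, by simpa using hR⟩
  refine (hpos.trans_le (measure_mono fun U hU => ?_)).ne'
  exact unitDist_le_iff.2 ⟨1, by simpa using (le_of_lt hU)⟩

/-- The inverse Cayley transform carries the set into a self-adjoint ball of radius `b / (2 - b)`.
The transform is 2-Lipschitz, so separation `a / 2` remains and the packing bound applies. -/
theorem card_le_of_separated_normBall {a b c : ℝ} (ha : 0 < a) (hb : b < 2) (hb0 : 0 ≤ b)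
    (hc : 1 + 4 * (b / (2 - b)) / a ≤ c) (F : Finset (UnitaryOp q n))
    (hF : (F : Set (UnitaryOp q n)) ⊆ normBall 1 b)
    (hsep : (F : Set (UnitaryOp q n)).Pairwise
      fun U V => a < ‖(U : Op q n) - V‖) :
    (F.card : ℝ) ≤ c ^ (q ^ n) ^ 2 := by
  classical
  have hρ : 0 ≤ b / (2 - b) := div_nonneg hb0 (by linarith)
  have hex : ∀ U : UnitaryOp q n, ∃ A : selfAdjoint (Op q n),
      U ∈ F → (U : Op q n) =
        2 • (1 - I • (A : Op q n))⁻¹ - 1 ∧ ‖A‖ ≤ b / (2 - b) := by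
    intro U
    by_cases hU : U ∈ F
    · obtain ⟨A, hA, h3, h4⟩ := exists_selfAdjoint_cayley_eq U.2 hb (mem_normBall_one.1 (hF hU))
      exact ⟨⟨A, hA⟩, fun _ => ⟨h3, h4⟩⟩
    · exact ⟨0, fun h => absurd h hU⟩
  choose g hg using hex
  have hsep' : ∀ U ∈ F, ∀ V ∈ F, U ≠ V → a / 2 < dist (g U) (g V) := by
    intro U hU V hV hUV
    have h3 := hsep hU hV hUV
    have h4 := norm_cayley_sub_le (selfAdjoint.mem_iff.1 (g U).2) (selfAdjoint.mem_iff.1 (g V).2)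
    rw [← (hg U hU).1, ← (hg V hV).1] at h4
    have h5 : dist (g U) (g V) =
      ‖(g U : Op q n) - (g V : Op q n)‖ := dist_eq_norm _ _
    rw [h5]
    linarith
  have hinj : Set.InjOn g F := by
    intro U hU V hV hUV
    by_contra hne
    have := hsep' U hU V hV hne
    rw [hUV, dist_self] at this
    linarith
  have hcard := card_le_of_separated hρ (half_pos ha) (F.image g)
    (by
      intro A hA
      obtain ⟨U, hU, rfl⟩ := Finset.mem_image.1 hA
      exact (hg U hU).2)
    (by
      intro A hA B hB hAB
      obtain ⟨U, hU, rfl⟩ := Finset.mem_image.1 hA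
      obtain ⟨V, hV, rfl⟩ := Finset.mem_image.1 hB
      exact hsep' U hU V hV fun h => hAB (h ▸ rfl))
  rw [Finset.card_image_of_injOn hinj, finrank_selfAdjoint_matrix, card_basis] at hcard
  refine hcard.trans (pow_le_pow_left₀ (by positivity) (le_trans (le_of_eq ?_) hc) _)
  generalize b / (2 - b) = x
  field_simp
  ring

/-- A maximal `a`-separated subset of the norm ball of radius `b` is an `a`-net, and the balls of
channels of radius `a` around it cover the ball of radius `b`. -/
theorem unitVol_le_mul_unitVol {a b c : ℝ} (ha : 0 < a) (hb : b < 2) (hb0 : 0 ≤ b)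
    (hc : 1 + 4 * (b / (2 - b)) / a ≤ c) :
    unitVol q n b ≤ ENNReal.ofReal (c ^ (q ^ n) ^ 2) * unitVol q n a := by
  obtain ⟨F, hF1, hF2, hF3⟩ := exists_maximal_separated (X := UnitaryOp q n)
    (fun U V => ‖(U : Op q n) - V‖) (fun U => by rw [sub_self, norm_zero])
    (fun U V => norm_sub_rev _ _) ha.le (normBall 1 b) (K := c ^ (q ^ n) ^ 2)
    (card_le_of_separated_normBall ha hb hb0 hc)
  have hcard := card_le_of_separated_normBall ha hb hb0 hc F hF1 hF2
  have hsub : unitBall (1 : UnitaryOp q n) b ⊆ ⋃ V ∈ F, unitBall V a := by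
    intro U hU
    obtain ⟨z, hz⟩ := unitDist_le_iff.1 hU
    -- Removing the optimal phase of `U` moves it into the norm ball without changing its channel.
    have hmul : ((phase q n z⁻¹ * U : UnitaryOp q n) : Op q n) =
        ((z⁻¹ : Circle) : ℂ) • (U : Op q n) := by
      rw [Submonoid.coe_mul, coe_phase, Matrix.smul_mul, one_mul]
    have hzz : ((z⁻¹ : Circle) : ℂ) * (z : ℂ) = 1 := by
      rw [← Circle.coe_mul, inv_mul_cancel, Circle.coe_one]
    have hmem : phase q n z⁻¹ * U ∈ normBall 1 b := by
      rw [mem_normBall, hmul]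
      have : ((z⁻¹ : Circle) : ℂ) • (U : Op q n) -
          ((1 : UnitaryOp q n) : Op q n) = ((z⁻¹ : Circle) : ℂ) •
            ((U : Op q n) - (z : ℂ) • ((1 : UnitaryOp q n) :
              Op q n)) := by
        rw [smul_sub, smul_smul, hzz, one_smul]
      rw [this, norm_smul, Circle.norm_coe, one_mul]
      exact hz
    obtain ⟨V, hV, hUV⟩ := hF3 _ hmem
    refine Set.mem_biUnion hV ?_
    change unitDist U V ≤ a
    rw [← unitDist_congr_of_eq_smul hmul]
    refine (unitDist_le _ V 1).trans ?_
    rw [Circle.coe_one, one_smul]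
    exact hUV
  calc unitVol q n b ≤ ∑ V ∈ F, haarUnit q n (unitBall V a) :=
        (measure_mono hsub).trans (measure_biUnion_finset_le _ _)
    _ = (F.card : ℝ≥0∞) * unitVol q n a := by
        simp only [haarUnit_unitBall, Finset.sum_const, nsmul_eq_mul]
    _ ≤ _ := by
        gcongr
        rw [← ENNReal.ofReal_natCast]
        exact ENNReal.ofReal_le_ofReal hcard

end UnitVol

/-! ## Complexity along the orbit of a point -/

section Orbit

variable {X : Type*} {act : UnitaryOp q n → X → X} {dist : X → X → ℝ}
  {G : Finset (UnitaryOp q n)} {x₀ : X} {ε : ℝ}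

/-- The least size of a circuit that maps `x₀` to within `ε` of `x`. -/
def orbitComplexity (act : UnitaryOp q n → X → X) (dist : X → X → ℝ)
    (G : Finset (UnitaryOp q n)) (x₀ : X) (ε : ℝ) (x : X) : ℕ∞ :=
  ⨅ l ∈ {l : ℕ | ∃ W ∈ circuits G l, dist x (act W x₀) ≤ ε}, (l : ℕ∞)

/-- Viewing a channel as the image of `1` under left multiplication lets channels and pure states
share every argument about walks and complexity. -/
theorem unitComplexity_eq_orbitComplexity (G : Finset (UnitaryOp q n)) (ε : ℝ) :
    unitComplexity G ε = orbitComplexity (· * ·) unitDist G 1 ε := by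
  funext U
  simp only [unitComplexity, orbitComplexity, mul_one]

theorem orbitComplexity_eq_zero_iff (hone : ∀ x, act 1 x = x) (x : X) :
    orbitComplexity act dist G x₀ ε x = 0 ↔ dist x x₀ ≤ ε := by
  rw [orbitComplexity, biInf_natCast_eq_zero_iff]
  constructor
  · rintro ⟨W, hW, h⟩
    rwa [mem_circuits_zero_iff.1 hW, hone] at h
  · intro h
    exact ⟨1, one_mem_circuits_zero G, by rwa [hone]⟩

theorem lt_orbitComplexity_of_notMem {r : ℝ} {x : X}
    (h : x ∉ nearCircuits act dist G x₀ ε r) :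
    (r : EReal) < natEReal (orbitComplexity act dist G x₀ ε x) := by
  refine lt_natEReal_biInf_of_forall _ fun l hl => ?_
  by_contra! hlr
  exact h ⟨l, hlr, hl⟩

theorem orbitComplexity_le_of_mem {m : ℕ} {x : X} (h : x ∈ nearCircuits act dist G x₀ ε m) :
    orbitComplexity act dist G x₀ ε x ≤ (m : ℕ∞) := by
  obtain ⟨l, hl, hW⟩ := h
  exact (iInf₂_le l hW).trans (by exact_mod_cast hl)

theorem act_mem_nearCircuits (hmul : ∀ V W x, act (V * W) x = act V (act W x))
    (hinv : ∀ W x y, dist (act W x) (act W y) = dist x y)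
    (hphase : ∀ V W, unitDist V W = 0 → ∀ x y, dist (act V x) y = dist (act W x) y)
    {k : ℕ} {V : UnitaryOp q n} (hV : ExactlyImplementable G k V) {r : ℝ} {x : X}
    (hx : x ∈ nearCircuits act dist G x₀ ε r) :
    act V x ∈ nearCircuits act dist G x₀ ε (r + k) := by
  obtain ⟨l, hl, W, hW, hVW⟩ := hV
  obtain ⟨l', hl', W', hW', hxW⟩ := hx
  refine ⟨l + l', ?_, W * W', mul_mem_circuits hW hW', ?_⟩
  · have : (l : ℝ) ≤ k := by exact_mod_cast hl
    push_cast
    linarith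
  · rw [hphase V W hVW, hmul, hinv]
    exact hxW

/-- Forward in time each step prepends at most `k` gates; backward in time the inverse of the step
does. -/
theorem orbitComplexity_walk_le (hmul : ∀ V W x, act (V * W) x = act V (act W x))
    (hone : ∀ x, act 1 x = x)
    (hinv : ∀ W x y, dist (act W x) (act W y) = dist x y)
    (hphase : ∀ V W, unitDist V W = 0 → ∀ x y, dist (act V x) y = dist (act W x) y)
    {k : ℕ} {ω : ℕ → UnitaryOp q n}
    (hω : ∀ i, ExactlyImplementable G k (ω i) ∧ ExactlyImplementable G k (ω i)⁻¹)
    {t : ℕ} (ht : orbitComplexity act dist G x₀ ε (act (walk ω t) x₀) = 0) (m : ℕ) :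
    orbitComplexity act dist G x₀ ε (act (walk ω (t + m)) x₀) ≤ ((k * m : ℕ) : ℕ∞) ∧
      (m ≤ t →
        orbitComplexity act dist G x₀ ε (act (walk ω (t - m)) x₀) ≤ ((k * m : ℕ) : ℕ∞)) := by
  have h0 : act (walk ω t) x₀ ∈ nearCircuits act dist G x₀ ε 0 := by
    refine ⟨0, by simp, 1, one_mem_circuits_zero G, ?_⟩
    rw [hone]
    exact (orbitComplexity_eq_zero_iff hone _).1 ht
  have hfor : ∀ m : ℕ,
      act (walk ω (t + m)) x₀ ∈ nearCircuits act dist G x₀ ε ((k * m : ℕ) : ℝ) := by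
    intro m
    induction m with
    | zero => simpa using h0
    | succ m ih =>
      have h := act_mem_nearCircuits hmul hinv hphase (hω (t + m)).1 ih
      rw [← hmul] at h
      have hk : ((k * (m + 1) : ℕ) : ℝ) = ((k * m : ℕ) : ℝ) + k := by push_cast; ring
      rw [hk]
      exact h
  have hback : ∀ m : ℕ, m ≤ t →
      act (walk ω (t - m)) x₀ ∈ nearCircuits act dist G x₀ ε ((k * m : ℕ) : ℝ) := by
    intro m
    induction m with
    | zero => intro _; simpa using h0
    | succ m ih =>
      intro hm
      have h := act_mem_nearCircuits hmul hinv hphase (hω (t - (m + 1))).2 (ih (by omega))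
      -- The subtraction is truncated; `m + 1 ≤ t` is what makes the two times consecutive.
      have hw : walk ω (t - m) = ω (t - (m + 1)) * walk ω (t - (m + 1)) := by
        conv_lhs => rw [show t - m = t - (m + 1) + 1 by omega]
        rfl
      rw [hw, ← hmul, inv_mul_cancel_left] at h
      have hk : ((k * (m + 1) : ℕ) : ℝ) = ((k * m : ℕ) : ℝ) + k := by push_cast; ring
      rw [hk]
      exact h
  exact ⟨orbitComplexity_le_of_mem (hfor m), fun hm => orbitComplexity_le_of_mem (hback m hm)⟩

theorem ae_stepsLaw_forall (ν : Measure (UnitaryOp q n)) [IsProbabilityMeasure ν]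
    {P : UnitaryOp q n → Prop} (h : ∀ᵐ V ∂ν, P V) : ∀ᵐ ω ∂(stepsLaw ν), ∀ i, P (ω i) :=
  ae_all_iff.2 fun i => (measurePreserving_eval_infinitePi (fun _ => ν) i).quasiMeasurePreserving.ae h

theorem cond_mono_of_ae {Ω : Type*} [MeasurableSpace Ω] (μ : Measure Ω) {A E F : Set Ω}
    (hA : MeasurableSet A) (h : ∀ᵐ ω ∂μ, ω ∈ A → ω ∈ E → ω ∈ F) :
    ProbabilityTheory.cond μ A E ≤ ProbabilityTheory.cond μ A F := by
  rw [ProbabilityTheory.cond_apply hA, ProbabilityTheory.cond_apply hA]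
  gcongr 1
  refine measure_mono_ae ?_
  filter_upwards [h] with ω hω hE
  exact ⟨hE.1, hω hE.1 hE.2⟩

variable [MeasurableSpace X]

theorem measurableSet_orbitComplexity_eq_zero
    (hact : Measurable fun x : UnitaryOp q n × X => act x.1 x.2) (hone : ∀ x, act 1 x = x)
    (hd : ∀ y, MeasurableSet {x | dist x y ≤ ε}) (t : ℕ) :
    MeasurableSet {ω | orbitComplexity act dist G x₀ ε (act (walk ω t) x₀) = 0} := by
  have hm : Measurable fun ω : ℕ → UnitaryOp q n => act (walk ω t) x₀ :=
    hact.comp ((measurable_walk t).prodMk measurable_const)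
  simp only [orbitComplexity_eq_zero_iff hone]
  exact hm (hd x₀)

theorem le_cond_lt_orbitComplexity (ν : Measure (UnitaryOp q n)) [IsProbabilityMeasure ν]
    (hact : Measurable fun x : UnitaryOp q n × X => act x.1 x.2)
    (hmul : ∀ V W x, act (V * W) x = act V (act W x)) (hone : ∀ x, act 1 x = x)
    (hd : ∀ y, MeasurableSet {x | dist x y ≤ ε}) (hg : 2 ≤ G.card) {T t : ℕ} (ht : 2 * T < t)
    {r v p ρ c : ℝ} (hp : 0 ≤ p) (hp1 : p ≤ 1) (hρ : 0 ≤ ρ) (hpρ : p * ρ ≤ 1)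
    (hc : c ≤ (1 - p) * (1 - p * ρ)) (hv0 : 0 ≤ v) {va : ℝ≥0∞} (hva : va ≠ 0)
    (hlow : ∀ x y, va ≤ convPow ν T {V | dist (act V x) y ≤ ε})
    (hup : ∀ x y, convPow ν T {V | dist (act V x) y ≤ ε} ≤ ENNReal.ofReal v)
    (hratio : ∀ x y, convPow ν T {V | dist (act V x) y ≤ ε} ≤ ENNReal.ofReal ρ * va)
    (hN : (G.card : ℝ) / (G.card - 1) * Real.exp (r * Real.log G.card) * v ≤ p) :
    stepsLaw ν {ω | orbitComplexity act dist G x₀ ε (act (walk ω t) x₀) = 0} ≠ 0 ∧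
      ENNReal.ofReal c ≤ ProbabilityTheory.cond (stepsLaw ν)
        {ω | orbitComplexity act dist G x₀ ε (act (walk ω t) x₀) = 0}
        {ω | (r : EReal) < natEReal (orbitComplexity act dist G x₀ ε (act (walk ω (t - T)) x₀)) ∧
          (r : EReal) < natEReal (orbitComplexity act dist G x₀ ε (act (walk ω (t + T)) x₀))} := by
  have hA := measurableSet_orbitComplexity_eq_zero (G := G) (x₀ := x₀) hact hone hd t
  have key := le_cond_notMem_of_forall_le ν hact hmul
    (measurableSet_nearCircuits (act := act) (G := G) (x₀ := x₀) (r := r) hd) (hd x₀) x₀ ht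
    hp hp1 hρ hpρ hc hva
    (fun x => measure_preimage_nearCircuits_le _ hg (fun V => act V x) (hup x) hv0 fun _ => hN)
    (fun x => hlow x x₀) (fun x => hratio x x₀)
  have hset : {ω : ℕ → UnitaryOp q n | act (walk ω t) x₀ ∈ {x | dist x x₀ ≤ ε}} =
      {ω | orbitComplexity act dist G x₀ ε (act (walk ω t) x₀) = 0} := by
    ext ω
    exact (orbitComplexity_eq_zero_iff hone _).symm
  rw [hset] at key
  refine ⟨key.1, key.2.trans (cond_mono_of_ae _ hA (Filter.Eventually.of_forall ?_))⟩
  intro ω _ hω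
  exact ⟨lt_orbitComplexity_of_notMem hω.1, lt_orbitComplexity_of_notMem hω.2⟩

theorem le_cond_dipLasts (ν : Measure (UnitaryOp q n)) [IsProbabilityMeasure ν]
    {C : (ℕ → UnitaryOp q n) → ℕ → ℕ∞} {r : ℝ} {t T k : ℕ} (hk : 1 ≤ k) (hT : 2 * T < t)
    (hA : MeasurableSet {ω | C ω t = 0})
    (hlin : ∀ᵐ ω ∂(stepsLaw ν), ∀ t, C ω t = 0 → ∀ m, C ω (t + m) ≤ ((k * m : ℕ) : ℕ∞) ∧
      (m ≤ t → C ω (t - m) ≤ ((k * m : ℕ) : ℕ∞))) {c : ℝ≥0∞}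
    (hc : c ≤ ProbabilityTheory.cond (stepsLaw ν) {ω | C ω t = 0}
      {ω | (r : EReal) < natEReal (C ω (t - T)) ∧ (r : EReal) < natEReal (C ω (t + T))}) :
    c ≤ ProbabilityTheory.cond (stepsLaw ν) {ω | C ω t = 0}
      {ω | DipLasts (C ω) r t (r / k) T} := by
  refine hc.trans (cond_mono_of_ae _ hA ?_)
  filter_upwards [hlin] with ω hω h0 hr
  exact dipLasts_of_le_mul hk (by omega) (fun m => (hω t h0 m).1) (fun m => (hω t h0 m).2)
    hr.1 hr.2

end Orbit

/-! ## Unitary channels -/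

/-- This is `g ^ r` for the threshold `r`, up to rounding the number of circuits of size `r`. Here
`D` is the volume exponent, and `x` is `cUp * β * ε` or `β * ε`. -/
theorem exp_threshold_mul {D g : ℕ} (hg : 2 ≤ g) {x Δ : ℝ} (hx : 0 < x) (hΔ : 0 < Δ) :
    Real.exp (((D : ℝ) * Real.log (1 / x) - Real.log (2 / Δ)) / Real.log g * Real.log g) =
      (1 / x) ^ D * (Δ / 2) := by
  have hlog : Real.log g ≠ 0 := (Real.log_pos (by exact_mod_cast hg)).ne'
  rw [div_mul_cancel₀ _ hlog, Real.exp_sub, Real.exp_log (by positivity), ← Real.log_pow,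
    Real.exp_log (by positivity)]
  field_simp

theorem cLow_div_three_le : cLow / 3 ≤ 1 / 81 ∧ 0 < cLow / 3 := by
  unfold cLow
  have := Real.pi_gt_three
  constructor
  · rw [div_div, div_le_div_iff₀ (by positivity) (by norm_num)]
    linarith
  · positivity

theorem three_le_sq_sub_one {d : ℕ} (hd : 2 ≤ d) : 3 ≤ d ^ 2 - 1 := by
  have : 2 ^ 2 ≤ d ^ 2 := Nat.pow_le_pow_left hd 2
  omega

theorem two_le_pow (hq : 2 ≤ q) (hn : 1 ≤ n) : 2 ≤ q ^ n :=
  hq.trans (Nat.le_self_pow (by omega) q)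

/-- Right multiplication is an isometry, so hitting the ball around `y` from `x` means lying in the
ball around `y * x⁻¹`. This makes the bounds uniform in the starting point. -/
theorem unitEquidistributed_preimage {α β ε : ℝ} {μ : Measure (UnitaryOp q n)}
    (h : UnitEquidistributed α β ε μ) (x y : UnitaryOp q n) :
    unitVol q n (α * ε) ≤ μ {V | unitDist (V * x) y ≤ ε} ∧
      μ {V | unitDist (V * x) y ≤ ε} ≤ unitVol q n (β * ε) := by
  have hset : {V | unitDist (V * x) y ≤ ε} = unitBall (y * x⁻¹) ε := by
    ext V
    change _ ↔ unitDist V (y * x⁻¹) ≤ ε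
    rw [← unitDist_mul_right x V (y * x⁻¹), inv_mul_cancel_right]
    rfl
  rw [hset]
  exact h.2.2.2 _ _ le_rfl

theorem unit_recurrence (hq : 2 ≤ q) (hn : 1 ≤ n) (G : Finset (UnitaryOp q n))
    (hG : 2 ≤ G.card) (ν : Measure (UnitaryOp q n)) [IsProbabilityMeasure ν]
    {ε Δ α β : ℝ} {T : ℕ} (hε : 0 < ε) (hε4 : ε < 1 / 4) (hΔ : 0 < Δ) (hΔ1 : Δ < 1)
    (heq : UnitEquidistributed α β ε (convPow ν T))
    (hΓ : max (1 - α) (β - 1) ≤ Δ / 6 * (cLow / 3) ^ ((q ^ n) ^ 2 - 1)) {t : ℕ} (ht : 2 * T < t) :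
    stepsLaw ν {ω | unitTrajectory G ε ω t = 0} ≠ 0 ∧
      ENNReal.ofReal (1 - 3 / 2 * Δ) ≤
        ProbabilityTheory.cond (stepsLaw ν) {ω | unitTrajectory G ε ω t = 0}
          {ω | (unitThreshold (q ^ n) G.card β ε Δ : EReal) <
              natEReal (unitTrajectory G ε ω (t - T)) ∧
            (unitThreshold (q ^ n) G.card β ε Δ : EReal) <
              natEReal (unitTrajectory G ε ω (t + T))} := by
  obtain ⟨D, hD⟩ : ∃ D, D = (q ^ n) ^ 2 - 1 := ⟨_, rfl⟩
  have hD3 : 3 ≤ D := hD ▸ three_le_sq_sub_one (two_le_pow hq hn)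
  have hdD : (q ^ n) ^ 2 = D + 1 := by omega
  have hdD' : (((q ^ n : ℕ) : ℝ)) ^ 2 - 1 = D := by
    have : (((q ^ n) ^ 2 : ℕ) : ℝ) = D + 1 := by rw [hdD]; push_cast; ring
    push_cast at this ⊢
    linarith
  have hα := heq.1
  have hα1 := heq.2.1
  have hβ1 := heq.2.2.1
  -- The bound on `Γ` is at most `1 / 6 * 1 / 81`. Only closeness of `α` and `β` to `1` matters
  -- here, because the doubling bound tolerates an exponentially large `ρ`.
  have hsmall : max (1 - α) (β - 1) ≤ 1 / 400 := by
    obtain ⟨h1, h2⟩ := cLow_div_three_le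
    rw [← hD] at hΓ
    have h3 : (cLow / 3) ^ D ≤ 1 / 81 :=
      (pow_le_of_le_one h2.le (by linarith) (by omega)).trans h1
    have h4 : 0 < (cLow / 3) ^ D := pow_pos h2 D
    nlinarith
  have hα' : 1 - 1 / 400 ≤ α := by linarith [le_max_left (1 - α) (β - 1)]
  have hβ' : β ≤ 1 + 1 / 400 := by linarith [le_max_right (1 - α) (β - 1)]
  have hβε : 0 < β * ε := by positivity
  have hβε1 : β * ε ≤ 0.26 := by nlinarith
  have hαε : 0 < α * ε := by positivity
  have hvol := unitVol_le (q := q) (n := n) hβε (by linarith)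
  -- With `b = β * ε ≤ 0.26` one has `2 - b ≥ 87 / 50`, and `β / α ≤ 1.01`, so `4 * (b / (2 - b)) /
  -- a ≤ 3` and `c = 4` is admissible.
  have hratio := unitVol_le_mul_unitVol (q := q) (n := n) (c := 4) hαε (b := β * ε)
    (by linarith) hβε.le (by
      have h1 : β * ε / (2 - β * ε) ≤ β * ε / (87 / 50) := by
        gcongr
        linarith
      have h2 : 4 * (β * ε / (87 / 50)) / (α * ε) ≤ 3 := by
        have h3 : β * ε ≤ 101 / 100 * α * ε := by gcongr; linarith
        rw [div_le_iff₀ hαε]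
        linarith
      have h3 : 4 * (β * ε / (2 - β * ε)) / (α * ε) ≤ 4 * (β * ε / (87 / 50)) / (α * ε) := by
        gcongr
      linarith)
  rw [hdD] at hvol hratio
  have hp3 : (4 / 87 : ℝ) ^ D ≤ (4 / 87) ^ 3 :=
    pow_le_pow_of_le_one (by norm_num) (by norm_num) hD3
  have hq3 : (16 / 87 : ℝ) ^ D ≤ (16 / 87) ^ 3 :=
    pow_le_pow_of_le_one (by norm_num) (by norm_num) hD3
  have hp0 : 0 < (4 / 87 : ℝ) ^ D := by positivity
  have hq0 : 0 < (16 / 87 : ℝ) ^ D := by positivity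
  -- The worst case is a single qubit, `D = 3`, where `116.8 * (16 / 87) ^ 3 < 0.75`. This is where
  -- the size of `cUp = 87` is used against `ρ`.
  have hpρ : Δ * 29.2 * (4 / 87) ^ D * 4 ^ (D + 1) = Δ * 116.8 * (16 / 87) ^ D := by
    have : (16 / 87 : ℝ) ^ D = (4 / 87) ^ D * 4 ^ D := by rw [← mul_pow]; norm_num
    rw [this]
    ring
  set p : ℝ := Δ * 29.2 * (4 / 87) ^ D with hp
  have hpp : 0 ≤ p := by positivity
  have hple : p ≤ 0.01 * Δ := by
    rw [hp]
    norm_num at hp3 ⊢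
    nlinarith
  have hpρle : p * 4 ^ (D + 1) ≤ 0.75 * Δ := by
    rw [hpρ]
    norm_num at hq3 ⊢
    nlinarith
  have hpρ0 : 0 ≤ p * 4 ^ (D + 1) := by positivity
  have hfinal := le_cond_lt_orbitComplexity (act := fun V x : UnitaryOp q n => V * x)
    (dist := unitDist) (G := G) (x₀ := 1) (ε := ε) ν measurable_mul mul_assoc one_mul
    (fun y => (isClosed_unitBall y ε).measurableSet) hG ht
    (r := unitThreshold (q ^ n) G.card β ε Δ)
    (v := 7.3 / (β * ε) * (4 * (β * ε)) ^ (D + 1)) (p := p) (ρ := 4 ^ (D + 1))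
    (c := 1 - 3 / 2 * Δ) hpp (by linarith) (by positivity) (by linarith) (by nlinarith)
    (by positivity) (unitVol_pos hαε)
    (fun x y => (unitEquidistributed_preimage heq x y).1)
    (fun x y => (unitEquidistributed_preimage heq x y).2.trans hvol)
    (fun x y => (unitEquidistributed_preimage heq x y).2.trans hratio) (by
      have hx : 0 < cUp * β * ε := by unfold cUp; positivity
      rw [unitThreshold, hdD', exp_threshold_mul hG hx hΔ]
      have hg : (2 : ℝ) ≤ G.card := by exact_mod_cast hG
      have hgg : (G.card : ℝ) / (G.card - 1) ≤ 2 := by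
        rw [div_le_iff₀ (by linarith)]
        linarith
      -- The powers of `β * ε` cancel, leaving `(4 / 87) ^ D`. The constant is `29.2 = 2 * (1 / 2) *
      -- 7.3 * 4`, with `|G| / (|G| - 1) ≤ 2`.
      calc (G.card : ℝ) / (G.card - 1) * ((1 / (cUp * β * ε)) ^ D * (Δ / 2)) *
            (7.3 / (β * ε) * (4 * (β * ε)) ^ (D + 1))
          ≤ 2 * ((1 / (cUp * β * ε)) ^ D * (Δ / 2)) *
            (7.3 / (β * ε) * (4 * (β * ε)) ^ (D + 1)) := by gcongr
        _ = Δ * 29.2 * ((1 / (cUp * β * ε)) * (4 * (β * ε))) ^ D := by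
            rw [mul_pow (1 / _), pow_succ]
            generalize (1 / (cUp * β * ε)) ^ D = A
            generalize (4 * (β * ε)) ^ D = B
            field_simp
            ring
        _ = p := by
            rw [hp]
            congr 2
            unfold cUp
            field_simp)
  simpa only [unitTrajectory, unitComplexity_eq_orbitComplexity, mul_one] using hfinal

theorem unit_linear (G : Finset (UnitaryOp q n)) (ν : Measure (UnitaryOp q n))
    [IsProbabilityMeasure ν] (ε : ℝ) {k : ℕ}
    (hk : ∀ᵐ V ∂ν, ExactlyImplementable G k V ∧ ExactlyImplementable G k V⁻¹) :
    ∀ᵐ ω ∂(stepsLaw ν), ∀ t, unitTrajectory G ε ω t = 0 → ∀ m,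
      unitTrajectory G ε ω (t + m) ≤ ((k * m : ℕ) : ℕ∞) ∧
        (m ≤ t → unitTrajectory G ε ω (t - m) ≤ ((k * m : ℕ) : ℕ∞)) := by
  filter_upwards [ae_stepsLaw_forall ν hk] with ω hω t ht m
  have h := orbitComplexity_walk_le (act := fun V x : UnitaryOp q n => V * x) (dist := unitDist)
    (G := G) (x₀ := 1) (ε := ε) mul_assoc one_mul unitDist_mul_left
    (fun V W hVW x y => by
      obtain ⟨z, hz⟩ := exists_eq_smul_of_unitDist_eq_zero hVW
      refine unitDist_congr_of_eq_smul (z := z) ?_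
      rw [Submonoid.coe_mul, Submonoid.coe_mul, hz, Matrix.smul_mul]) hω (t := t)
  simp only [unitTrajectory, unitComplexity_eq_orbitComplexity] at ht ⊢
  simp only [mul_one] at h
  exact h ht m

theorem measurableSet_unitTrajectory_eq_zero (G : Finset (UnitaryOp q n)) (ε : ℝ) (t : ℕ) :
    MeasurableSet {ω | unitTrajectory G ε ω t = 0} := by
  have h := measurableSet_orbitComplexity_eq_zero (act := fun V x : UnitaryOp q n => V * x)
    (dist := unitDist) (G := G) (x₀ := 1) (ε := ε) measurable_mul one_mul
    (fun y => (isClosed_unitBall y ε).measurableSet) t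
  simpa only [unitTrajectory, unitComplexity_eq_orbitComplexity, mul_one] using h

/-! ## The distance of pure states -/

open scoped ComplexOrder in
/-- The trace norm of a matrix whose modulus has at most one nonzero eigenvalue. -/
theorem traceNorm_eq_of_sq_eq {N : Type*} [Fintype N] [DecidableEq N] {A : Matrix N N ℂ} {s : ℝ}
    (hsq : (Aᴴ * A) * (Aᴴ * A) = (s : ℂ) • (Aᴴ * A)) (htr : (Aᴴ * A).trace = ((2 * s : ℝ) : ℂ)) :
    0 ≤ s ∧ traceNorm A = 2 * Real.sqrt s := by
  have hH := Matrix.isHermitian_conjTranspose_mul_self A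
  have hnn : ∀ i, 0 ≤ hH.eigenvalues i := (Matrix.posSemidef_conjTranspose_mul_self A).eigenvalues_nonneg
  have hsum : ∑ i, hH.eigenvalues i = 2 * s := by
    have := hH.trace_eq_sum_eigenvalues
    rw [htr] at this
    have h := congrArg Complex.re this
    rw [Complex.ofReal_re, Complex.re_sum] at h
    exact h.symm
  have heig : ∀ i, hH.eigenvalues i * hH.eigenvalues i = s * hH.eigenvalues i := by
    intro i
    have h1 := hH.mulVec_eigenvectorBasis i
    set u : N → ℂ := ⇑(hH.eigenvectorBasis i) with hu
    have h2 : ((Aᴴ * A) * (Aᴴ * A)) *ᵥ u = (hH.eigenvalues i * hH.eigenvalues i) • u := by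
      rw [← Matrix.mulVec_mulVec, h1, Matrix.mulVec_smul, h1, smul_smul]
    rw [hsq, Matrix.smul_mulVec, h1] at h2
    have hu0 : u ≠ 0 := by
      intro h0
      have h3 := hH.eigenvectorBasis.orthonormal.norm_eq_one i
      have h4 : hH.eigenvectorBasis i = 0 := by
        ext j
        exact congrFun h0 j
      rw [h4, norm_zero] at h3
      exact zero_ne_one h3
    have h5 : (s * hH.eigenvalues i) • u = (hH.eigenvalues i * hH.eigenvalues i) • u := by
      rw [← h2, mul_smul]
      ext j
      simp
    exact (smul_left_injective ℝ hu0 h5).symm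
  have hs : 0 ≤ s := by
    have := Finset.sum_nonneg fun i (_ : i ∈ Finset.univ) => hnn i
    linarith
  refine ⟨hs, ?_⟩
  -- Every eigenvalue of `Aᴴ * A` is `0` or `s`. Summing this identity gives `traceNorm A * √s = 2 *
  -- s` without counting multiplicities.
  have hsqrt : ∀ i, Real.sqrt (hH.eigenvalues i) * Real.sqrt s = hH.eigenvalues i := by
    intro i
    rcases eq_or_ne (hH.eigenvalues i) 0 with h0 | h0
    · simp [h0]
    · rw [mul_right_cancel₀ h0 (heig i)]
      exact Real.mul_self_sqrt hs
  rcases hs.eq_or_lt with h0 | h0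
  · have : ∀ i, hH.eigenvalues i = 0 := fun i => by
      have := heig i
      rw [← h0, zero_mul] at this
      exact mul_self_eq_zero.1 this
    simp [traceNorm, this, ← h0]
  · have h1 : traceNorm A * Real.sqrt s = 2 * s := by
      rw [traceNorm, Finset.sum_mul, ← hsum]
      exact Finset.sum_congr rfl fun i _ => hsqrt i
    have h2 : 0 < Real.sqrt s := Real.sqrt_pos.2 h0
    have h3 : Real.sqrt s * Real.sqrt s = s := Real.mul_self_sqrt hs
    refine mul_right_cancel₀ h2.ne' ?_
    rw [h1, mul_assoc, h3]

theorem trace_mul_vecMulVec {N : Type*} [Fintype N] (v w : N → ℂ) :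
    (vecMulVec v (star v) * vecMulVec w (star w)).trace =
      ((‖star v ⬝ᵥ w‖ ^ 2 : ℝ) : ℂ) := by
  rw [vecMulVec_mul_vecMulVec, vecMulVec_smul, trace_smul, trace_vecMulVec, smul_eq_mul,
    ← Complex.normSq_eq_norm_sq, ← Complex.mul_conj]
  congr 1
  rw [← RCLike.star_def, star_dotProduct, star_star, dotProduct_comm]

/-- For projectors `P`, `Q` with overlap `c`, the relation `PQP = c P` and its mirror give `(P - Q)
^ 3 = (1 - c) (P - Q)`, and `(P - Q) ^ 2` has trace `2 (1 - c)`. Thus `traceNorm_eq_of_sq_eq`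
applies. -/
theorem stateDist_eq_sqrt (ψ φ : PureState q n) {v w : Basis q n → ℂ}
    (hv : star v ⬝ᵥ v = 1) (hw : star w ⬝ᵥ w = 1) (hψ : ψ.1 = vecMulVec v (star v))
    (hφ : φ.1 = vecMulVec w (star w)) :
    0 ≤ 1 - ‖star v ⬝ᵥ w‖ ^ 2 ∧ stateDist ψ φ = Real.sqrt (1 - ‖star v ⬝ᵥ w‖ ^ 2) := by
  have hP : ∀ {a b : Basis q n → ℂ}, star a ⬝ᵥ a = 1 →
      vecMulVec a (star a) * vecMulVec b (star b) * vecMulVec a (star a) =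
        ((‖star a ⬝ᵥ b‖ ^ 2 : ℝ) : ℂ) • vecMulVec a (star a) := by
    intro a b ha
    rw [← trace_mul_vecMulVec, vecMulVec_mul_vecMulVec, vecMulVec_smul, Matrix.smul_mul,
      vecMulVec_mul_vecMulVec, vecMulVec_smul, trace_smul, trace_vecMulVec, smul_smul,
      smul_eq_mul, dotProduct_comm a (star b)]
  have hPP : ∀ {a : Basis q n → ℂ}, star a ⬝ᵥ a = 1 →
      vecMulVec a (star a) * vecMulVec a (star a) = vecMulVec a (star a) := by
    intro a ha
    rw [vecMulVec_mul_vecMulVec, ha, one_smul]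
  have hH : ∀ a : Basis q n → ℂ, (vecMulVec a (star a))ᴴ = vecMulVec a (star a) := by
    intro a
    rw [conjTranspose_vecMulVec, star_star]
  have htr : ∀ {a : Basis q n → ℂ}, star a ⬝ᵥ a = 1 → (vecMulVec a (star a)).trace = 1 := by
    intro a ha
    rw [trace_vecMulVec, dotProduct_comm, ha]
  have e1 := hPP hv
  have e2 := hPP hw
  have e3 := hP (b := w) hv
  have e4 := hP (b := v) hw
  have e5 := trace_mul_vecMulVec v w
  have hsymm : ‖star w ⬝ᵥ v‖ = ‖star v ⬝ᵥ w‖ := by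
    rw [← norm_star (star w ⬝ᵥ v), star_dotProduct, star_star, dotProduct_comm]
  rw [hsymm] at e4
  have e6 := trace_mul_vecMulVec w v
  rw [hsymm] at e6
  have e7 := htr hv
  have e8 := htr hw
  have e9 := hH v
  have e10 := hH w
  rw [stateDist, hψ, hφ]
  generalize vecMulVec v (star v) = P at *
  generalize vecMulVec w (star w) = Q at *
  generalize ‖star v ⬝ᵥ w‖ ^ 2 = c at *
  have hA : (P - Q)ᴴ * (P - Q) = P + Q - P * Q - Q * P := by
    rw [conjTranspose_sub, e9, e10, sub_mul, mul_sub, mul_sub, e1, e2]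
    abel
  have hcube : (P - Q) * (P + Q - P * Q - Q * P) = ((1 - c : ℝ) : ℂ) • (P - Q) := by
    calc (P - Q) * (P + Q - P * Q - Q * P)
        = P * P + P * Q - (P * P) * Q - P * Q * P - Q * P - Q * Q + Q * P * Q + (Q * Q) * P := by
          noncomm_ring
      _ = _ := by
          rw [e1, e2, e3, e4]
          push_cast
          rw [sub_smul, one_smul, smul_sub]
          abel
  obtain ⟨h0, h1⟩ := traceNorm_eq_of_sq_eq (A := P - Q) (s := 1 - c)
    (by
      calc _ = (P - Q)ᴴ * ((P - Q) * (P + Q - P * Q - Q * P)) := by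
            rw [hA, ← hA, Matrix.mul_assoc]
        _ = _ := by rw [hcube, Matrix.mul_smul])
    (by
      rw [hA, trace_sub, trace_sub, trace_add, e5, e6, e7, e8]
      push_cast
      ring)
  refine ⟨h0, ?_⟩
  rw [h1]
  ring

/-- Free of representing vectors, this form shows continuity and unitary invariance directly. -/
theorem stateDist_eq_sqrt_trace (ψ φ : PureState q n) :
    stateDist ψ φ = Real.sqrt (1 - (ψ.1 * φ.1).trace.re) := by
  obtain ⟨v, hv, hψ⟩ := ψ.2
  obtain ⟨w, hw, hφ⟩ := φ.2
  rw [(stateDist_eq_sqrt ψ φ hv hw hψ hφ).2, hψ, hφ, trace_mul_vecMulVec, Complex.ofReal_re]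

theorem isClosed_stateBall (φ : PureState q n) (R : ℝ) : IsClosed (stateBall φ R) := by
  refine isClosed_le ?_ continuous_const
  simp only [stateDist_eq_sqrt_trace]
  have : Continuous fun ψ : PureState q n => ψ.1 := continuous_subtype_val
  refine Real.continuous_sqrt.comp (continuous_const.sub (Complex.continuous_re.comp ?_))
  exact (this.matrix_mul continuous_const).matrix_trace

theorem applyState_coe (U : UnitaryOp q n) (ψ : PureState q n) :
    (applyState U ψ).1 = (U : Matrix (Basis q n) (Basis q n) ℂ) * ψ.1 *
      (U : Matrix (Basis q n) (Basis q n) ℂ)ᴴ := rfl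

theorem applyState_mul (U V : UnitaryOp q n) (ψ : PureState q n) :
    applyState (U * V) ψ = applyState U (applyState V ψ) := by
  apply Subtype.ext
  rw [applyState_coe, applyState_coe, applyState_coe, Submonoid.coe_mul, conjTranspose_mul]
  simp only [Matrix.mul_assoc]

theorem applyState_one (ψ : PureState q n) : applyState 1 ψ = ψ := by
  apply Subtype.ext
  rw [applyState_coe, OneMemClass.coe_one, conjTranspose_one, Matrix.one_mul, Matrix.mul_one]

theorem conjTranspose_mul_coe (U : UnitaryOp q n) :
    (U : Matrix (Basis q n) (Basis q n) ℂ)ᴴ * (U : Matrix (Basis q n) (Basis q n) ℂ) = 1 :=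
  Matrix.UnitaryGroup.star_mul_self U

theorem stateDist_applyState (U : UnitaryOp q n) (ψ φ : PureState q n) :
    stateDist (applyState U ψ) (applyState U φ) = stateDist ψ φ := by
  rw [stateDist_eq_sqrt_trace, stateDist_eq_sqrt_trace, applyState_coe, applyState_coe]
  congr 3
  set M := (U : Matrix (Basis q n) (Basis q n) ℂ)
  have hU : Mᴴ * M = 1 := conjTranspose_mul_coe U
  calc (M * ψ.1 * Mᴴ * (M * φ.1 * Mᴴ)).trace = (M * (ψ.1 * (Mᴴ * M) * φ.1 * Mᴴ)).trace := by
        simp only [Matrix.mul_assoc]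
    _ = (ψ.1 * φ.1 * (Mᴴ * M)).trace := by
        rw [Matrix.trace_mul_comm, hU, Matrix.mul_one, Matrix.mul_assoc, hU]
    _ = _ := by rw [hU, Matrix.mul_one]

theorem applyState_eq_of_unitDist_eq_zero {V W : UnitaryOp q n} (h : unitDist V W = 0)
    (ψ : PureState q n) : applyState V ψ = applyState W ψ := by
  obtain ⟨z, hz⟩ := exists_eq_smul_of_unitDist_eq_zero h
  apply Subtype.ext
  rw [applyState_coe, applyState_coe, hz, conjTranspose_smul, Matrix.smul_mul, Matrix.smul_mul,
    Matrix.mul_smul, smul_smul]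
  have : (z : ℂ) * star (z : ℂ) = 1 := by
    rw [RCLike.star_def, Complex.mul_conj, Complex.normSq_eq_norm_sq, Circle.norm_coe]
    simp
  rw [this, one_smul]

theorem continuous_applyState :
    Continuous fun x : UnitaryOp q n × PureState q n => applyState x.1 x.2 := by
  refine Continuous.subtype_mk ?_ _
  have h1 : Continuous fun U : UnitaryOp q n => (U : Matrix (Basis q n) (Basis q n) ℂ) :=
    continuous_subtype_val
  have h2 : Continuous fun ψ : PureState q n => ψ.1 := continuous_subtype_val
  have h3 := h1.comp (continuous_fst (X := UnitaryOp q n) (Y := PureState q n))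
  have h4 := h2.comp (continuous_snd (X := UnitaryOp q n) (Y := PureState q n))
  exact (h3.matrix_mul h4).matrix_mul h3.matrix_conjTranspose

theorem measurable_applyState :
    Measurable fun x : UnitaryOp q n × PureState q n => applyState x.1 x.2 :=
  continuous_applyState.measurable

theorem measurable_applyState_left (ψ : PureState q n) :
    Measurable fun U : UnitaryOp q n => applyState U ψ := by
  have h1 : Continuous fun U : UnitaryOp q n => (U : Matrix (Basis q n) (Basis q n) ℂ) :=
    continuous_subtype_val
  have h : Continuous fun U : UnitaryOp q n => applyState U ψ :=
    Continuous.subtype_mk ((h1.matrix_mul continuous_const).matrix_mul h1.matrix_conjTranspose) _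
  exact h.measurable

/-! ## Gaussian integrals over cones -/

theorem lintegral_Ioi_mul_exp_neg_mul_sq {b x₀ : ℝ} (hb : 0 < b) (hx : 0 ≤ x₀) :
    ∫⁻ x in Set.Ioi x₀, ENNReal.ofReal (x * Real.exp (-b * x ^ 2)) =
      ENNReal.ofReal (1 / (2 * b) * Real.exp (-b * x₀ ^ 2)) := by
  have hderiv : ∀ x ∈ Set.Ici x₀, HasDerivAt (fun x => -(1 / (2 * b)) * Real.exp (-b * x ^ 2))
      (x * Real.exp (-b * x ^ 2)) x := by
    intro x _
    have h1 : HasDerivAt (fun x : ℝ => -b * x ^ 2) (-b * (2 * x)) x := by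
      simpa using (hasDerivAt_pow 2 x).const_mul (-b)
    have h2 := (h1.exp).const_mul (-(1 / (2 * b)))
    refine h2.congr_deriv ?_
    have hb' : 1 / (2 * b) * (2 * b) = 1 := one_div_mul_cancel (by positivity)
    linear_combination (x * Real.exp (-b * x ^ 2)) * hb'
  have hpos : ∀ x ∈ Set.Ioi x₀, 0 ≤ x * Real.exp (-b * x ^ 2) := fun x hx' =>
    mul_nonneg (hx.trans (le_of_lt hx')) (Real.exp_pos _).le
  have hlim : Filter.Tendsto (fun x : ℝ => -(1 / (2 * b)) * Real.exp (-b * x ^ 2)) Filter.atTop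
      (nhds 0) := by
    have h1 : Filter.Tendsto (fun x : ℝ => -b * x ^ 2) Filter.atTop Filter.atBot :=
      (Filter.tendsto_pow_atTop two_ne_zero).const_mul_atTop_of_neg (neg_lt_zero.2 hb)
    simpa using (Real.tendsto_exp_atBot.comp h1).const_mul (-(1 / (2 * b)))
  rw [← ofReal_integral_eq_lintegral_ofReal (integrableOn_Ioi_deriv_of_nonneg' hderiv hpos hlim)
    ((ae_restrict_iff' measurableSet_Ioi).2 (Filter.Eventually.of_forall hpos)),
    integral_Ioi_of_hasDerivAt_of_nonneg' hderiv hpos hlim]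
  congr 1
  ring

/-- In polar coordinates the area factor makes the radial integrand an exact derivative, so the tail
beyond `√s` is explicit. -/
theorem lintegral_complex_indicator_exp_neg_mul_sq {b s : ℝ} (hb : 0 < b) (hs : 0 ≤ s) :
    ∫⁻ a : ℂ, {a : ℂ | s ≤ ‖a‖ ^ 2}.indicator (fun a => ENNReal.ofReal (Real.exp (-b * ‖a‖ ^ 2))) a =
      ENNReal.ofReal (Real.pi / b * Real.exp (-b * s)) := by
  let f : ℝ → ℝ≥0∞ := (Set.Ici (Real.sqrt s)).indicator
    fun x => ENNReal.ofReal (x * Real.exp (-b * x ^ 2))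
  have hf : Measurable f :=
    (Measurable.ennreal_ofReal (by fun_prop)).indicator measurableSet_Ici
  rw [← Complex.lintegral_comp_polarCoord_symm, polarCoord_target]
  have hcongr : ∀ p ∈ Set.Ioi (0 : ℝ) ×ˢ Set.Ioo (-Real.pi) Real.pi,
      ENNReal.ofReal p.1 • {a : ℂ | s ≤ ‖a‖ ^ 2}.indicator
        (fun a => ENNReal.ofReal (Real.exp (-b * ‖a‖ ^ 2))) (Complex.polarCoord.symm p) =
      f p.1 := by
    intro p hp
    have hp0 : 0 < p.1 := hp.1
    have hmem : Complex.polarCoord.symm p ∈ {a : ℂ | s ≤ ‖a‖ ^ 2} ↔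
        p.1 ∈ Set.Ici (Real.sqrt s) := by
      change s ≤ ‖Complex.polarCoord.symm p‖ ^ 2 ↔ Real.sqrt s ≤ p.1
      rw [Complex.norm_polarCoord_symm, sq_abs, Real.sqrt_le_left hp0.le]
    by_cases h : p.1 ∈ Set.Ici (Real.sqrt s)
    · rw [Set.indicator_of_mem (hmem.2 h), smul_eq_mul, ← ENNReal.ofReal_mul hp0.le,
        Complex.norm_polarCoord_symm, sq_abs]
      exact (Set.indicator_of_mem (s := Set.Ici (Real.sqrt s)) h
        fun x => ENNReal.ofReal (x * Real.exp (-b * x ^ 2))).symm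
    · rw [Set.indicator_of_notMem (fun h' => h (hmem.1 h')), smul_zero]
      exact (Set.indicator_of_notMem (s := Set.Ici (Real.sqrt s)) h
        fun x => ENNReal.ofReal (x * Real.exp (-b * x ^ 2))).symm
  rw [setLIntegral_congr_fun (measurableSet_Ioi.prod measurableSet_Ioo) hcongr,
    Measure.volume_eq_prod, setLIntegral_prod (fun p : ℝ × ℝ => f p.1)
      (hf.comp measurable_fst).aemeasurable]
  simp only [setLIntegral_const, Real.volume_Ioo]
  rw [lintegral_mul_const _ hf, setLIntegral_indicator measurableSet_Ici]
  have hae : (Set.Ici (Real.sqrt s) ∩ Set.Ioi 0 : Set ℝ) =ᵐ[volume] Set.Ioi (Real.sqrt s) := by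
    have h1 : (Set.Ici (Real.sqrt s) ∩ Set.Ioi 0 : Set ℝ) =ᵐ[volume]
        (Set.Ioi (Real.sqrt s) ∩ Set.Ioi 0 : Set ℝ) :=
      ae_eq_set_inter Ioi_ae_eq_Ici.symm Filter.EventuallyEq.rfl
    rwa [Set.Ioi_inter_Ioi, max_eq_left (Real.sqrt_nonneg s)] at h1
  rw [setLIntegral_congr hae, lintegral_Ioi_mul_exp_neg_mul_sq hb (Real.sqrt_nonneg s),
    Real.sq_sqrt hs, ← ENNReal.ofReal_mul (by positivity)]
  congr 1
  field_simp
  ring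

theorem lintegral_complex_exp_neg_mul_sq {b : ℝ} (hb : 0 < b) :
    ∫⁻ a : ℂ, ENNReal.ofReal (Real.exp (-b * ‖a‖ ^ 2)) = ENNReal.ofReal (Real.pi / b) := by
  have h := lintegral_complex_indicator_exp_neg_mul_sq hb le_rfl
  have hset : {a : ℂ | (0 : ℝ) ≤ ‖a‖ ^ 2} = Set.univ := by
    ext a
    simp
  rw [hset] at h
  simpa using h

theorem lintegral_pi_exp_neg_mul_sq {ι : Type*} [Fintype ι] {b : ℝ} (hb : 0 < b) :
    ∫⁻ w : ι → ℂ, ENNReal.ofReal (Real.exp (-b * ∑ i, ‖w i‖ ^ 2)) =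
      ENNReal.ofReal ((Real.pi / b) ^ Fintype.card ι) := by
  have hnn : ∀ a : ℂ, 0 ≤ Real.exp (-b * ‖a‖ ^ 2) := fun a => (Real.exp_pos _).le
  have hint : Integrable fun a : ℂ => Real.exp (-b * ‖a‖ ^ 2) := by
    refine ⟨by fun_prop, ?_⟩
    rw [hasFiniteIntegral_iff_ofReal (Filter.Eventually.of_forall hnn),
      lintegral_complex_exp_neg_mul_sq hb]
    exact ENNReal.ofReal_lt_top
  have hval : ∫ a : ℂ, Real.exp (-b * ‖a‖ ^ 2) = Real.pi / b := by
    rw [integral_eq_lintegral_of_nonneg_ae (Filter.Eventually.of_forall hnn) hint.1,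
      lintegral_complex_exp_neg_mul_sq hb, ENNReal.toReal_ofReal (by positivity)]
  have hprod : ∀ w : ι → ℂ, Real.exp (-b * ∑ i, ‖w i‖ ^ 2) =
      ∏ i, Real.exp (-b * ‖w i‖ ^ 2) := fun w => by
    rw [Finset.mul_sum, Real.exp_sum]
  simp only [hprod]
  have hI : Integrable fun w : ι → ℂ => ∏ i, Real.exp (-b * ‖w i‖ ^ 2) :=
    Integrable.fintype_prod (μ := fun _ => (volume : Measure ℂ)) fun _ => hint
  rw [← ofReal_integral_eq_lintegral_ofReal hI
    (Filter.Eventually.of_forall fun w => Finset.prod_nonneg fun i _ => hnn _),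
    integral_fintype_prod_volume_eq_prod (fun _ a => Real.exp (-b * ‖a‖ ^ 2))]
  rw [Finset.prod_const, hval, Finset.card_univ]

/-- The standard Gaussian weight on `ι → ℂ`, not normalized. -/
def gaussian (ι : Type*) [Fintype ι] : Measure (ι → ℂ) :=
  volume.withDensity fun z => ENNReal.ofReal (Real.exp (-∑ i, ‖z i‖ ^ 2))

theorem measurable_gaussian_density (ι : Type*) [Fintype ι] :
    Measurable fun z : ι → ℂ => ENNReal.ofReal (Real.exp (-∑ i, ‖z i‖ ^ 2)) := by
  fun_prop

/-- The vectors whose component in the direction `w` has at least the share `1 - R ^ 2` of the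
squared norm. -/
def cone {ι : Type*} [Fintype ι] (w : ι → ℂ) (R : ℝ) : Set (ι → ℂ) :=
  {z | (1 - R ^ 2) * ∑ i, ‖z i‖ ^ 2 ≤ ‖star w ⬝ᵥ z‖ ^ 2}

theorem measurableSet_cone {ι : Type*} [Fintype ι] (w : ι → ℂ) (R : ℝ) :
    MeasurableSet (cone w R) := by
  refine measurableSet_le (by fun_prop) ?_
  unfold dotProduct
  fun_prop

/-- Integrating first over the coordinate at `i₀` gives `π * exp (-κ * S)`, where `S` is the squared
norm of the others. What remains is a full Gaussian integral of rate `κ + 1 = 1 / R ^ 2` in one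
dimension fewer. -/
theorem gaussian_cone_single {ι : Type*} [Fintype ι] [DecidableEq ι] (i₀ : ι) {R : ℝ}
    (hR : 0 < R) (hR1 : R ≤ 1) :
    gaussian ι (cone (Pi.single i₀ 1) R) =
      ENNReal.ofReal (Real.pi ^ Fintype.card ι * (R ^ 2) ^ (Fintype.card ι - 1)) := by
  let J := {i : ι // ¬ i = i₀}
  have hmp : MeasurePreserving (fun z : ι → ℂ => (z i₀, fun j : J => z j)) volume
      ((volume : Measure ℂ).prod (volume : Measure (J → ℂ))) := by
    have h0 : MeasurePreserving (MeasurableEquiv.funUnique {i : ι // i = i₀} ℂ)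
        (volume : Measure ({i : ι // i = i₀} → ℂ)) volume := by
      convert volume_preserving_funUnique {i : ι // i = i₀} ℂ
    have h1 := h0.prod (MeasurePreserving.id (volume : Measure (J → ℂ)))
    have h2 : MeasurePreserving
        (MeasurableEquiv.piEquivPiSubtypeProd (fun _ : ι => ℂ) (fun i => i = i₀)) volume
        ((volume : Measure ({i : ι // i = i₀} → ℂ)).prod (volume : Measure (J → ℂ))) := by
      convert volume_preserving_piEquivPiSubtypeProd (fun _ : ι => ℂ) (fun i => i = i₀)
      · rfl
      · refine (Measure.volume_eq_prod _ _).symm.trans ?_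
        congr!
    exact h1.comp h2
  -- The cone condition solved for the distinguished coordinate: it reads `κ * S ≤ ‖z i₀‖ ^ 2`.
  set κ : ℝ := (1 - R ^ 2) / R ^ 2 with hκ
  have hR2 : R ^ 2 ≤ 1 := pow_le_one₀ hR.le hR1
  have hκ0 : 0 ≤ κ := div_nonneg (by linarith) (by positivity)
  have hκ1 : κ + 1 = 1 / R ^ 2 := by rw [hκ]; field_simp; ring
  let S : (J → ℂ) → ℝ := fun w => ∑ j, ‖w j‖ ^ 2
  have hS : Measurable S := by fun_prop
  have hS0 : ∀ w, 0 ≤ S w := fun w => Finset.sum_nonneg fun _ _ => sq_nonneg _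
  let F : ℂ × (J → ℂ) → ℝ≥0∞ := fun x =>
    {x : ℂ × (J → ℂ) | κ * S x.2 ≤ ‖x.1‖ ^ 2}.indicator
      (fun x => ENNReal.ofReal (Real.exp (-‖x.1‖ ^ 2)) * ENNReal.ofReal (Real.exp (-S x.2))) x
  have hF : Measurable F := by
    refine Measurable.indicator (by fun_prop) (measurableSet_le ?_ ?_) <;> fun_prop
  have hsum : ∀ z : ι → ℂ, ∑ i, ‖z i‖ ^ 2 = ‖z i₀‖ ^ 2 + S (fun j : J => z j) := by
    intro z
    rw [← Finset.add_sum_erase _ _ (Finset.mem_univ i₀)]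
    congr 1
    exact Finset.sum_subtype _ (by simp) _
  have hdot : ∀ z : ι → ℂ, star (Pi.single i₀ (1 : ℂ)) ⬝ᵥ z = z i₀ := by
    intro z
    rw [← Pi.single_star, star_one, single_dotProduct, one_mul]
  have hpt : ∀ z : ι → ℂ, (cone (Pi.single i₀ 1) R).indicator
      (fun z => ENNReal.ofReal (Real.exp (-∑ i, ‖z i‖ ^ 2))) z = F (z i₀, fun j : J => z j) := by
    intro z
    have hiff : z ∈ cone (Pi.single i₀ 1) R ↔
        (z i₀, fun j : J => z j) ∈ {x : ℂ × (J → ℂ) | κ * S x.2 ≤ ‖x.1‖ ^ 2} := by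
      change (1 - R ^ 2) * ∑ i, ‖z i‖ ^ 2 ≤ ‖star (Pi.single i₀ (1 : ℂ)) ⬝ᵥ z‖ ^ 2 ↔
        κ * S (fun j : J => z j) ≤ ‖z i₀‖ ^ 2
      rw [hdot, hsum, hκ, div_mul_eq_mul_div, div_le_iff₀ (by positivity)]
      constructor <;> intro h <;> linarith
    by_cases h : z ∈ cone (Pi.single i₀ 1) R
    · rw [Set.indicator_of_mem h]
      refine Eq.trans ?_ (Set.indicator_of_mem (hiff.1 h) _).symm
      rw [← ENNReal.ofReal_mul (Real.exp_pos _).le, ← Real.exp_add, hsum, neg_add]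
    · rw [Set.indicator_of_notMem h]
      exact (Set.indicator_of_notMem (fun h' => h (hiff.2 h')) _).symm
  have hcard : Fintype.card ι - 1 = Fintype.card J := by
    rw [Fintype.card_subtype_compl, Fintype.card_subtype_eq]
  have hcard' : Fintype.card ι = Fintype.card J + 1 := by
    have : 0 < Fintype.card ι := Fintype.card_pos_iff.2 ⟨i₀⟩
    omega
  rw [gaussian, withDensity_apply _ (measurableSet_cone _ _), ← lintegral_indicator
    (measurableSet_cone _ _)]
  simp only [hpt]
  rw [hmp.lintegral_comp hF, lintegral_prod_symm' _ hF]
  have hinner : ∀ w : J → ℂ, ∫⁻ a : ℂ, F (a, w) =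
      ENNReal.ofReal Real.pi * ENNReal.ofReal (Real.exp (-(κ + 1) * S w)) := by
    intro w
    have h1 : ∀ a : ℂ, F (a, w) = {a : ℂ | κ * S w ≤ ‖a‖ ^ 2}.indicator
        (fun a => ENNReal.ofReal (Real.exp (-1 * ‖a‖ ^ 2))) a *
          ENNReal.ofReal (Real.exp (-S w)) := by
      intro a
      by_cases h : κ * S w ≤ ‖a‖ ^ 2
      · rw [Set.indicator_of_mem (s := {a : ℂ | κ * S w ≤ ‖a‖ ^ 2}) h, neg_one_mul]
        exact Set.indicator_of_mem (s := {x : ℂ × (J → ℂ) | κ * S x.2 ≤ ‖x.1‖ ^ 2})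
          (a := (a, w)) h _
      · rw [Set.indicator_of_notMem (s := {a : ℂ | κ * S w ≤ ‖a‖ ^ 2}) h, zero_mul]
        exact Set.indicator_of_notMem (s := {x : ℂ × (J → ℂ) | κ * S x.2 ≤ ‖x.1‖ ^ 2})
          (a := (a, w)) h _
    simp only [h1]
    rw [lintegral_mul_const' _ _ ENNReal.ofReal_ne_top,
      lintegral_complex_indicator_exp_neg_mul_sq one_pos (mul_nonneg hκ0 (hS0 w)),
      ← ENNReal.ofReal_mul (by positivity), ← ENNReal.ofReal_mul (by positivity), mul_assoc,
      ← Real.exp_add, div_one]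
    congr 3
    ring
  simp only [hinner]
  rw [lintegral_const_mul' _ _ ENNReal.ofReal_ne_top,
    lintegral_pi_exp_neg_mul_sq (by linarith : 0 < κ + 1), hκ1, hcard, hcard',
    ← ENNReal.ofReal_mul (by positivity)]
  congr 1
  rw [one_div, div_inv_eq_mul, mul_pow, pow_succ]
  ring

/-! ## The volume of balls of pure states -/

theorem star_dotProduct_self_eq_sum {ι : Type*} [Fintype ι] (z : ι → ℂ) :
    star z ⬝ᵥ z = ((∑ i, ‖z i‖ ^ 2 : ℝ) : ℂ) := by
  rw [dotProduct, Complex.ofReal_sum]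
  refine Finset.sum_congr rfl fun i _ => ?_
  rw [Pi.star_apply, mul_comm, RCLike.star_def, Complex.mul_conj, Complex.normSq_eq_norm_sq]

theorem star_mulVec_dotProduct_mulVec {ι : Type*} [Fintype ι] [DecidableEq ι]
    (U : unitaryGroup ι ℂ) (v w : ι → ℂ) :
    star ((U : Matrix ι ι ℂ) *ᵥ v) ⬝ᵥ ((U : Matrix ι ι ℂ) *ᵥ w) = star v ⬝ᵥ w := by
  have hU : (U : Matrix ι ι ℂ)ᴴ * (U : Matrix ι ι ℂ) = 1 := UnitaryGroup.star_mul_self U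
  rw [star_mulVec, dotProduct_mulVec, vecMul_vecMul, hU, vecMul_one]

theorem sum_norm_sq_mulVec {ι : Type*} [Fintype ι] [DecidableEq ι] (U : unitaryGroup ι ℂ)
    (z : ι → ℂ) : ∑ i, ‖((U : Matrix ι ι ℂ) *ᵥ z) i‖ ^ 2 = ∑ i, ‖z i‖ ^ 2 := by
  have h := star_mulVec_dotProduct_mulVec U z z
  rw [star_dotProduct_self_eq_sum, star_dotProduct_self_eq_sum] at h
  exact_mod_cast h

/-- The real determinant of a complex-linear map is the squared modulus of its complex determinant,
here `1`. -/
theorem measurePreserving_mulVec {ι : Type*} [Fintype ι] [DecidableEq ι]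
    (U : unitaryGroup ι ℂ) :
    MeasurePreserving (fun z : ι → ℂ => (U : Matrix ι ι ℂ) *ᵥ z) volume volume := by
  let f : (ι → ℂ) →ₗ[ℝ] (ι → ℂ) := (toLin' (U : Matrix ι ι ℂ)).restrictScalars ℝ
  have hdet : LinearMap.det f = 1 := by
    rw [LinearMap.det_restrictScalars, LinearMap.det_toLin', Algebra.norm_complex_eq]
    have h1 := (Unitary.mem_iff.1 (det_of_mem_unitary U.2)).2
    rw [RCLike.star_def, Complex.mul_conj] at h1
    exact_mod_cast h1
  have h := Measure.map_linearMap_addHaar_eq_smul_addHaar (volume : Measure (ι → ℂ)) (f := f)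
    (by rw [hdet]; exact one_ne_zero)
  rw [hdet, inv_one, abs_one, ENNReal.ofReal_one, one_smul] at h
  exact ⟨by fun_prop, h⟩

theorem gaussian_preimage_mulVec {ι : Type*} [Fintype ι] [DecidableEq ι] (U : unitaryGroup ι ℂ)
    {S : Set (ι → ℂ)} (hS : MeasurableSet S) :
    gaussian ι ((fun z => (U : Matrix ι ι ℂ) *ᵥ z) ⁻¹' S) = gaussian ι S := by
  have hmp := measurePreserving_mulVec U
  rw [gaussian, withDensity_apply _ hS, withDensity_apply _ (hmp.measurable hS),
    ← hmp.setLIntegral_comp_preimage hS (measurable_gaussian_density ι)]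
  simp only [sum_norm_sq_mulVec]

/-- The isometry from the line of `v` to the line of `w` sending `v` to `w` extends to the whole
finite-dimensional space. -/
theorem exists_mulVec_eq {ι : Type*} [Fintype ι] [DecidableEq ι] {v w : ι → ℂ}
    (hv : star v ⬝ᵥ v = 1) (hw : star w ⬝ᵥ w = 1) :
    ∃ U : unitaryGroup ι ℂ, (U : Matrix ι ι ℂ) *ᵥ v = w := by
  have hnorm : ∀ {x : ι → ℂ}, star x ⬝ᵥ x = 1 → ‖WithLp.toLp 2 x‖ = 1 := by
    intro x hx
    rw [star_dotProduct_self_eq_sum] at hx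
    have h1 : ‖WithLp.toLp 2 x‖ ^ 2 = 1 := by
      rw [EuclideanSpace.norm_sq_eq]
      exact_mod_cast hx
    exact (pow_eq_one_iff_of_nonneg (norm_nonneg _) two_ne_zero).1 h1
  let e := LinearIsometryEquiv.toSpanUnitSingleton (𝕜 := ℂ) (WithLp.toLp 2 v) (hnorm hv)
  let f := (LinearIsometry.toSpanSingleton ℂ (EuclideanSpace ℂ ι) (hnorm hw)).comp
    e.symm.toLinearIsometry
  let g := f.extend.toLinearIsometryEquiv rfl
  have hg : g (WithLp.toLp 2 v) = WithLp.toLp 2 w := by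
    have h1 : ((e 1 : _) : EuclideanSpace ℂ ι) = WithLp.toLp 2 v := by
      simp [e]
    have h2 : f (e 1) = WithLp.toLp 2 w := by
      simp [f]
    rw [← h2, ← f.extend_apply, h1]
    rfl
  let u := Unitary.linearIsometryEquiv.symm g
  have hu : (toEuclideanCLM (𝕜 := ℂ) (n := ι)).symm (u : _ →L[ℂ] _) ∈ unitaryGroup ι ℂ :=
    Unitary.map_mem (toEuclideanCLM (𝕜 := ℂ) (n := ι)).symm u.2
  refine ⟨⟨_, hu⟩, ?_⟩
  have h3 := toEuclideanCLM_toLp ((toEuclideanCLM (𝕜 := ℂ) (n := ι)).symm (u : _ →L[ℂ] _)) v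
  rw [StarAlgEquiv.apply_symm_apply] at h3
  have h4 : (u : EuclideanSpace ℂ ι →L[ℂ] EuclideanSpace ℂ ι) (WithLp.toLp 2 v) =
      WithLp.toLp 2 w := hg
  rw [h4] at h3
  exact (congrArg WithLp.ofLp h3).symm

theorem smul_mem_cone_iff {ι : Type*} [Fintype ι] {w z : ι → ℂ} {R : ℝ} {c : ℂ} (hc : c ≠ 0) :
    c • z ∈ cone w R ↔ z ∈ cone w R := by
  have hc2 : 0 < ‖c‖ ^ 2 := by positivity
  have h1 : ∑ i, ‖(c • z) i‖ ^ 2 = ‖c‖ ^ 2 * ∑ i, ‖z i‖ ^ 2 := by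
    rw [Finset.mul_sum]
    refine Finset.sum_congr rfl fun i _ => ?_
    rw [Pi.smul_apply, norm_smul, mul_pow]
  have h2 : ‖star w ⬝ᵥ (c • z)‖ ^ 2 = ‖c‖ ^ 2 * ‖star w ⬝ᵥ z‖ ^ 2 := by
    rw [dotProduct_smul, norm_smul, mul_pow]
  change (1 - R ^ 2) * ∑ i, ‖(c • z) i‖ ^ 2 ≤ ‖star w ⬝ᵥ (c • z)‖ ^ 2 ↔
    (1 - R ^ 2) * ∑ i, ‖z i‖ ^ 2 ≤ ‖star w ⬝ᵥ z‖ ^ 2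
  rw [h1, h2, mul_left_comm, mul_le_mul_iff_right₀ hc2]

/-- The unitaries that map the vector `z` into the cone around `w`. -/
def intoCone (w z : Basis q n → ℂ) (R : ℝ) : Set (UnitaryOp q n) :=
  {U | (U : Matrix (Basis q n) (Basis q n) ℂ) *ᵥ z ∈ cone w R}

/-- Cones are invariant under scaling and unitaries act transitively on unit vectors, so right
invariance reduces every `z ≠ 0` to `w`. -/
theorem haarUnit_intoCone {w z : Basis q n → ℂ} (hw : star w ⬝ᵥ w = 1) (hz : z ≠ 0) (R : ℝ) :
    haarUnit q n (intoCone w z R) = haarUnit q n (intoCone w w R) := by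
  have hs0 : 0 < ∑ i, ‖z i‖ ^ 2 := by
    obtain ⟨i, hi⟩ := Function.ne_iff.1 hz
    have : 0 < ‖z i‖ := norm_pos_iff.2 hi
    exact Finset.sum_pos' (fun _ _ => sq_nonneg _) ⟨i, Finset.mem_univ i, by positivity⟩
  obtain ⟨s, hs⟩ : ∃ s : ℝ, s = Real.sqrt (∑ i, ‖z i‖ ^ 2) := ⟨_, rfl⟩
  have hspos : 0 < s := hs ▸ Real.sqrt_pos.2 hs0
  have hsC : (s : ℂ) ≠ 0 := by exact_mod_cast hspos.ne'
  have hs2 : s * s = ∑ i, ‖z i‖ ^ 2 := hs ▸ Real.mul_self_sqrt hs0.le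
  have hunit : star ((s : ℂ)⁻¹ • z) ⬝ᵥ ((s : ℂ)⁻¹ • z) = 1 := by
    rw [star_smul, smul_dotProduct, dotProduct_smul, star_dotProduct_self_eq_sum, ← hs2,
      RCLike.star_def, map_inv₀, Complex.conj_ofReal, smul_eq_mul, smul_eq_mul]
    push_cast
    field_simp
  obtain ⟨W, hW⟩ := exists_mulVec_eq hw hunit
  have hset : intoCone w z R = (fun U => U * W) ⁻¹' intoCone w w R := by
    ext U
    change (U : Matrix (Basis q n) (Basis q n) ℂ) *ᵥ z ∈ cone w R ↔
      ((U * W : UnitaryOp q n) : Matrix (Basis q n) (Basis q n) ℂ) *ᵥ w ∈ cone w R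
    rw [Submonoid.coe_mul, ← mulVec_mulVec, hW, mulVec_smul, smul_mem_cone_iff (inv_ne_zero hsC)]
  rw [hset, measure_preimage_mul_right]

/-- Measure the pairs `(U, z)` with `U z` in the cone in both orders: for fixed `U` the Gaussian is
invariant, and for almost every fixed `z` the Haar measure does not depend on `z`. -/
theorem gaussian_cone_eq_mul {w : Basis q n → ℂ} (hw : star w ⬝ᵥ w = 1) (R : ℝ) :
    gaussian (Basis q n) (cone w R) =
      haarUnit q n (intoCone w w R) * gaussian (Basis q n) Set.univ := by
  have : SFinite (gaussian (Basis q n)) := by unfold gaussian; infer_instance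
  have hcont : Continuous fun x : UnitaryOp q n × (Basis q n → ℂ) =>
      (x.1 : Matrix (Basis q n) (Basis q n) ℂ) *ᵥ x.2 :=
    (continuous_subtype_val.comp continuous_fst).matrix_mulVec continuous_snd
  have hA : MeasurableSet {x : UnitaryOp q n × (Basis q n → ℂ) |
      (x.1 : Matrix (Basis q n) (Basis q n) ℂ) *ᵥ x.2 ∈ cone w R} :=
    hcont.measurable (measurableSet_cone w R)
  have h1 := Measure.prod_apply (μ := haarUnit q n) (ν := gaussian (Basis q n)) hA
  have h2 := Measure.prod_apply_symm (μ := haarUnit q n) (ν := gaussian (Basis q n)) hA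
  have hne : ∀ᵐ z ∂gaussian (Basis q n), z ≠ 0 := by
    have hac : gaussian (Basis q n) ≪ volume := withDensity_absolutelyContinuous _ _
    have : Nonempty (Basis q n) := by
      by_contra h
      rw [not_nonempty_iff] at h
      simp [dotProduct] at hw
    refine hac.ae_le ?_
    rw [mem_ae_iff, Set.compl_ofPred]
    simp
  have h3 : ∀ U : UnitaryOp q n, gaussian (Basis q n) (Prod.mk U ⁻¹'
      {x : UnitaryOp q n × (Basis q n → ℂ) |
        (x.1 : Matrix (Basis q n) (Basis q n) ℂ) *ᵥ x.2 ∈ cone w R}) =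
      gaussian (Basis q n) (cone w R) := fun U =>
    gaussian_preimage_mulVec U (measurableSet_cone w R)
  have h4 : ∀ᵐ z ∂gaussian (Basis q n), haarUnit q n ((fun U => (U, z)) ⁻¹'
      {x : UnitaryOp q n × (Basis q n → ℂ) |
        (x.1 : Matrix (Basis q n) (Basis q n) ℂ) *ᵥ x.2 ∈ cone w R}) =
      haarUnit q n (intoCone w w R) := by
    filter_upwards [hne] with z hz using haarUnit_intoCone hw hz R
  rw [lintegral_congr h3, lintegral_const, measure_univ, mul_one] at h1
  rw [lintegral_congr_ae h4, lintegral_const] at h2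
  exact h1.symm.trans h2

theorem gaussian_cone {ι : Type*} [Fintype ι] [DecidableEq ι] {w : ι → ℂ}
    (hw : star w ⬝ᵥ w = 1) {R : ℝ} (hR : 0 < R) (hR1 : R ≤ 1) :
    gaussian ι (cone w R) =
      ENNReal.ofReal (Real.pi ^ Fintype.card ι * (R ^ 2) ^ (Fintype.card ι - 1)) := by
  obtain ⟨i₀⟩ : Nonempty ι := by
    by_contra h
    rw [not_nonempty_iff] at h
    simp [dotProduct] at hw
  have he : star (Pi.single i₀ (1 : ℂ)) ⬝ᵥ Pi.single i₀ (1 : ℂ) = 1 := by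
    rw [← Pi.single_star, star_one, single_dotProduct, Pi.single_eq_same, one_mul]
  obtain ⟨U, hU⟩ := exists_mulVec_eq he hw
  rw [← gaussian_cone_single i₀ hR hR1, ← gaussian_preimage_mulVec U (measurableSet_cone w R)]
  congr 1
  ext z
  change (1 - R ^ 2) * ∑ i, ‖((U : Matrix ι ι ℂ) *ᵥ z) i‖ ^ 2 ≤
      ‖star w ⬝ᵥ ((U : Matrix ι ι ℂ) *ᵥ z)‖ ^ 2 ↔
    (1 - R ^ 2) * ∑ i, ‖z i‖ ^ 2 ≤ ‖star (Pi.single i₀ (1 : ℂ)) ⬝ᵥ z‖ ^ 2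
  rw [sum_norm_sq_mulVec, ← hU, star_mulVec_dotProduct_mulVec]

theorem haarUnit_intoCone_self {w : Basis q n → ℂ} (hw : star w ⬝ᵥ w = 1) {R : ℝ}
    (hR : 0 < R) (hR1 : R ≤ 1) :
    haarUnit q n (intoCone w w R) = ENNReal.ofReal ((R ^ 2) ^ (q ^ n - 1)) := by
  -- Radius `1` gives the total Gaussian mass, so the unnormalized weight divides out.
  have huniv : cone w 1 = Set.univ := by
    ext z
    change (1 - (1 : ℝ) ^ 2) * ∑ i, ‖z i‖ ^ 2 ≤ ‖star w ⬝ᵥ z‖ ^ 2 ↔ _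
    simp
  have h1 := gaussian_cone hw one_pos le_rfl
  have h2 := gaussian_cone hw hR hR1
  rw [huniv, card_basis, one_pow, one_pow, mul_one] at h1
  rw [gaussian_cone_eq_mul hw, h1, card_basis, mul_comm, ENNReal.ofReal_mul (by positivity)] at h2
  refine (ENNReal.mul_right_inj ?_ ENNReal.ofReal_ne_top).1 h2
  have : 0 < Real.pi ^ q ^ n := by positivity
  simpa using this

/-- By the overlap formula for the trace distance, `U` maps `ψ` into the ball exactly when it maps a
representing vector into the cone. -/
theorem stateVol_eq (ψ : PureState q n) {R : ℝ} (hR : 0 < R) (hR1 : R ≤ 1) :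
    stateVol ψ R = ENNReal.ofReal ((R ^ 2) ^ (q ^ n - 1)) := by
  obtain ⟨w, hw, hψ⟩ := ψ.2
  rw [stateVol, stateMeasure, Measure.map_apply (measurable_applyState_left ψ)
    (isClosed_stateBall ψ R).measurableSet, ← haarUnit_intoCone_self hw hR hR1]
  have hset : (fun U => applyState U ψ) ⁻¹' stateBall ψ R = intoCone w w R := by
    ext U
    have hU : star ((U : Matrix (Basis q n) (Basis q n) ℂ) *ᵥ w) ⬝ᵥ
        ((U : Matrix (Basis q n) (Basis q n) ℂ) *ᵥ w) = 1 := by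
      rw [star_mulVec_dotProduct_mulVec, hw]
    have hUψ : (applyState U ψ).1 = vecMulVec ((U : Matrix (Basis q n) (Basis q n) ℂ) *ᵥ w)
        (star ((U : Matrix (Basis q n) (Basis q n) ℂ) *ᵥ w)) := by
      rw [applyState_coe, hψ, star_mulVec, mul_vecMulVec, vecMulVec_mul]
    have hsum : ∑ i, ‖w i‖ ^ 2 = 1 := by
      have := hw
      rw [star_dotProduct_self_eq_sum] at this
      exact_mod_cast this
    have hsymm : ‖star ((U : Matrix (Basis q n) (Basis q n) ℂ) *ᵥ w) ⬝ᵥ w‖ =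
        ‖star w ⬝ᵥ ((U : Matrix (Basis q n) (Basis q n) ℂ) *ᵥ w)‖ := by
      rw [← norm_star, star_dotProduct, star_star, dotProduct_comm]
    change stateDist (applyState U ψ) ψ ≤ R ↔
      (1 - R ^ 2) * ∑ i, ‖((U : Matrix (Basis q n) (Basis q n) ℂ) *ᵥ w) i‖ ^ 2 ≤
        ‖star w ⬝ᵥ ((U : Matrix (Basis q n) (Basis q n) ℂ) *ᵥ w)‖ ^ 2
    rw [(stateDist_eq_sqrt _ _ hU hw hUψ hψ).2, sum_norm_sq_mulVec, hsum, mul_one, hsymm,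
      Real.sqrt_le_left hR.le]
    constructor <;> intro h <;> linarith
  rw [hset]

/-! ## Recurrence of the complexity of pure states -/

theorem stateEquidistributed_preimage {α β ε : ℝ} {μ : Measure (UnitaryOp q n)}
    {x : PureState q n} (h : StateEquidistributed α β ε (stateMeasure μ x)) (y : PureState q n) :
    stateVol y (α * ε) ≤ μ {V | stateDist (applyState V x) y ≤ ε} ∧
      μ {V | stateDist (applyState V x) y ≤ ε} ≤ stateVol y (β * ε) := by
  have h1 := h.2.2.2 y ε le_rfl
  rw [stateMeasure, Measure.map_apply (measurable_applyState_left x)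
    (isClosed_stateBall y ε).measurableSet] at h1
  exact h1

theorem measurableSet_stateDist_le (y : PureState q n) (ε : ℝ) :
    MeasurableSet {x | stateDist x y ≤ ε} :=
  (isClosed_stateBall y ε).measurableSet

/-- Bernoulli's inequality after `α / β ≥ (1 - x) / (1 + x) ≥ 1 - 2 * x`. -/
theorem one_sub_le_div_pow {x α β : ℝ} {m : ℕ} (hx1 : 4 * x ≤ 1)
    (hα : 1 - x ≤ α) (hβ1 : 1 ≤ β) (hβ : β ≤ 1 + x) : 1 - 2 * m * x ≤ (α / β) ^ m := by
  have hx : 0 ≤ x := by linarith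
  have hαβ : 1 - 2 * x ≤ α / β := by
    rw [le_div_iff₀ (by linarith)]
    nlinarith
  have h1 := one_add_mul_le_pow (a := -(2 * x)) (by linarith) m
  calc 1 - 2 * m * x = 1 + m * -(2 * x) := by ring
    _ ≤ (1 + -(2 * x)) ^ m := h1
    _ ≤ (α / β) ^ m := pow_le_pow_left₀ (by linarith) (by linarith) m

theorem state_recurrence (hq : 2 ≤ q) (hn : 1 ≤ n) (ψ₀ : PureState q n)
    (G : Finset (UnitaryOp q n)) (hG : 3 ≤ G.card) (ν : Measure (UnitaryOp q n))
    [IsProbabilityMeasure ν] {ε Δ α β : ℝ} {T : ℕ} (hε : 0 < ε) (hε4 : ε < 1 / 4) (hΔ : 0 < Δ)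
    (hΔ1 : Δ < 1)
    (heq : ∀ φ : PureState q n, StateEquidistributed α β ε (stateMeasure (convPow ν T) φ))
    (hΓ : max (1 - α) (β - 1) ≤ Δ / (24 * (q : ℝ) ^ n)) {t : ℕ} (ht : 2 * T < t) :
    stepsLaw ν {ω | stateTrajectory G ψ₀ ε ω t = 0} ≠ 0 ∧
      ENNReal.ofReal (1 - 3 / 2 * Δ) ≤
        ProbabilityTheory.cond (stepsLaw ν) {ω | stateTrajectory G ψ₀ ε ω t = 0}
          {ω | (stateThreshold (q ^ n) G.card β ε Δ : EReal) <
              natEReal (stateTrajectory G ψ₀ ε ω (t - T)) ∧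
            (stateThreshold (q ^ n) G.card β ε Δ : EReal) <
              natEReal (stateTrajectory G ψ₀ ε ω (t + T))} := by
  obtain ⟨hα, hα1, hβ1, -⟩ := heq ψ₀
  obtain ⟨D, hD⟩ : ∃ D, D = q ^ n - 1 := ⟨_, rfl⟩
  have hd2 := two_le_pow hq hn
  have hdD : q ^ n = D + 1 := by omega
  have hdD' : (q : ℝ) ^ n = D + 1 := by exact_mod_cast hdD
  obtain ⟨x, hx⟩ : ∃ x, x = Δ / (24 * (q : ℝ) ^ n) := ⟨_, rfl⟩
  rw [← hx] at hΓ
  have hD0 : (0 : ℝ) ≤ D := by positivity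
  have hxD : 24 * (D + 1) * x = Δ := by
    rw [hx, hdD']
    field_simp
  have hx0 : 0 < x := by
    rw [hx, hdD']
    positivity
  have hDx : 0 ≤ D * x := by positivity
  have hα' : 1 - x ≤ α := by linarith [le_max_left (1 - α) (β - 1)]
  have hβ' : β ≤ 1 + x := by linarith [le_max_right (1 - α) (β - 1)]
  have hx24 : 24 * x ≤ 1 := by linarith
  have hβ0 : 0 < β := by linarith
  have hβε : 0 < β * ε := by positivity
  have hβε1 : β * ε ≤ 1 := by nlinarith
  have hαε : 0 < α * ε := by positivity
  have hαε1 : α * ε ≤ 1 := by nlinarith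
  have hvolα : ∀ y : PureState q n, stateVol y (α * ε) =
      ENNReal.ofReal (((α * ε) ^ 2) ^ D) := fun y => by rw [stateVol_eq y hαε hαε1, ← hD]
  have hvolβ : ∀ y : PureState q n, stateVol y (β * ε) =
      ENNReal.ofReal (((β * ε) ^ 2) ^ D) := fun y => by rw [stateVol_eq y hβε hβε1, ← hD]
  have hlow : ∀ z y : PureState q n, ENNReal.ofReal (((α * ε) ^ 2) ^ D) ≤
      convPow ν T {V | stateDist (applyState V z) y ≤ ε} := fun z y => by
    rw [← hvolα y]
    exact (stateEquidistributed_preimage (heq z) y).1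
  have hup : ∀ z y : PureState q n, convPow ν T {V | stateDist (applyState V z) y ≤ ε} ≤
      ENNReal.ofReal (((β * ε) ^ 2) ^ D) := fun z y => by
    rw [← hvolβ y]
    exact (stateEquidistributed_preimage (heq z) y).2
  have hρinv := one_sub_le_div_pow (m := 2 * D) (by linarith) hα' hβ1 hβ'
  have hρ1 : (β / α) ^ (2 * D) * (α / β) ^ (2 * D) = 1 := by
    rw [← mul_pow, div_mul_div_cancel₀ hα.ne', div_self hβ0.ne', one_pow]
  have hratio : ((β * ε) ^ 2) ^ D = (β / α) ^ (2 * D) * ((α * ε) ^ 2) ^ D := by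
    rw [← pow_mul, ← pow_mul, ← mul_pow]
    congr 1
    field_simp
  have hρ0 : 0 < (β / α) ^ (2 * D) := by positivity
  obtain ⟨ρ, hρ⟩ : ∃ ρ, ρ = (β / α) ^ (2 * D) := ⟨_, rfl⟩
  rw [← hρ] at hρ1 hratio hρ0
  -- The loss is `4 * D * x`, and `24 * (D + 1) * x = Δ`: this is the use of the `24 d` in the
  -- hypothesis.
  have hle : 1 - Δ / 6 ≤ (α / β) ^ (2 * D) := by
    refine le_trans ?_ hρinv
    push_cast
    nlinarith
  have hρle : ρ * (1 - Δ / 6) ≤ 1 :=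
    (mul_le_mul_of_nonneg_left hle hρ0.le).trans_eq hρ1
  -- With `p = 3 / 4 * Δ` this is equivalent to `1 - 3 / 2 * Δ ≤ (1 - p) * (1 - p * ρ)`: the term `p
  -- ^ 2 * ρ` pays for the excess of `ρ` over `1`.
  have hρle' : ρ * (1 - 3 / 4 * Δ) ≤ 1 := by nlinarith
  have hρ65 : ρ ≤ 6 / 5 := by nlinarith
  exact le_cond_lt_orbitComplexity (act := applyState)
    (dist := stateDist) (G := G) (x₀ := ψ₀) (ε := ε) ν measurable_applyState applyState_mul
    applyState_one (fun y => measurableSet_stateDist_le y ε) (by omega) ht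
    (r := stateThreshold (q ^ n) G.card β ε Δ)
    (v := ((β * ε) ^ 2) ^ D) (p := 3 / 4 * Δ) (ρ := ρ)
    (c := 1 - 3 / 2 * Δ) (by positivity) (by linarith) hρ0.le (by nlinarith) (by nlinarith)
    (by positivity) (va := ENNReal.ofReal (((α * ε) ^ 2) ^ D))
    (by
      have : 0 < ((α * ε) ^ 2) ^ D := by positivity
      simpa using this)
    hlow hup (fun z y => (hup z y).trans_eq (by rw [hratio, ENNReal.ofReal_mul hρ0.le])) (by
      have hexp : stateThreshold (q ^ n) G.card β ε Δ =
          (((2 * D : ℕ) : ℝ) * Real.log (1 / (β * ε)) - Real.log (2 / Δ)) /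
            Real.log G.card := by
        rw [stateThreshold, hdD]
        push_cast
        congr 3
        ring
      rw [hexp, exp_threshold_mul (by omega) hβε hΔ]
      have hg : (3 : ℝ) ≤ G.card := by exact_mod_cast hG
      -- Three gates are needed here: together with the factor `Δ / 2` this gives `p = 3 / 4 * Δ`,
      -- whereas two gates would only give `Δ`.
      have hgg : (G.card : ℝ) / (G.card - 1) ≤ 3 / 2 := by
        rw [div_le_iff₀ (by linarith)]
        linarith
      calc (G.card : ℝ) / (G.card - 1) * ((1 / (β * ε)) ^ (2 * D) * (Δ / 2)) * ((β * ε) ^ 2) ^ D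
          ≤ 3 / 2 * ((1 / (β * ε)) ^ (2 * D) * (Δ / 2)) * ((β * ε) ^ 2) ^ D := by gcongr
        _ = 3 / 4 * Δ * ((1 / (β * ε)) * (β * ε)) ^ (2 * D) := by
            rw [mul_pow (1 / _), ← pow_mul]
            ring
        _ = 3 / 4 * Δ := by rw [one_div_mul_cancel hβε.ne', one_pow, mul_one])

theorem state_linear (ψ₀ : PureState q n) (G : Finset (UnitaryOp q n))
    (ν : Measure (UnitaryOp q n)) [IsProbabilityMeasure ν] (ε : ℝ) {k : ℕ}
    (hk : ∀ᵐ V ∂ν, ExactlyImplementable G k V ∧ ExactlyImplementable G k V⁻¹) :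
    ∀ᵐ ω ∂(stepsLaw ν), ∀ t, stateTrajectory G ψ₀ ε ω t = 0 → ∀ m,
      stateTrajectory G ψ₀ ε ω (t + m) ≤ ((k * m : ℕ) : ℕ∞) ∧
        (m ≤ t → stateTrajectory G ψ₀ ε ω (t - m) ≤ ((k * m : ℕ) : ℕ∞)) := by
  filter_upwards [ae_stepsLaw_forall ν hk] with ω hω t ht m
  exact orbitComplexity_walk_le (act := applyState) (dist := stateDist) (G := G) (x₀ := ψ₀)
    (ε := ε) applyState_mul applyState_one stateDist_applyState
    (fun V W hVW x y => by rw [applyState_eq_of_unitDist_eq_zero hVW]) hω ht m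

theorem measurableSet_stateTrajectory_eq_zero (ψ₀ : PureState q n) (G : Finset (UnitaryOp q n))
    (ε : ℝ) (t : ℕ) : MeasurableSet {ω | stateTrajectory G ψ₀ ε ω t = 0} :=
  measurableSet_orbitComplexity_eq_zero (act := applyState) (dist := stateDist) (G := G)
    (x₀ := ψ₀) (ε := ε) measurable_applyState applyState_one
    (fun y => measurableSet_stateDist_le y ε) t

/-! ## The duration of the dips -/

/-- Since `log 2 > 0.69 > 1 / 2`, the power `2 ^ n` beats `exp (n / 2)`, which in turn absorbs the
polynomial and the constant. -/
theorem eventually_exp_quarter_mul_pow_add_le (κ : ℕ) (M : ℝ) {c : ℝ} (hc : 0 < c) :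
    ∀ᶠ n : ℕ in Filter.atTop, Real.exp (1 / 4 * n) * ((n : ℝ) ^ κ * (n : ℝ) ^ κ) + M ≤
      c * 2 ^ n := by
  have hexp : ∀ {b : ℝ}, 0 < b →
      Filter.Tendsto (fun n : ℕ => Real.exp (b * n)) Filter.atTop Filter.atTop := fun hb =>
    Real.tendsto_exp_atTop.comp (tendsto_natCast_atTop_atTop.const_mul_atTop hb)
  have h1 : ∀ᶠ n : ℕ in Filter.atTop, (n : ℝ) ^ (2 * κ) ≤ Real.exp (1 / 4 * n) := by
    have h := (isLittleO_pow_exp_pos_mul_atTop (2 * κ) (by norm_num : (0 : ℝ) < 1 / 4)).bound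
      one_pos
    filter_upwards [tendsto_natCast_atTop_atTop.eventually h] with n hn
    rw [one_mul, Real.norm_of_nonneg (by positivity), Real.norm_of_nonneg (Real.exp_pos _).le] at hn
    exact hn
  have h2 := (hexp (by norm_num : (0 : ℝ) < 1 / 2)).eventually_ge_atTop M
  have h3 := (hexp (by norm_num : (0 : ℝ) < 19 / 100)).eventually_ge_atTop (2 / c)
  filter_upwards [h1, h2, h3] with n h1 h2 h3
  have h4 : Real.exp (1 / 4 * n) * ((n : ℝ) ^ κ * (n : ℝ) ^ κ) ≤ Real.exp (1 / 2 * n) := by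
    rw [← pow_add, ← two_mul]
    calc Real.exp (1 / 4 * n) * (n : ℝ) ^ (2 * κ)
        ≤ Real.exp (1 / 4 * n) * Real.exp (1 / 4 * n) := by gcongr
      _ = Real.exp (1 / 2 * n) := by rw [← Real.exp_add]; ring_nf
  have h5 : Real.exp (69 / 100 * n) ≤ 2 ^ n := by
    rw [mul_comm, Real.exp_nat_mul]
    refine pow_le_pow_left₀ (Real.exp_pos _).le ?_ n
    rw [← Real.le_log_iff_exp_le two_pos]
    linarith [Real.log_two_gt_d9]
  have h6 : 2 * Real.exp (1 / 2 * n) ≤ c * Real.exp (69 / 100 * n) := by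
    have : Real.exp (69 / 100 * n) = Real.exp (19 / 100 * n) * Real.exp (1 / 2 * n) := by
      rw [← Real.exp_add]
      ring_nf
    rw [this, ← mul_assoc]
    gcongr
    rwa [div_le_iff₀' hc] at h3
  have h7 : c * Real.exp (69 / 100 * n) ≤ c * 2 ^ n := by gcongr
  linarith

/-- Common to channels and states: `x` is the volume exponent, `ℓ = log (1 / ε)`, and `s` is the
logarithm in the threshold, comparable to `ℓ`. The quantifiers after `n` make the constants uniform.
-/
theorem eventually_threshold_bounds (hq : 2 ≤ q) (κ : ℕ) (Δ₀ : ℝ) (hΔ₀ : 0 < Δ₀) {c : ℝ}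
    (hc : 0 < c) :
    ∀ᶠ n : ℕ in Filter.atTop, ∀ {x s ℓ Δ : ℝ} {g k : ℕ}, 2 ^ n ≤ x → x ≤ ((q : ℝ) ^ n) ^ 2 →
      1 ≤ ℓ → c * ℓ ≤ s → s ≤ ℓ → Δ₀ ≤ Δ → Δ < 1 → 2 ≤ g → g ≤ n ^ κ → 1 ≤ k → k ≤ n ^ κ →
      Real.exp (1 / 4 * n) * ℓ ≤ (x * s - Real.log (2 / Δ)) / Real.log g / k ∧
        (x * s - Real.log (2 / Δ)) / Real.log g / k ≤
          Real.exp ((2 * Real.log q + 2) * n) * ℓ := by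
  filter_upwards [eventually_exp_quarter_mul_pow_add_le κ |Real.log (2 / Δ₀)| hc,
    Filter.eventually_ge_atTop 1] with n hn hn1
  intro x s ℓ Δ g k hx hxq hℓ hcs hsℓ hΔ hΔ1 hg hgn hk hkn
  have hgR : (2 : ℝ) ≤ g := by exact_mod_cast hg
  have hgnR : (g : ℝ) ≤ (n : ℝ) ^ κ := by exact_mod_cast hgn
  have hkR : (1 : ℝ) ≤ k := by exact_mod_cast hk
  have hknR : (k : ℝ) ≤ (n : ℝ) ^ κ := by exact_mod_cast hkn
  have hΔpos : 0 < Δ := hΔ₀.trans_le hΔ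
  have hx0 : 0 < x := lt_of_lt_of_le (by positivity) hx
  have hlog2 : 1 / 2 ≤ Real.log g :=
    le_trans (by linarith [Real.log_two_gt_d9]) (Real.log_le_log two_pos hgR)
  have hlogg : Real.log g ≤ (n : ℝ) ^ κ := by
    have := Real.log_le_sub_one_of_pos (by linarith : (0 : ℝ) < g)
    linarith
  have hL0 : 0 ≤ Real.log (2 / Δ) :=
    Real.log_nonneg (by rw [le_div_iff₀ hΔpos]; linarith)
  have hL : Real.log (2 / Δ) ≤ |Real.log (2 / Δ₀)| := by
    refine le_trans (Real.log_le_log (by positivity) ?_) (le_abs_self _)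
    gcongr
  rw [div_div]
  have hden : 0 < Real.log g * k := by positivity
  constructor
  · rw [le_div_iff₀ hden]
    have h1 : Real.exp (1 / 4 * n) * ℓ * (Real.log g * k) ≤
        Real.exp (1 / 4 * n) * ((n : ℝ) ^ κ * (n : ℝ) ^ κ) * ℓ := by
      calc Real.exp (1 / 4 * n) * ℓ * (Real.log g * k)
          ≤ Real.exp (1 / 4 * n) * ℓ * ((n : ℝ) ^ κ * (n : ℝ) ^ κ) := by gcongr
        _ = _ := by ring
    have h2 : |Real.log (2 / Δ₀)| ≤ |Real.log (2 / Δ₀)| * ℓ :=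
      le_mul_of_one_le_right (abs_nonneg _) hℓ
    have h3 := mul_le_mul_of_nonneg_right hn (by linarith : 0 ≤ ℓ)
    have h4 : c * 2 ^ n * ℓ ≤ x * s := by
      calc c * 2 ^ n * ℓ = 2 ^ n * (c * ℓ) := by ring
        _ ≤ x * s := by gcongr
    linarith
  · rw [div_le_iff₀ hden]
    have hs0 : 0 ≤ s := le_trans (by positivity) hcs
    have h1 : x * s ≤ ((q : ℝ) ^ n) ^ 2 * ℓ := by gcongr
    have h2 : Real.exp ((2 * Real.log q + 2) * n) = ((q : ℝ) ^ n) ^ 2 * Real.exp (2 * n) := by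
      have hq0 : (0 : ℝ) < q := by positivity
      rw [add_mul, Real.exp_add, ← pow_mul, mul_comm n 2, ← Real.exp_log (pow_pos hq0 (2 * n)),
        Real.log_pow]
      push_cast
      ring_nf
    have h3 : 2 ≤ Real.exp (2 * n) := by
      have h4 : (1 : ℝ) ≤ n := by exact_mod_cast hn1
      have := Real.add_one_le_exp (2 * n : ℝ)
      linarith
    have h5 : 1 / 2 ≤ Real.log g * k := by nlinarith
    rw [h2]
    calc x * s - Real.log (2 / Δ) ≤ ((q : ℝ) ^ n) ^ 2 * ℓ := by linarith
      _ = ((q : ℝ) ^ n) ^ 2 * 2 * ℓ * (1 / 2) := by ring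
      _ ≤ ((q : ℝ) ^ n) ^ 2 * Real.exp (2 * n) * ℓ * (Real.log g * k) := by gcongr

theorem two_pow_le_pow (hq : 2 ≤ q) (n : ℕ) : (2 : ℝ) ^ n ≤ (q : ℝ) ^ n :=
  pow_le_pow_left₀ zero_le_two (by exact_mod_cast hq) n

theorem two_le_pow_real (hq : 2 ≤ q) (hn : 1 ≤ n) : (2 : ℝ) ≤ (q : ℝ) ^ n := by
  exact_mod_cast two_le_pow hq hn

theorem unit_duration (hq : 2 ≤ q) (κ : ℕ) (Δ₀ ε₀ : ℝ) (hΔ₀ : 0 < Δ₀) (hε₀ : 0 < ε₀)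
    (hε₀' : ε₀ < 1 / cUp) :
    ∀ᶠ n : ℕ in Filter.atTop, ∀ {ε Δ α β : ℝ} {g k : ℕ}, 0 < ε → ε ≤ ε₀ → Δ₀ ≤ Δ → Δ < 1 →
      2 ≤ g → g ≤ n ^ κ → 1 ≤ k → k ≤ n ^ κ → 1 ≤ β →
      max (1 - α) (β - 1) ≤ Δ / 6 * (cLow / 3) ^ ((q ^ n) ^ 2 - 1) →
      Real.exp (1 / 4 * n) * Real.log (1 / ε) ≤ unitThreshold (q ^ n) g β ε Δ / k ∧
        unitThreshold (q ^ n) g β ε Δ / k ≤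
          Real.exp ((2 * Real.log q + 2) * n) * Real.log (1 / ε) := by
  obtain ⟨L, hL⟩ : ∃ L, L = Real.log (1 / ε₀) := ⟨_, rfl⟩
  have hL87 : Real.log 87 < L := by
    rw [hL]
    refine Real.log_lt_log (by norm_num) ?_
    rw [cUp, lt_div_iff₀ (by norm_num)] at hε₀'
    rw [lt_div_iff₀ hε₀]
    linarith
  have h87 : 1 ≤ Real.log 87 := by
    rw [Real.le_log_iff_exp_le (by norm_num)]
    linarith [Real.exp_one_lt_d9]
  have hLpos : 0 < L := by linarith
  -- Half of the relative gap between `log (1 / ε₀)` and `log 87` serves as the lower constant; the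
  -- other half is left for `log β`.
  have hc : 0 < (L - Real.log 87) / (2 * L) := div_pos (by linarith) (by linarith)
  have hsmall : ∀ᶠ n : ℕ in Filter.atTop, (1 / 2 : ℝ) ^ n ≤ (L - Real.log 87) / 2 :=
    (tendsto_pow_atTop_nhds_zero_of_lt_one (by norm_num) (by norm_num)).eventually_le_const
      (by linarith)
  filter_upwards [eventually_threshold_bounds hq κ Δ₀ hΔ₀ hc, hsmall,
    Filter.eventually_ge_atTop 1] with n hn hsm hn1
  intro ε Δ α β g k hε hεε₀ hΔ hΔ1 hg hgn hk hkn hβ1 hΓ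
  have hd2 := two_le_pow_real hq hn1
  have h2d := two_pow_le_pow hq n
  have hβ0 : 0 < β := by linarith
  have hℓ : L ≤ Real.log (1 / ε) := by
    rw [hL]
    exact Real.log_le_log (by positivity) (by gcongr)
  have hlogβ : Real.log β ≤ (L - Real.log 87) / 2 := by
    obtain ⟨h1, h2⟩ := cLow_div_three_le
    have h3 : (cLow / 3) ^ ((q ^ n) ^ 2 - 1) ≤ (1 / 2) ^ n := by
      have h4 : n ≤ (q ^ n) ^ 2 - 1 := by
        have h5 : n < q ^ n := Nat.lt_pow_self (by omega)
        have h6 : q ^ n ≤ (q ^ n) ^ 2 := Nat.le_self_pow two_ne_zero _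
        omega
      calc (cLow / 3) ^ ((q ^ n) ^ 2 - 1) ≤ (cLow / 3) ^ n :=
            pow_le_pow_of_le_one h2.le (by linarith) h4
        _ ≤ (1 / 2) ^ n := pow_le_pow_left₀ h2.le (by linarith) n
    have h7 : 0 < (cLow / 3) ^ ((q ^ n) ^ 2 - 1) := pow_pos h2 _
    have h8 : Δ / 6 * (cLow / 3) ^ ((q ^ n) ^ 2 - 1) ≤ (cLow / 3) ^ ((q ^ n) ^ 2 - 1) :=
      mul_le_of_le_one_left h7.le (by linarith)
    linarith [Real.log_le_sub_one_of_pos hβ0, le_max_right (1 - α) (β - 1)]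
  have hs : Real.log (1 / (cUp * β * ε)) = Real.log (1 / ε) - Real.log 87 - Real.log β := by
    rw [cUp, one_div, one_div, Real.log_inv, Real.log_inv, Real.log_mul (by positivity) hε.ne',
      Real.log_mul (by norm_num) hβ0.ne']
    ring
  have hlogβ0 : 0 ≤ Real.log β := Real.log_nonneg hβ1
  have hbounds := hn (x := ((q : ℝ) ^ n) ^ 2 - 1) (s := Real.log (1 / (cUp * β * ε)))
    (ℓ := Real.log (1 / ε)) (by nlinarith) (by linarith) (by linarith)
    (by
      rw [hs]
      -- The subtracted `log 87 + log β` is at most `(L + log 87) / 2`, which is the fraction `1 -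
      -- c` of `L`, hence at most that fraction of `log (1 / ε)`.
      have h1 : (1 - (L - Real.log 87) / (2 * L)) * L = (L + Real.log 87) / 2 := by
        field_simp
        ring
      have h2 : (L - Real.log 87) / (2 * L) ≤ 1 := by
        rw [div_le_one (by linarith)]
        linarith
      have h3 := mul_le_mul_of_nonneg_left hℓ (sub_nonneg.2 h2)
      rw [h1] at h3
      linarith)
    (by rw [hs]; linarith) hΔ hΔ1 hg hgn hk hkn
  rw [unitThreshold]
  push_cast
  exact hbounds

theorem state_duration (hq : 2 ≤ q) (κ : ℕ) (Δ₀ : ℝ) (hΔ₀ : 0 < Δ₀) :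
    ∀ᶠ n : ℕ in Filter.atTop, ∀ {ε Δ α β : ℝ} {g k : ℕ}, 0 < ε → ε < 1 / 4 → Δ₀ ≤ Δ → Δ < 1 →
      2 ≤ g → g ≤ n ^ κ → 1 ≤ k → k ≤ n ^ κ → 1 ≤ β →
      max (1 - α) (β - 1) ≤ Δ / (24 * (q : ℝ) ^ n) →
      Real.exp (1 / 4 * n) * Real.log (1 / ε) ≤ stateThreshold (q ^ n) g β ε Δ / k ∧
        stateThreshold (q ^ n) g β ε Δ / k ≤
          Real.exp ((2 * Real.log q + 2) * n) * Real.log (1 / ε) := by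
  filter_upwards [eventually_threshold_bounds hq κ Δ₀ hΔ₀ (c := 1 / 2) (by norm_num),
    Filter.eventually_ge_atTop 1] with n hn hn1
  intro ε Δ α β g k hε hε4 hΔ hΔ1 hg hgn hk hkn hβ1 hΓ
  have hd2 := two_le_pow_real hq hn1
  have h2d := two_pow_le_pow hq n
  have hβ0 : 0 < β := by linarith
  -- As `1 / ε > 4 > e`, subtracting `log β ≤ 1 / 2` leaves at least half of `log (1 / ε)`. No
  -- upper-volume constant is subtracted, so no `ε₀` is needed.
  have hℓ : 1 ≤ Real.log (1 / ε) := by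
    rw [Real.le_log_iff_exp_le (by positivity)]
    refine Real.exp_one_lt_d9.le.trans ?_
    rw [le_div_iff₀ hε]
    linarith
  have hlogβ : Real.log β ≤ 1 / 2 := by
    have h1 : Δ / (24 * (q : ℝ) ^ n) ≤ 1 / 2 := by
      rw [div_le_iff₀ (by positivity)]
      linarith
    linarith [Real.log_le_sub_one_of_pos hβ0, le_max_right (1 - α) (β - 1)]
  have hs : Real.log (1 / (β * ε)) = Real.log (1 / ε) - Real.log β := by
    rw [one_div, one_div, Real.log_inv, Real.log_inv, Real.log_mul hβ0.ne' hε.ne']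
    ring
  have hlogβ0 : 0 ≤ Real.log β := Real.log_nonneg hβ1
  have hbounds := hn (x := 2 * (q : ℝ) ^ n - 2) (s := Real.log (1 / (β * ε)))
    (ℓ := Real.log (1 / ε)) (by linarith) (by nlinarith) hℓ (by rw [hs]; linarith)
    (by rw [hs]; linarith) hΔ hΔ1 hg hgn hk hkn
  rw [stateThreshold]
  push_cast
  exact hbounds

end Recurrence

end

/-! ### Assembly of the assertions for channels and pure states -/

theorem mainTheorem5 (q : ℕ) (hq : 2 ≤ q) :
    -- unitary channels: the complexity is large a time `T` before and after the dip
    (∀ (n : ℕ), 1 ≤ n → ∀ (G : Finset (Recurrence.UnitaryOp q n)), 2 ≤ G.card →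
      ∀ (ν : MeasureTheory.Measure (Recurrence.UnitaryOp q n)),
      MeasureTheory.IsProbabilityMeasure ν →
      ∀ (ε Δ α β : ℝ) (T : ℕ), 0 < ε → ε < 1 / 4 → 0 < Δ → Δ < 1 →
      Recurrence.UnitEquidistributed α β ε (Recurrence.convPow ν T) →
      max (1 - α) (β - 1) ≤ Δ / 6 * (Recurrence.cLow / 3) ^ ((q ^ n) ^ 2 - 1) →
      ∀ (t : ℕ), 2 * T < t → ∀ (r : ℝ), r = Recurrence.unitThreshold (q ^ n) G.card β ε Δ →
      Recurrence.stepsLaw ν {ω | Recurrence.unitTrajectory G ε ω t = 0} ≠ 0 ∧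
      ENNReal.ofReal (1 - 3 / 2 * Δ) ≤
        ProbabilityTheory.cond (Recurrence.stepsLaw ν)
          {ω | Recurrence.unitTrajectory G ε ω t = 0}
          {ω | (r : EReal) < Recurrence.natEReal (Recurrence.unitTrajectory G ε ω (t - T)) ∧
            (r : EReal) < Recurrence.natEReal (Recurrence.unitTrajectory G ε ω (t + T))}) ∧
    -- unitary channels: at most linear change of the complexity
    (∀ (n : ℕ), 1 ≤ n → ∀ (G : Finset (Recurrence.UnitaryOp q n))
      (ν : MeasureTheory.Measure (Recurrence.UnitaryOp q n)),
      MeasureTheory.IsProbabilityMeasure ν →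
      ∀ (ε : ℝ) (k : ℕ), 0 < ε → ε < 1 / 4 →
      (∀ᵐ V ∂ν, Recurrence.ExactlyImplementable G k V ∧
        Recurrence.ExactlyImplementable G k V⁻¹) →
      ∀ᵐ ω ∂(Recurrence.stepsLaw ν), ∀ (t : ℕ), Recurrence.unitTrajectory G ε ω t = 0 →
        ∀ (m : ℕ), Recurrence.unitTrajectory G ε ω (t + m) ≤ ((k * m : ℕ) : ℕ∞) ∧
          (m ≤ t → Recurrence.unitTrajectory G ε ω (t - m) ≤ ((k * m : ℕ) : ℕ∞))) ∧
    -- unitary channels: duration of the dips, with constants uniform in the number of qudits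
    (∀ (κ : ℕ) (Δ₀ ε₀ : ℝ), 0 < Δ₀ → 0 < ε₀ → ε₀ < 1 / Recurrence.cUp →
      ∃ (c₁ c₂ : ℝ) (n₀ : ℕ), 0 < c₁ ∧ 0 < c₂ ∧
      ∀ (n : ℕ), 1 ≤ n → n₀ ≤ n → ∀ (G : Finset (Recurrence.UnitaryOp q n)), 2 ≤ G.card →
      G.card ≤ n ^ κ →
      ∀ (ν : MeasureTheory.Measure (Recurrence.UnitaryOp q n)),
      MeasureTheory.IsProbabilityMeasure ν →
      ∀ (ε Δ α β : ℝ) (T k : ℕ), 0 < ε → ε ≤ ε₀ → Δ₀ ≤ Δ → Δ < 1 → 1 ≤ k → k ≤ n ^ κ →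
      (∀ᵐ V ∂ν, Recurrence.ExactlyImplementable G k V ∧
        Recurrence.ExactlyImplementable G k V⁻¹) →
      Recurrence.UnitEquidistributed α β ε (Recurrence.convPow ν T) →
      max (1 - α) (β - 1) ≤ Δ / 6 * (Recurrence.cLow / 3) ^ ((q ^ n) ^ 2 - 1) →
      ∀ (t : ℕ), 2 * T < t → ∀ (r : ℝ), r = Recurrence.unitThreshold (q ^ n) G.card β ε Δ →
      (Real.exp (c₁ * n) * Real.log (1 / ε) ≤ r / k ∧
        r / k ≤ Real.exp (c₂ * n) * Real.log (1 / ε)) ∧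
      ENNReal.ofReal (1 - 3 / 2 * Δ) ≤
        ProbabilityTheory.cond (Recurrence.stepsLaw ν)
          {ω | Recurrence.unitTrajectory G ε ω t = 0}
          {ω | Recurrence.DipLasts (Recurrence.unitTrajectory G ε ω) r t (r / k) T}) ∧
    -- pure states: the complexity is large a time `T` before and after the dip
    (∀ (n : ℕ), 1 ≤ n → ∀ (ψ₀ : Recurrence.PureState q n)
      (G : Finset (Recurrence.UnitaryOp q n)), 3 ≤ G.card →
      ∀ (ν : MeasureTheory.Measure (Recurrence.UnitaryOp q n)),
      MeasureTheory.IsProbabilityMeasure ν →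
      ∀ (ε Δ α β : ℝ) (T : ℕ), 0 < ε → ε < 1 / 4 → 0 < Δ → Δ < 1 →
      (∀ φ : Recurrence.PureState q n, Recurrence.StateEquidistributed α β ε
        (Recurrence.stateMeasure (Recurrence.convPow ν T) φ)) →
      max (1 - α) (β - 1) ≤ Δ / (24 * (q : ℝ) ^ n) →
      ∀ (t : ℕ), 2 * T < t → ∀ (r : ℝ), r = Recurrence.stateThreshold (q ^ n) G.card β ε Δ →
      Recurrence.stepsLaw ν {ω | Recurrence.stateTrajectory G ψ₀ ε ω t = 0} ≠ 0 ∧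
      ENNReal.ofReal (1 - 3 / 2 * Δ) ≤
        ProbabilityTheory.cond (Recurrence.stepsLaw ν)
          {ω | Recurrence.stateTrajectory G ψ₀ ε ω t = 0}
          {ω | (r : EReal) < Recurrence.natEReal (Recurrence.stateTrajectory G ψ₀ ε ω (t - T)) ∧
            (r : EReal) < Recurrence.natEReal (Recurrence.stateTrajectory G ψ₀ ε ω (t + T))}) ∧
    -- pure states: at most linear change of the complexity
    (∀ (n : ℕ), 1 ≤ n → ∀ (ψ₀ : Recurrence.PureState q n)
      (G : Finset (Recurrence.UnitaryOp q n)) (ν : MeasureTheory.Measure (Recurrence.UnitaryOp q n)),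
      MeasureTheory.IsProbabilityMeasure ν →
      ∀ (ε : ℝ) (k : ℕ), 0 < ε → ε < 1 / 4 →
      (∀ᵐ V ∂ν, Recurrence.ExactlyImplementable G k V ∧
        Recurrence.ExactlyImplementable G k V⁻¹) →
      ∀ᵐ ω ∂(Recurrence.stepsLaw ν), ∀ (t : ℕ), Recurrence.stateTrajectory G ψ₀ ε ω t = 0 →
        ∀ (m : ℕ), Recurrence.stateTrajectory G ψ₀ ε ω (t + m) ≤ ((k * m : ℕ) : ℕ∞) ∧
          (m ≤ t → Recurrence.stateTrajectory G ψ₀ ε ω (t - m) ≤ ((k * m : ℕ) : ℕ∞))) ∧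
    -- pure states: duration of the dips, with constants uniform in the number of qudits
    (∀ (κ : ℕ) (Δ₀ : ℝ), 0 < Δ₀ →
      ∃ (c₁ c₂ : ℝ) (n₀ : ℕ), 0 < c₁ ∧ 0 < c₂ ∧
      ∀ (n : ℕ), 1 ≤ n → n₀ ≤ n → ∀ (ψ₀ : Recurrence.PureState q n)
      (G : Finset (Recurrence.UnitaryOp q n)), 3 ≤ G.card → G.card ≤ n ^ κ →
      ∀ (ν : MeasureTheory.Measure (Recurrence.UnitaryOp q n)),
      MeasureTheory.IsProbabilityMeasure ν →
      ∀ (ε Δ α β : ℝ) (T k : ℕ), 0 < ε → ε < 1 / 4 → Δ₀ ≤ Δ → Δ < 1 → 1 ≤ k → k ≤ n ^ κ →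
      (∀ᵐ V ∂ν, Recurrence.ExactlyImplementable G k V ∧
        Recurrence.ExactlyImplementable G k V⁻¹) →
      (∀ φ : Recurrence.PureState q n, Recurrence.StateEquidistributed α β ε
        (Recurrence.stateMeasure (Recurrence.convPow ν T) φ)) →
      max (1 - α) (β - 1) ≤ Δ / (24 * (q : ℝ) ^ n) →
      ∀ (t : ℕ), 2 * T < t → ∀ (r : ℝ), r = Recurrence.stateThreshold (q ^ n) G.card β ε Δ →
      (Real.exp (c₁ * n) * Real.log (1 / ε) ≤ r / k ∧
        r / k ≤ Real.exp (c₂ * n) * Real.log (1 / ε)) ∧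
      ENNReal.ofReal (1 - 3 / 2 * Δ) ≤
        ProbabilityTheory.cond (Recurrence.stepsLaw ν)
          {ω | Recurrence.stateTrajectory G ψ₀ ε ω t = 0}
          {ω | Recurrence.DipLasts (Recurrence.stateTrajectory G ψ₀ ε ω) r t (r / k) T}) := by
  have hc₂ : 0 < 2 * Real.log q + 2 := by
    have := Real.log_natCast_nonneg q
    linarith
  refine ⟨?_, ?_, ?_, ?_, ?_, ?_⟩
  · intro n hn G hG ν hν ε Δ α β T hε hε4 hΔ hΔ1 heq hΓ t ht r hr
    subst hr
    exact Recurrence.unit_recurrence hq hn G hG ν hε hε4 hΔ hΔ1 heq hΓ ht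
  · intro n hn G ν hν ε k hε hε4 hk
    exact Recurrence.unit_linear G ν ε hk
  · intro κ Δ₀ ε₀ hΔ₀ hε₀ hε₀'
    obtain ⟨n₀, hn₀⟩ := Filter.eventually_atTop.1
      (Recurrence.unit_duration hq κ Δ₀ ε₀ hΔ₀ hε₀ hε₀')
    refine ⟨1 / 4, 2 * Real.log q + 2, n₀, by norm_num, hc₂, ?_⟩
    intro n hn hnn G hG hGn ν hν ε Δ α β T k hε hεε₀ hΔ hΔ1 hk hkn himp heq hΓ t ht r hr
    subst hr
    -- Indeed `ε ≤ ε₀ < 1 / 87`.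
    have hε4 : ε < 1 / 4 := by
      rw [Recurrence.cUp] at hε₀'
      linarith
    exact ⟨hn₀ n hnn hε hεε₀ hΔ hΔ1 hG hGn hk hkn heq.2.2.1 hΓ,
      Recurrence.le_cond_dipLasts ν hk ht (Recurrence.measurableSet_unitTrajectory_eq_zero G ε t)
        (Recurrence.unit_linear G ν ε himp)
        (Recurrence.unit_recurrence hq hn G hG ν hε hε4 (hΔ₀.trans_le hΔ) hΔ1 heq hΓ ht).2⟩
  · intro n hn ψ₀ G hG ν hν ε Δ α β T hε hε4 hΔ hΔ1 heq hΓ t ht r hr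
    subst hr
    exact Recurrence.state_recurrence hq hn ψ₀ G hG ν hε hε4 hΔ hΔ1 heq hΓ ht
  · intro n hn ψ₀ G ν hν ε k hε hε4 hk
    exact Recurrence.state_linear ψ₀ G ν ε hk
  · intro κ Δ₀ hΔ₀
    obtain ⟨n₀, hn₀⟩ := Filter.eventually_atTop.1 (Recurrence.state_duration hq κ Δ₀ hΔ₀)
    refine ⟨1 / 4, 2 * Real.log q + 2, n₀, by norm_num, hc₂, ?_⟩
    intro n hn hnn ψ₀ G hG hGn ν hν ε Δ α β T k hε hε4 hΔ hΔ1 hk hkn himp heq hΓ t ht r hr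
    subst hr
    exact ⟨hn₀ n hnn hε hε4 hΔ hΔ1 (by omega) hGn hk hkn (heq ψ₀).2.2.1 hΓ,
      Recurrence.le_cond_dipLasts ν hk ht
        (Recurrence.measurableSet_stateTrajectory_eq_zero ψ₀ G ε t)
        (Recurrence.state_linear ψ₀ G ν ε himp)
        (Recurrence.state_recurrence hq hn ψ₀ G hG ν hε hε4 (hΔ₀.trans_le hΔ) hΔ1 heq hΓ ht).2⟩
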